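/- Let $\Pi$ be a Poisson point process on $\mathbb{R}_+\times[0,1]^2$ with intensity $\mathrm{d}t\otimes\mathrm{d}x\,\mathrm{d}y$, and let $((\tau_i,x_i,y_i))_{i\ge 1}$ be its atoms, ranked in increasing order of $\tau_i$. Let $\mathrm{Quad}(0)=\{[0,1]^2\}$; at each time $\tau_i$ the rectangle whose interior contains $(x_i,y_i)$ is replaced by the four closed subrectangles into which it is cut by the vertical and the horizontal line through $(x_i,y_i)$. This defines a.s. a process $(\mathrm{Quad}(t))_{t\ge 0}$ of finite coverings of $[0,1]^2$ by closed rectangles with disjoint interiors. The unit square has generation $0$, and the four parts of a rectangle of generation $n$ have generation $n+1$. Let $\mathcal{F}_t$ be the $\sigma$-field generated by $(\mathrm{Quad}(u))_{0\le u\le t}$, let $\lambda$ be the Lebesgue measure on $[0,1]^2$, and put $\beta=\frac{\sqrt{17}-3}{2}$ and $h(u)=(u(1-u))^{\beta/2}$ for $u\in[0,1]$. A rectangle $R=[\ell,r]\times[b,c]$ is above $x\in[0,1]$ if $\ell\le x\le r$; the position of $x$ in it is then $x_R=\frac{x-\ell}{r-\ell}$. Set $$M_t(x)=\sum_{R\in\mathrm{Quad}(t),\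 R\text{ above }x}\lambda(R)^\beta h(x_R),\qquad \tilde M_n(x)=\sum_{R}\lambda(R)^\beta h(x_R),$$ where the second sum runs over all rectangles $R$ of generation $n$ above $x$ that appear in the process. Then for every $x\in[0,1]$ the process $(M_t(x))_{t\ge 0}$ is a non-negative continuous-time martingale with respect to $(\mathcal{F}_t)_{t\ge0}$. Moreover there is a random variable $\tilde M_\infty(x)$, belonging to $L^p$ for every $p\in(1,\infty)$, such that $\tilde M_n(x)\to\tilde M_\infty(x)$ as $n\to\infty$, almost surely and in $L^p$ for every $p\in(1,\infty)$, such that $M_t(x)=E[\tilde M_\infty(x)\mid\mathcal{F}_t]$ a.s. for every $t\ge0$, and such that $M_t(x)\to\tilde M_\infty(x)$ as $t\to\infty$, almost surely and in $L^p$ for every $p\in(1,\infty)$. -/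

import Mathlib

open MeasureTheory ProbabilityTheory Filter Topology
open scoped NNReal ENNReal

/-- `N` is a Poisson point process (Poisson random measure) with intensity `μ` under `P`: the
number of points in a Borel set of finite `μ`-measure is Poisson with mean this measure, and the
numbers of points in finitely many pairwise disjoint Borel sets are independent. -/
structure IsPoissonPointProcess {Ω E : Type*} [MeasurableSpace Ω] [MeasurableSpace E]
    (N : Ω → Measure E) (μ : Measure E) (P : Measure Ω) : Prop where
  measurable : Measurable N
  law : ∀ B : Set E, MeasurableSet B → ∀ r : ℝ≥0, μ B = r →
    P.map (fun ω => N ω B) = (poissonMeasure r).map (fun k : ℕ => (k : ℝ≥0∞))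
  indep : ∀ (n : ℕ) (B : Fin n → Set E), (∀ i, MeasurableSet (B i)) →
    Pairwise (Function.onFun Disjoint B) → iIndepFun (fun i ω => N ω (B i)) P

namespace Quadtree

noncomputable section

/-- The intensity `dt ⊗ dx dy` on `ℝ₊ × [0,1]²`. -/
def intensity : Measure (ℝ × ℝ × ℝ) :=
  volume.restrict (Set.Ici 0 ×ˢ (Set.Icc 0 1 ×ˢ Set.Icc 0 1))

/-- A rectangle `[left, right] × [bottom, top]` with sides parallel to the axes. -/
@[ext]
structure Rect where
  left : ℝ
  right : ℝ
  bottom : ℝ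
  top : ℝ

/-- The Borel σ-algebra of `ℝ⁴`, carried over to the space of rectangles. -/
instance : MeasurableSpace Rect :=
  MeasurableSpace.comap (fun R => (R.left, R.right, R.bottom, R.top)) inferInstance

/-- The points of the closed rectangle. -/
def Rect.carrier (R : Rect) : Set (ℝ × ℝ) :=
  Set.Icc R.left R.right ×ˢ Set.Icc R.bottom R.top

/-- The unit square `[0,1]²`. -/
def unitSquare : Rect := ⟨0, 1, 0, 1⟩

/-- The four subrectangles cut out by the vertical and the horizontal line through `p`, in
counter-clockwise order starting with the north-east one. -/
def Rect.split (R : Rect) (p : ℝ × ℝ) : Fin 4 → Rect :=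
  ![⟨p.1, R.right, p.2, R.top⟩,
    ⟨R.left, p.1, p.2, R.top⟩,
    ⟨R.left, p.1, R.bottom, p.2⟩,
    ⟨p.1, R.right, R.bottom, p.2⟩]

/-- A rectangle together with the word over a four-letter alphabet that encodes it. -/
abbrev Cell : Type := List (Fin 4) × Rect

open Classical in
/-- The effect of the point `p` on one encoded rectangle: if `p` lies in its interior, the
rectangle is replaced by its four subrectangles (the word `u` being replaced by `u1,…,u4`);
otherwise it is kept. -/
def Cell.step (p : ℝ × ℝ) (c : Cell) : Finset Cell :=
  if p ∈ interior c.2.carrier then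
    Finset.univ.image (fun j : Fin 4 => (c.1 ++ [j], c.2.split p j))
  else {c}

open Classical in
/-- The encoded rectangles of the quadtree after the insertion of the first `k` of the
points `p 0, p 1, …`. -/
def cellsAfter (p : ℕ → ℝ × ℝ) : ℕ → Finset Cell
  | 0 => {([], unitSquare)}
  | k + 1 => (cellsAfter p k).biUnion (Cell.step (p k))

/-- The number of the times `τ 0, τ 1, …` that are at most `t`. -/
def numAtoms (τ : ℕ → ℝ) (t : ℝ≥0) : ℕ := {i | τ i ≤ t}.ncard

open Classical in
/-- The covering `Quad(t)` of the unit square, for atoms `(τ i, p i)` ranked by `τ`. -/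
def quad (τ : ℕ → ℝ) (p : ℕ → ℝ × ℝ) (t : ℝ≥0) : Finset Rect :=
  (cellsAfter p (numAtoms τ t)).image Prod.snd

open Classical in
/-- The σ-algebra on finite sets of rectangles generated by the numbers of elements in Borel
sets of rectangles. -/
@[reducible] def rectFinsetSigma : MeasurableSpace (Finset Rect) :=
  ⨆ B : {B : Set Rect // MeasurableSet B},
    MeasurableSpace.comap (fun s => (s.filter (· ∈ B.1)).card) ⊤

/-- The σ-field generated by `(Quad(u))_{0 ≤ u ≤ t}`. -/
@[reducible] def history {Ω : Type*} (τ : ℕ → Ω → ℝ) (p : ℕ → Ω → ℝ × ℝ) (t : ℝ≥0) : MeasurableSpace Ω :=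
  ⨆ u : {u : ℝ≥0 // u ≤ t},
    MeasurableSpace.comap (fun ω => quad (fun i => τ i ω) (fun i => p i ω) u.1) rectFinsetSigma

/-- The exponent `β = (√17 - 3)/2`. -/
def beta : ℝ := (Real.sqrt 17 - 3) / 2

/-- The function `h(u) = (u(1-u))^{β/2}`. -/
def h (u : ℝ) : ℝ := (u * (1 - u)) ^ (beta / 2)

/-- The rectangle is above `x`: its horizontal side contains `x`. -/
def Rect.IsAbove (R : Rect) (x : ℝ) : Prop := x ∈ Set.Icc R.left R.right

/-- The position of `x` relative to the horizontal side of the rectangle. -/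
def Rect.position (R : Rect) (x : ℝ) : ℝ := (x - R.left) / (R.right - R.left)

/-- The weight `λ(R)^β h(position of x in R)`, with `λ` the Lebesgue measure. -/
def Rect.weight (R : Rect) (x : ℝ) : ℝ :=
  (volume R.carrier).toReal ^ beta * h (R.position x)

open Classical in
/-- `M_t(x)`: the sum of the weights of the rectangles of `Quad(t)` above `x`. -/
def M (τ : ℕ → ℝ) (p : ℕ → ℝ × ℝ) (x : ℝ) (t : ℝ≥0) : ℝ :=
  ∑ R ∈ (quad τ p t).filter (fun R => R.IsAbove x), R.weight x

/-- The encoded rectangles of generation `n` above `x` that appear in the quadtree process. -/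
def generationAbove (p : ℕ → ℝ × ℝ) (x : ℝ) (n : ℕ) : Set Cell :=
  {c | (∃ k, c ∈ cellsAfter p k) ∧ c.1.length = n ∧ c.2.IsAbove x}

/-- The sum of the weights of the rectangles of generation `n` above `x`; at most one rectangle
is encoded by each word, so that the sum is finite. -/
def Mgen (p : ℕ → ℝ × ℝ) (x : ℝ) (n : ℕ) : ℝ :=
  ∑ᶠ c ∈ generationAbove p x n, c.2.weight x

end

end Quadtree

/-! For a rectangle `[l,r] × [b,t]` above `x` the width cancels from λ(R)^β h(x_R), which becomes
(t-b)^β ((x-l)(r-x))^(β/2). For this expression with any exponent γ > 0 in place of β, a cut at a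
uniform point multiplies the weight, on average, by 4/((γ+1)(γ+2))
(`setIntegral_sum_powWeight_split`). The exponent β is the positive one for which the factor is 1,
so a uniform insertion preserves the mean total weight. Squared weights have exponent 2β, for which
the factor ρ = `splitRate (2 * beta)` is less than 1.

The estimates concern the discrete chain of successive insertions, in a tree whose cells of
generation `n` are frozen (`capCells`). With `n = ⊤` this is the quadtree, and M_t(x) is the chain's
total weight W read at the number of atoms up to t. With `n` finite, almost surely every cell is
eventually split until only frozen cells are left, so the total weight becomes constant, equal to
the weight of generation `n`. Two functionals decrease on average at each insertion.

The first is the exponential of κ (W_β + W_{2β}). The quadratic term in the expansion of the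
exponential is paid for by the negative drift of W_{2β} (`setIntegral_exp_splitChange_le`). The
resulting exponential moments are bounded uniformly in `n` and in the number of insertions, which
gives all moments and uniform integrability of all powers.

The second is the square of the difference between the total weights of the free and of the capped
tree, plus a multiple of a discounted sum of squared weights (`integral_capVariance_update_le`). It
starts at order ρ^n, so the two trees differ by O(ρ^n) in mean square, uniformly in the number of
insertions. Summing over `n` shows that the generation weights converge almost surely to the limit
of the chain.

The Poisson hypothesis enters through one fact: the positions are uniform, independent of one
another and of all the times (`measure_times_positions`, `indepFun_past_position`). It is proved by
counting points in time slots of a shrinking mesh. The chain is therefore a martingale in the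
filtration that knows all times from the start. On the event that there are `k` atoms up to `t`, the
history up to `t` is contained in stage `k` of that filtration (`measurableSet_history_inter`).
Summing over `k` identifies M_t(x) as the conditional expectation of the limit
(`IsUniformInput.M_ae_eq_condExp`), and the martingale property follows by the tower rule. -/

namespace Quadtree

/-! ### The geometry of quadtree cells -/

/-- The open rectangle. -/
def Rect.inner (R : Rect) : Set (ℝ × ℝ) := Set.Ioo R.left R.right ×ˢ Set.Ioo R.bottom R.top

lemma Rect.interior_carrier (R : Rect) : interior R.carrier = R.inner := by
  rw [Rect.carrier, Rect.inner, interior_prod_eq, interior_Icc, interior_Icc]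

lemma Rect.mem_inner {R : Rect} {q : ℝ × ℝ} :
    q ∈ R.inner ↔ (R.left < q.1 ∧ q.1 < R.right) ∧ R.bottom < q.2 ∧ q.2 < R.top := by
  simp [Rect.inner, Set.mem_prod]

/-- A non-degenerate rectangle contained in the unit square. -/
structure Rect.Proper (R : Rect) : Prop where
  left_nonneg : 0 ≤ R.left
  left_lt_right : R.left < R.right
  right_le : R.right ≤ 1
  bottom_nonneg : 0 ≤ R.bottom
  bottom_lt_top : R.bottom < R.top
  top_le : R.top ≤ 1

lemma Rect.Proper.inner_nonempty {R : Rect} (hR : R.Proper) : R.inner.Nonempty :=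
  ⟨((R.left + R.right) / 2, (R.bottom + R.top) / 2), by
    have := hR.left_lt_right; have := hR.bottom_lt_top
    rw [Rect.mem_inner]; constructor <;> constructor <;> simp only <;> linarith⟩

lemma unitSquare_proper : unitSquare.Proper := by
  constructor <;> simp [unitSquare]

lemma Rect.Proper.split {R : Rect} (hR : R.Proper) {q : ℝ × ℝ} (hq : q ∈ R.inner) (j : Fin 4) :
    (R.split q j).Proper := by
  obtain ⟨h1, h2, h3, h4, h5, h6⟩ := hR
  obtain ⟨⟨a, b⟩, c, d⟩ := Rect.mem_inner.1 hq
  fin_cases j <;> constructor <;> simp [Rect.split] <;> linarith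

lemma Rect.split_inner_subset {R : Rect} {q : ℝ × ℝ} (hq : q ∈ R.inner) (j : Fin 4) :
    (R.split q j).inner ⊆ R.inner := by
  obtain ⟨⟨a, b⟩, c, d⟩ := Rect.mem_inner.1 hq
  intro z hz
  rw [Rect.mem_inner] at hz ⊢
  fin_cases j <;> simp [Rect.split] at hz <;> refine ⟨⟨?_, ?_⟩, ?_, ?_⟩ <;> linarith

lemma Rect.split_inner_disjoint (R : Rect) (q : ℝ × ℝ) {i j : Fin 4} (hij : i ≠ j) :
    Disjoint (R.split q i).inner (R.split q j).inner := by
  rw [Set.disjoint_left]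
  intro z hz hz'
  rw [Rect.mem_inner] at hz hz'
  fin_cases i <;> fin_cases j <;> simp [Rect.split] at hz hz' hij <;> linarith

/-! ### Quadtrees with a cap on the generation -/

open Classical in
/-- The effect of a point on a cell, where cells of generation at least `n` are frozen. -/
noncomputable def stepCap (n : ℕ∞) (q : ℝ × ℝ) (c : Cell) : Finset Cell :=
  if (c.1.length : ℕ∞) < n then Cell.step q c else {c}

open Classical in
/-- The cells after insertion of `k` points, where cells of generation `n` are frozen. -/
noncomputable def capCells (n : ℕ∞) (p : ℕ → ℝ × ℝ) : ℕ → Finset Cell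
  | 0 => {([], unitSquare)}
  | k + 1 => (capCells n p k).biUnion (stepCap n (p k))

lemma capCells_top (p : ℕ → ℝ × ℝ) (k : ℕ) : capCells ⊤ p k = cellsAfter p k := by
  induction k with
  | zero => rfl
  | succ k ih =>
    simp only [capCells, cellsAfter, ih]
    congr 1

/-- The cell `c` is split by the point `q` in the quadtree capped at generation `n`. -/
def IsHit (n : ℕ∞) (q : ℝ × ℝ) (c : Cell) : Prop := (c.1.length : ℕ∞) < n ∧ q ∈ c.2.inner

/-- The `j`-th child of a cell split at `q`. -/
noncomputable def child (q : ℝ × ℝ) (c : Cell) (j : Fin 4) : Cell := (c.1 ++ [j], c.2.split q j)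

lemma child_injective (q : ℝ × ℝ) (c : Cell) : Function.Injective (child q c) := by
  intro i j hij
  simpa [child] using congrArg Prod.fst hij

open Classical in
lemma stepCap_of_isHit {n : ℕ∞} {q : ℝ × ℝ} {c : Cell} (hh : IsHit n q c) :
    stepCap n q c = Finset.univ.image (child q c) := by
  rw [stepCap, if_pos hh.1, Cell.step, Rect.interior_carrier, if_pos hh.2]; rfl

lemma stepCap_of_not_isHit {n : ℕ∞} {q : ℝ × ℝ} {c : Cell} (hh : ¬ IsHit n q c) :
    stepCap n q c = {c} := by
  rw [stepCap]
  split_ifs with h1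
  · rw [Cell.step, Rect.interior_carrier, if_neg]
    exact fun h2 => hh ⟨h1, h2⟩
  · rfl

lemma mem_stepCap {n : ℕ∞} {q : ℝ × ℝ} {c d : Cell} :
    d ∈ stepCap n q c ↔ (IsHit n q c ∧ ∃ j, d = child q c j) ∨ (¬ IsHit n q c ∧ d = c) := by
  by_cases hh : IsHit n q c
  · simp [stepCap_of_isHit hh, hh, eq_comm]
  · simp [stepCap_of_not_isHit hh, hh]

/-- The cells are proper rectangles with pairwise disjoint interiors. -/
structure IsTiling (s : Finset Cell) : Prop where
  proper : ∀ c ∈ s, c.2.Proper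
  disjoint : ∀ c ∈ s, ∀ d ∈ s, c ≠ d → Disjoint c.2.inner d.2.inner

lemma inner_subset_of_mem_stepCap {n : ℕ∞} {q : ℝ × ℝ} {c d : Cell} (hd : d ∈ stepCap n q c) :
    d.2.inner ⊆ c.2.inner := by
  rcases mem_stepCap.1 hd with ⟨hh, j, rfl⟩ | ⟨_, rfl⟩
  · exact Rect.split_inner_subset hh.2 j
  · exact subset_rfl

lemma proper_of_mem_stepCap {n : ℕ∞} {q : ℝ × ℝ} {c d : Cell} (hc : c.2.Proper)
    (hd : d ∈ stepCap n q c) : d.2.Proper := by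
  rcases mem_stepCap.1 hd with ⟨hh, j, rfl⟩ | ⟨_, rfl⟩
  · exact hc.split hh.2 j
  · exact hc

open Classical in
lemma IsTiling.biUnion {s : Finset Cell} (hs : IsTiling s) (n : ℕ∞) (q : ℝ × ℝ) :
    IsTiling (s.biUnion (stepCap n q)) := by
  constructor
  · intro d hd
    obtain ⟨c, hc, hd⟩ := Finset.mem_biUnion.1 hd
    exact proper_of_mem_stepCap (hs.proper c hc) hd
  · intro d hd d' hd' hne
    obtain ⟨c, hc, hdc⟩ := Finset.mem_biUnion.1 hd
    obtain ⟨c', hc', hdc'⟩ := Finset.mem_biUnion.1 hd'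
    by_cases hcc : c = c'
    · subst hcc
      rcases mem_stepCap.1 hdc with ⟨hh, j, rfl⟩ | ⟨hh, rfl⟩
      · rcases mem_stepCap.1 hdc' with ⟨_, j', rfl⟩ | ⟨hh', _⟩
        · exact Rect.split_inner_disjoint _ _ (fun h => hne (by rw [h]))
        · exact absurd hh hh'
      · rcases mem_stepCap.1 hdc' with ⟨hh', _⟩ | ⟨_, rfl⟩
        · exact absurd hh' hh
        · exact absurd rfl hne
    · exact (hs.disjoint c hc c' hc' hcc).mono (inner_subset_of_mem_stepCap hdc)
        (inner_subset_of_mem_stepCap hdc')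

lemma isTiling_capCells (n : ℕ∞) (p : ℕ → ℝ × ℝ) (k : ℕ) : IsTiling (capCells n p k) := by
  induction k with
  | zero =>
    constructor
    · intro c hc
      rw [capCells, Finset.mem_singleton] at hc
      subst hc
      exact unitSquare_proper
    · intro c hc d hd hne
      rw [capCells, Finset.mem_singleton] at hc hd
      exact absurd (hc.trans hd.symm) hne
  | succ k ih => exact ih.biUnion n (p k)

lemma IsTiling.eq_of_mem {s : Finset Cell} (hs : IsTiling s) {c d : Cell} (hc : c ∈ s) (hd : d ∈ s)
    {q : ℝ × ℝ} (hqc : q ∈ c.2.inner) (hqd : q ∈ d.2.inner) : c = d := by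
  by_contra hne
  exact Set.disjoint_left.1 (hs.disjoint c hc d hd hne) hqc hqd

/-- Distinct cells have disjoint, non-empty interiors. Forgetting the words therefore loses nothing,
and sums over the bare rectangles of `quad` can be computed over cells. -/
lemma IsTiling.injOn_snd {s : Finset Cell} (hs : IsTiling s) :
    Set.InjOn Prod.snd (s : Set Cell) := by
  intro c hc d hd hcd
  obtain ⟨q, hq⟩ := (hs.proper c hc).inner_nonempty
  exact hs.eq_of_mem hc hd hq (by rwa [← hcd])

open Classical in
lemma IsTiling.sum_biUnion {s : Finset Cell} (hs : IsTiling s) (n : ℕ∞) (q : ℝ × ℝ)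
    (g : Cell → ℝ) :
    ∑ d ∈ s.biUnion (stepCap n q), g d = ∑ c ∈ s, ∑ d ∈ stepCap n q c, g d := by
  refine Finset.sum_biUnion fun c hc c' hc' hne => ?_
  rw [Function.onFun, Finset.disjoint_left]
  intro d hd hd'
  obtain ⟨z, hz⟩ := (proper_of_mem_stepCap (hs.proper c hc) hd).inner_nonempty
  exact Set.disjoint_left.1 (hs.disjoint c hc c' hc' hne) (inner_subset_of_mem_stepCap hd hz)
    (inner_subset_of_mem_stepCap hd' hz)

lemma sum_stepCap_of_isHit {n : ℕ∞} {q : ℝ × ℝ} {c : Cell} (hh : IsHit n q c) (g : Cell → ℝ) :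
    ∑ d ∈ stepCap n q c, g d = ∑ j, g (child q c j) := by
  classical
  rw [stepCap_of_isHit hh, Finset.sum_image (fun i _ j _ h => child_injective q c h)]

lemma sum_stepCap_of_not_isHit {n : ℕ∞} {q : ℝ × ℝ} {c : Cell} (hh : ¬ IsHit n q c)
    (g : Cell → ℝ) : ∑ d ∈ stepCap n q c, g d = g c := by
  rw [stepCap_of_not_isHit hh, Finset.sum_singleton]

lemma sum_capCells_succ (n : ℕ∞) (p : ℕ → ℝ × ℝ) (k : ℕ) (g : Cell → ℝ) :
    ∑ d ∈ capCells n p (k + 1), g d =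
      ∑ c ∈ capCells n p k, ∑ d ∈ stepCap n (p k) c, g d :=
  (isTiling_capCells n p k).sum_biUnion n (p k) g

/-- Splitting the cell `c` changes a sum over cells only through `c` and its children. -/
lemma sum_capCells_succ_of_isHit {n : ℕ∞} {p : ℕ → ℝ × ℝ} {k : ℕ} {c : Cell}
    (hc : c ∈ capCells n p k) (hh : IsHit n (p k) c) (g : Cell → ℝ) :
    ∑ d ∈ capCells n p (k + 1), g d =
      ∑ d ∈ capCells n p k, g d + (∑ j, g (child (p k) c j) - g c) := by
  classical
  rw [sum_capCells_succ, ← Finset.add_sum_erase _ _ hc, ← Finset.add_sum_erase _ g hc,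
    sum_stepCap_of_isHit hh]
  -- By disjointness of the interiors, `c` is the only cell that the point can split.
  have : ∑ x ∈ (capCells n p k).erase c, ∑ d ∈ stepCap n (p k) x, g d =
      ∑ x ∈ (capCells n p k).erase c, g x := by
    refine Finset.sum_congr rfl fun x hx => sum_stepCap_of_not_isHit (fun hx' => ?_) g
    exact (Finset.mem_erase.1 hx).1
      ((isTiling_capCells n p k).eq_of_mem (Finset.mem_erase.1 hx).2 hc hx'.2 hh.2)
  rw [this]; ring

lemma capCells_succ_of_forall_not_isHit {n : ℕ∞} {p : ℕ → ℝ × ℝ} {k : ℕ}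
    (hh : ∀ c ∈ capCells n p k, ¬ IsHit n (p k) c) : capCells n p (k + 1) = capCells n p k := by
  classical
  rw [capCells]
  ext d
  simp only [Finset.mem_biUnion]
  constructor
  · rintro ⟨c, hc, hd⟩
    rw [stepCap_of_not_isHit (hh c hc), Finset.mem_singleton] at hd
    exact hd ▸ hc
  · intro hd
    exact ⟨d, hd, by rw [stepCap_of_not_isHit (hh d hd), Finset.mem_singleton]⟩

/-- This is the source of adaptedness: after `k` insertions only the points of index below `k` have
been read. -/
lemma capCells_congr (n : ℕ∞) {p p' : ℕ → ℝ × ℝ} {k : ℕ} (hp : ∀ i < k, p i = p' i) :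
    capCells n p k = capCells n p' k := by
  induction k with
  | zero => rfl
  | succ k ih =>
    rw [capCells, capCells, ih fun i hi => hp i (hi.trans k.lt_succ_self), hp k k.lt_succ_self]

lemma length_le_of_mem_capCells {n : ℕ∞} {p : ℕ → ℝ × ℝ} {k : ℕ} {c : Cell}
    (hc : c ∈ capCells n p k) : (c.1.length : ℕ∞) ≤ n := by
  classical
  induction k generalizing c with
  | zero => rw [capCells, Finset.mem_singleton] at hc; simp [hc]
  | succ k ih =>
    rw [capCells, Finset.mem_biUnion] at hc
    obtain ⟨d, hd, hc⟩ := hc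
    rcases mem_stepCap.1 hc with ⟨hh, j, rfl⟩ | ⟨hh, rfl⟩
    · have := Order.add_one_le_of_lt hh.1
      simpa [child] using this
    · exact ih hd

/-- Below generation `n`, the cells of the capped quadtree are those of the quadtree. -/
lemma mem_capCells_iff_of_length_lt {n : ℕ∞} {p : ℕ → ℝ × ℝ} {k : ℕ} {c : Cell}
    (hc : (c.1.length : ℕ∞) < n) : c ∈ capCells n p k ↔ c ∈ capCells ⊤ p k := by
  classical
  induction k generalizing c with
  | zero => simp [capCells]
  | succ k ih =>
    -- A cell of generation at least `n` is not `c` and has no child equal to `c`, so freezing it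
    -- does not matter here.
    have key : ∀ d : Cell, c ∈ stepCap n (p k) d ↔ c ∈ stepCap ⊤ (p k) d := by
      intro d
      by_cases hd : (d.1.length : ℕ∞) < n
      · simp [stepCap, hd]
      · constructor
        · intro h
          rcases mem_stepCap.1 h with ⟨hh, _⟩ | ⟨_, rfl⟩
          · exact absurd hh.1 hd
          · exact absurd hc hd
        · intro h
          exfalso
          rcases mem_stepCap.1 h with ⟨_, j, rfl⟩ | ⟨_, rfl⟩
          · refine hd (lt_of_le_of_lt ?_ hc)
            simp [child]
          · exact hd hc
    simp only [capCells, Finset.mem_biUnion, key]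
    refine exists_congr fun d => and_congr_left fun hd => ih (lt_of_le_of_lt ?_ hc)
    rcases mem_stepCap.1 hd with ⟨_, j, rfl⟩ | ⟨_, rfl⟩
    · simp [child]
    · exact le_rfl

/-- The cells of generation `n` of the quadtree capped at `n` are those that have appeared. -/
lemma mem_capCells_iff_of_length_eq {n : ℕ} {p : ℕ → ℝ × ℝ} {k : ℕ} {c : Cell}
    (hc : c.1.length = n) : c ∈ capCells n p k ↔ ∃ j ≤ k, c ∈ capCells ⊤ p j := by
  classical
  -- Once present, a frozen cell stays. The capped tree thus remembers cells that have since been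
  -- split in the free tree.
  have hnot : ¬ (c.1.length : ℕ∞) < n := by simp [hc]
  induction k with
  | zero => simp [capCells]
  | succ k ih =>
    constructor
    · intro h
      rw [capCells, Finset.mem_biUnion] at h
      obtain ⟨d, hd, h⟩ := h
      rcases mem_stepCap.1 h with ⟨hh, j, rfl⟩ | ⟨hh, rfl⟩
      · refine ⟨k + 1, le_rfl, ?_⟩
        rw [capCells, Finset.mem_biUnion]
        refine ⟨d, (mem_capCells_iff_of_length_lt hh.1).1 hd, mem_stepCap.2 (Or.inl ⟨⟨?_, hh.2⟩, j, rfl⟩)⟩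
        exact ENat.natCast_lt_top _
      · obtain ⟨j, hj, h⟩ := ih.1 hd
        exact ⟨j, hj.trans k.le_succ, h⟩
    · rintro ⟨j, hj, h⟩
      rw [capCells, Finset.mem_biUnion]
      rcases hj.lt_or_eq with hj | rfl
      · exact ⟨c, ih.2 ⟨j, Nat.lt_succ_iff.1 hj, h⟩, mem_stepCap.2 (Or.inr ⟨fun hh => hnot hh.1, rfl⟩)⟩
      · rw [capCells, Finset.mem_biUnion] at h
        obtain ⟨d, hd, h⟩ := h
        rcases mem_stepCap.1 h with ⟨hh, j, rfl⟩ | ⟨hh, rfl⟩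
        · have hlt : (d.1.length : ℕ∞) < n := by
            rw [← hc, Nat.cast_lt]; simp [child]
          exact ⟨d, (mem_capCells_iff_of_length_lt hlt).2 hd,
            mem_stepCap.2 (Or.inl ⟨⟨hlt, hh.2⟩, j, rfl⟩)⟩
        · exact ⟨c, ih.2 ⟨k, le_rfl, hd⟩, mem_stepCap.2 (Or.inr ⟨fun hh => hnot hh.1, rfl⟩)⟩

/-! ### Measurability -/

lemma measurable_left : Measurable Rect.left :=
  measurable_fst.comp (comap_measurable (fun R : Rect => (R.left, R.right, R.bottom, R.top)))

lemma measurable_right : Measurable Rect.right :=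
  (measurable_fst.comp measurable_snd).comp
    (comap_measurable (fun R : Rect => (R.left, R.right, R.bottom, R.top)))

lemma measurable_bottom : Measurable Rect.bottom :=
  (measurable_fst.comp (measurable_snd.comp measurable_snd)).comp
    (comap_measurable (fun R : Rect => (R.left, R.right, R.bottom, R.top)))

lemma measurable_top : Measurable Rect.top :=
  (measurable_snd.comp (measurable_snd.comp measurable_snd)).comp
    (comap_measurable (fun R : Rect => (R.left, R.right, R.bottom, R.top)))

lemma measurable_rect {Z : Type*} [MeasurableSpace Z] {f : Z → Rect}
    (h1 : Measurable fun z => (f z).left) (h2 : Measurable fun z => (f z).right)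
    (h3 : Measurable fun z => (f z).bottom) (h4 : Measurable fun z => (f z).top) :
    Measurable f :=
  measurable_comap_iff.2 (h1.prodMk (h2.prodMk (h3.prodMk h4)))

lemma measurable_split {Z : Type*} [MeasurableSpace Z] {f : Z → Rect} {q : Z → ℝ × ℝ}
    (hf : Measurable f) (hq : Measurable q) (j : Fin 4) :
    Measurable fun z => (f z).split (q z) j := by
  have h1 := measurable_left.comp hf
  have h2 := measurable_right.comp hf
  have h3 := measurable_bottom.comp hf
  have h4 := measurable_top.comp hf
  have h5 := hq.fst
  have h6 := hq.snd
  fin_cases j <;> apply measurable_rect <;> simp [Rect.split] <;> assumption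

lemma measurableSet_mem_inner {Z : Type*} [MeasurableSpace Z] {f : Z → Rect} {q : Z → ℝ × ℝ}
    (hf : Measurable f) (hq : Measurable q) : MeasurableSet {z | q z ∈ (f z).inner} := by
  simp only [Rect.mem_inner]
  exact ((measurableSet_lt (measurable_left.comp hf) hq.fst).inter
    (measurableSet_lt hq.fst (measurable_right.comp hf))).inter
    ((measurableSet_lt (measurable_bottom.comp hf) hq.snd).inter
    (measurableSet_lt hq.snd (measurable_top.comp hf)))

/-- Sums over the cells of a measurably varying quadtree are measurable. -/
lemma measurable_sum_capCells {Z : Type*} [MeasurableSpace Z] (n : ℕ∞) {p : Z → ℕ → ℝ × ℝ}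
    (hp : ∀ i, Measurable fun z => p z i) (k : ℕ) (g : List (Fin 4) → Z → Rect → ℝ)
    (hg : ∀ u, Measurable fun y : Z × Rect => g u y.1 y.2) :
    Measurable fun z => ∑ c ∈ capCells n (p z) k, g c.1 z c.2 := by
  classical
  induction k generalizing g with
  | zero =>
    simp only [capCells, Finset.sum_singleton]
    exact (hg []).comp (measurable_id.prodMk measurable_const)
  | succ k ih =>
    -- The last insertion is absorbed into the summand. The new summand depends on `z` through the
    -- inserted point, which is why `g` is allowed to depend on `z`.
    have key : ∀ z, ∑ d ∈ capCells n (p z) (k + 1), g d.1 z d.2 = ∑ c ∈ capCells n (p z) k,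
        if ((c.1.length : ℕ∞) < n) ∧ p z k ∈ c.2.inner then
          ∑ j, g (c.1 ++ [j]) z (c.2.split (p z k) j) else g c.1 z c.2 := by
      intro z
      rw [sum_capCells_succ n (p z) k (fun d => g d.1 z d.2)]
      refine Finset.sum_congr rfl fun c _ => ?_
      split_ifs with hh
      · exact sum_stepCap_of_isHit (n := n) hh _
      · exact sum_stepCap_of_not_isHit (n := n) hh _
    simp only [key]
    refine ih (fun u z R => if ((u.length : ℕ∞) < n) ∧ p z k ∈ R.inner then
          ∑ j, g (u ++ [j]) z (R.split (p z k) j) else g u z R) fun u => ?_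
    have hpk : Measurable fun y : Z × Rect => p y.1 k := (hp k).comp measurable_fst
    refine Measurable.ite ?_ ?_ (hg u)
    · exact (MeasurableSet.const _).inter (measurableSet_mem_inner measurable_snd hpk)
    · refine Finset.measurable_sum _ fun j _ => ?_
      exact (hg (u ++ [j])).comp (measurable_fst.prodMk (measurable_split measurable_snd hpk j))

end Quadtree

namespace Quadtree

/-! ### The weights and their behaviour under a uniform split -/

open Classical in
/-- The weight `(height)^γ ((x - left) (right - x))^(γ/2)` of a rectangle strictly above `x`. -/
noncomputable def powWeight (x γ : ℝ) (R : Rect) : ℝ :=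
  if R.left < x ∧ x < R.right then
    (R.top - R.bottom) ^ γ * ((x - R.left) * (R.right - x)) ^ (γ / 2) else 0

/-- The factor by which the mean total weight changes at a uniform split. -/
noncomputable def splitRate (γ : ℝ) : ℝ := 4 / ((γ + 1) * (γ + 2))

lemma measurable_powWeight (x γ : ℝ) : Measurable (powWeight x γ) := by
  have h1 := measurable_left
  have h2 := measurable_right
  have h3 := measurable_bottom
  have h4 := measurable_top
  refine Measurable.ite ?_ ?_ measurable_const
  · exact (measurableSet_lt h1 measurable_const).inter (measurableSet_lt measurable_const h2)
  · exact ((h4.sub h3).pow_const γ).mul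
      (((measurable_const.sub h1).mul (h2.sub measurable_const)).pow_const _)

lemma powWeight_nonneg {R : Rect} (hR : R.Proper) (x γ : ℝ) : 0 ≤ powWeight x γ R := by
  have := hR.bottom_lt_top
  rw [powWeight]
  split_ifs with h
  · have h1 := h.1
    have h2 := h.2
    have : 0 ≤ (x - R.left) * (R.right - x) := mul_nonneg (by linarith) (by linarith)
    have : 0 ≤ R.top - R.bottom := by linarith
    positivity
  · exact le_rfl

lemma powWeight_le_one {R : Rect} (hR : R.Proper) (x : ℝ) {γ : ℝ} (hγ : 0 < γ) :
    powWeight x γ R ≤ 1 := by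
  obtain ⟨h1, h2, h3, h4, h5, h6⟩ := hR
  rw [powWeight]
  split_ifs with h
  · obtain ⟨h7, h8⟩ := h
    have h9 : 0 ≤ (x - R.left) * (R.right - x) := mul_nonneg (by linarith) (by linarith)
    have h10 : (x - R.left) * (R.right - x) ≤ 1 :=
      mul_le_one₀ (by linarith) (by linarith) (by linarith)
    exact mul_le_one₀ (Real.rpow_le_one (by linarith) (by linarith) hγ.le)
      (Real.rpow_nonneg h9 _) (Real.rpow_le_one h9 h10 (by linarith))
  · exact zero_le_one

/-- Turns second moments at exponent β into first moments at exponent 2β, where splitting is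
contracting. -/
lemma powWeight_sq {R : Rect} (hR : R.Proper) (x γ : ℝ) :
    powWeight x γ R ^ 2 = powWeight x (2 * γ) R := by
  have := hR.bottom_lt_top
  rw [powWeight, powWeight]
  split_ifs with h
  · have h1 := h.1
    have h2 := h.2
    have h3 : 0 ≤ (x - R.left) * (R.right - x) := mul_nonneg (by linarith) (by linarith)
    have h4 : 0 ≤ R.top - R.bottom := by linarith
    rw [mul_pow, ← Real.rpow_mul_natCast h4, ← Real.rpow_mul_natCast h3]
    congr 2 <;> push_cast <;> ring
  · simp

open Classical in
/-- The horizontal factor of the total weight of the children, for a cut at abscissa `a`. -/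
noncomputable def cutFactor (x l r γ a : ℝ) : ℝ :=
  if a < x then ((x - a) * (r - x)) ^ (γ / 2)
  else if x < a then ((x - l) * (a - x)) ^ (γ / 2) else 0

/-- Only the two children on the side of the cut that contains `x` carry weight. They share their
horizontal side, and only their heights differ. A cut exactly at `x` leaves no child strictly above
`x`. -/
lemma sum_powWeight_split {R : Rect} {x : ℝ} (hl : R.left < x) (hr : x < R.right) (γ : ℝ)
    (q : ℝ × ℝ) :
    ∑ j, powWeight x γ (R.split q j) =
      cutFactor x R.left R.right γ q.1 * ((R.top - q.2) ^ γ + (q.2 - R.bottom) ^ γ) := by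
  simp only [Fin.sum_univ_four, powWeight, cutFactor, Rect.split]
  rcases lt_trichotomy q.1 x with h | h | h
  · simp [h, hl, hr, h.not_gt]; ring
  · simp [h]
  · simp [h, hl, hr, h.not_gt]; ring

lemma powWeight_split_eq_zero {R : Rect} {q : ℝ × ℝ} (hq : q ∈ R.inner) {x : ℝ}
    (hx : ¬ (R.left < x ∧ x < R.right)) (γ : ℝ) (j : Fin 4) : powWeight x γ (R.split q j) = 0 := by
  obtain ⟨⟨a, b⟩, c, d⟩ := Rect.mem_inner.1 hq
  rw [powWeight, if_neg]
  rintro ⟨h1, h2⟩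
  apply hx
  fin_cases j <;> simp [Rect.split] at h1 h2 <;> constructor <;> linarith

lemma sum_powWeight_split_nonneg {R : Rect} (hR : R.Proper) {q : ℝ × ℝ} (hq : q ∈ R.inner)
    (x γ : ℝ) : 0 ≤ ∑ j, powWeight x γ (R.split q j) :=
  Finset.sum_nonneg fun j _ => powWeight_nonneg (hR.split hq j) x γ

/-- At most two children carry weight, and neither has more than the parent because the weight
increases with the rectangle. -/
lemma sum_powWeight_split_le {R : Rect} {q : ℝ × ℝ} (hq : q ∈ R.inner)
    (x : ℝ) {γ : ℝ} (hγ : 0 < γ) :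
    ∑ j, powWeight x γ (R.split q j) ≤ 2 * powWeight x γ R := by
  by_cases hx : R.left < x ∧ x < R.right
  · obtain ⟨⟨a, b⟩, c, d⟩ := Rect.mem_inner.1 hq
    obtain ⟨h1, h2⟩ := hx
    rw [sum_powWeight_split h1 h2, powWeight, if_pos ⟨h1, h2⟩]
    have hc : cutFactor x R.left R.right γ q.1 ≤ ((x - R.left) * (R.right - x)) ^ (γ / 2) := by
      rw [cutFactor]
      have h3 : 0 ≤ (x - R.left) * (R.right - x) := mul_nonneg (by linarith) (by linarith)
      split_ifs with h4 h5
      · refine Real.rpow_le_rpow (mul_nonneg (by linarith) (by linarith)) ?_ (by linarith)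
        exact mul_le_mul_of_nonneg_right (by linarith) (by linarith)
      · refine Real.rpow_le_rpow (mul_nonneg (by linarith) (by linarith)) ?_ (by linarith)
        exact mul_le_mul_of_nonneg_left (by linarith) (by linarith)
      · positivity
    have h6 : (R.top - q.2) ^ γ ≤ (R.top - R.bottom) ^ γ :=
      Real.rpow_le_rpow (by linarith) (by linarith) hγ.le
    have h7 : (q.2 - R.bottom) ^ γ ≤ (R.top - R.bottom) ^ γ :=
      Real.rpow_le_rpow (by linarith) (by linarith) hγ.le
    have h8 : 0 ≤ (R.top - q.2) ^ γ := Real.rpow_nonneg (by linarith) _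
    have h9 : 0 ≤ (q.2 - R.bottom) ^ γ := Real.rpow_nonneg (by linarith) _
    have h10 : 0 ≤ ((x - R.left) * (R.right - x)) ^ (γ / 2) :=
      Real.rpow_nonneg (mul_nonneg (by linarith) (by linarith)) _
    calc _ ≤ ((x - R.left) * (R.right - x)) ^ (γ / 2) *
          ((R.top - R.bottom) ^ γ + (R.top - R.bottom) ^ γ) :=
          mul_le_mul hc (add_le_add h6 h7) (by positivity) h10
      _ = _ := by ring
  · rw [Finset.sum_eq_zero fun j _ => powWeight_split_eq_zero hq hx γ j, powWeight, if_neg hx,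
      mul_zero]

lemma integral_sub_rpow {s x y : ℝ} (hs : 0 < s) :
    ∫ v in x..y, (v - x) ^ s = (y - x) ^ (s + 1) / (s + 1) := by
  rw [intervalIntegral.integral_comp_sub_right (fun u => u ^ s) x, integral_rpow (by left; linarith),
    sub_self, Real.zero_rpow (by linarith), sub_zero]

lemma integral_sub_left_rpow {s x y : ℝ} (hs : 0 < s) :
    ∫ v in x..y, (y - v) ^ s = (y - x) ^ (s + 1) / (s + 1) := by
  rw [intervalIntegral.integral_comp_sub_left (fun u => u ^ s) y, integral_rpow (by left; linarith),
    sub_self, Real.zero_rpow (by linarith), sub_zero]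

lemma continuous_sub_rpow {s x : ℝ} (hs : 0 < s) : Continuous fun v : ℝ => (v - x) ^ s :=
  (continuous_id.sub continuous_const).rpow_const fun _ => Or.inr hs.le

lemma continuous_sub_left_rpow {s x : ℝ} (hs : 0 < s) : Continuous fun v : ℝ => (x - v) ^ s :=
  (continuous_const.sub continuous_id).rpow_const fun _ => Or.inr hs.le

lemma setIntegral_heightFactor {b t γ : ℝ} (hbt : b < t) (hγ : 0 < γ) :
    ∫ v in Set.Ioo b t, ((t - v) ^ γ + (v - b) ^ γ) = 2 * (t - b) ^ (γ + 1) / (γ + 1) := by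
  rw [← integral_Ioc_eq_integral_Ioo, ← intervalIntegral.integral_of_le hbt.le,
    intervalIntegral.integral_add ((continuous_sub_left_rpow hγ).intervalIntegrable _ _)
      ((continuous_sub_rpow hγ).intervalIntegrable _ _),
    integral_sub_rpow hγ, integral_sub_left_rpow hγ]
  ring

/-- Cuts to the left of `x` contribute ((x-l)(r-x))^(γ/2) (x-l)/(γ/2+1), and cuts to the right the
same with r-x as the last factor of the numerator. The two lengths add up to the width. -/
lemma setIntegral_cutFactor {l r x γ : ℝ} (hl : l < x) (hr : x < r) (hγ : 0 < γ) :
    ∫ a in Set.Ioo l r, cutFactor x l r γ a =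
      ((x - l) * (r - x)) ^ (γ / 2) * (r - l) / (γ / 2 + 1) := by
  have hγ2 : 0 < γ / 2 := by linarith
  have e1 : Set.EqOn (fun a => (r - x) ^ (γ / 2) * (x - a) ^ (γ / 2)) (cutFactor x l r γ)
      (Set.Ioc l x) := by
    intro a ha
    simp only [cutFactor]
    rcases ha.2.lt_or_eq with h | h
    · rw [if_pos h, ← Real.mul_rpow (by linarith) (by linarith), mul_comm]
    · simp [h, Real.zero_rpow hγ2.ne']
  have e2 : Set.EqOn (fun a => (x - l) ^ (γ / 2) * (a - x) ^ (γ / 2)) (cutFactor x l r γ)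
      (Set.Ioc x r) := by
    intro a ha
    simp only [cutFactor]
    rw [if_neg ha.1.not_gt, if_pos ha.1, ← Real.mul_rpow (by linarith) (by linarith [ha.1])]
  have i1 : IntervalIntegrable (cutFactor x l r γ) volume l x := by
    refine IntervalIntegrable.congr ?_
      (((continuous_sub_left_rpow (x := x) hγ2).const_mul ((r - x) ^ (γ / 2))).intervalIntegrable l x)
    rw [Set.uIoc_of_le hl.le]; exact e1
  have i2 : IntervalIntegrable (cutFactor x l r γ) volume x r := by
    refine IntervalIntegrable.congr ?_
      (((continuous_sub_rpow (x := x) hγ2).const_mul ((x - l) ^ (γ / 2))).intervalIntegrable x r)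
    rw [Set.uIoc_of_le hr.le]; exact e2
  rw [← integral_Ioc_eq_integral_Ioo, ← intervalIntegral.integral_of_le (hl.trans hr).le,
    ← intervalIntegral.integral_add_adjacent_intervals i1 i2,
    intervalIntegral.integral_of_le hl.le, intervalIntegral.integral_of_le hr.le,
    ← setIntegral_congr_fun measurableSet_Ioc e1, ← setIntegral_congr_fun measurableSet_Ioc e2,
    ← intervalIntegral.integral_of_le hl.le, ← intervalIntegral.integral_of_le hr.le,
    intervalIntegral.integral_const_mul, intervalIntegral.integral_const_mul,
    integral_sub_rpow hγ2, integral_sub_left_rpow hγ2, Real.rpow_add (by linarith),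
    Real.rpow_add (by linarith), Real.rpow_one, Real.rpow_one,
    Real.mul_rpow (by linarith) (by linarith)]
  ring

/-- The area of a rectangle. -/
noncomputable def Rect.area (R : Rect) : ℝ := (R.right - R.left) * (R.top - R.bottom)

/-- At a uniform split the total weight is multiplied by `splitRate γ` on average. -/
lemma setIntegral_sum_powWeight_split {R : Rect} (hR : R.Proper) (x : ℝ) {γ : ℝ} (hγ : 0 < γ) :
    ∫ q in R.inner, ∑ j, powWeight x γ (R.split q j) =
      splitRate γ * (R.area * powWeight x γ R) := by
  by_cases hx : R.left < x ∧ x < R.right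
  · obtain ⟨h1, h2⟩ := hx
    simp only [sum_powWeight_split h1 h2]
    rw [Rect.inner, Measure.volume_eq_prod, setIntegral_prod_mul (cutFactor x R.left R.right γ)
      (fun v => (R.top - v) ^ γ + (v - R.bottom) ^ γ), setIntegral_cutFactor h1 h2 hγ,
      setIntegral_heightFactor hR.bottom_lt_top hγ, powWeight, if_pos ⟨h1, h2⟩,
      Real.rpow_add (by linarith [hR.bottom_lt_top]), Real.rpow_one, splitRate, Rect.area]
    field_simp
    ring
  · rw [setIntegral_congr_fun (g := fun _ => 0), powWeight, if_neg hx]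
    · simp
    · exact measurableSet_Ioo.prod measurableSet_Ioo
    · intro q hq
      exact Finset.sum_eq_zero fun j _ => powWeight_split_eq_zero hq hx γ j

lemma beta_pos : 0 < beta := by
  have : (3 : ℝ) < Real.sqrt 17 := by
    rw [Real.lt_sqrt (by norm_num)]; norm_num
  rw [beta]; linarith

lemma beta_eq : (beta + 1) * (beta + 2) = 4 := by
  have := Real.mul_self_sqrt (show (0 : ℝ) ≤ 17 by norm_num)
  rw [beta]; nlinarith

lemma splitRate_beta : splitRate beta = 1 := by
  rw [splitRate, beta_eq, div_self (by norm_num)]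

/-- Since β > 0, the product (2β+1)(2β+2) exceeds (β+1)(β+2) = 4. This strict contraction drives
both the exponential moments and the geometric decay in the generation. -/
lemma splitRate_two_mul_beta_lt_one : splitRate (2 * beta) < 1 := by
  have := beta_pos
  have := beta_eq
  rw [splitRate, div_lt_one (by positivity)]
  nlinarith

lemma splitRate_two_mul_beta_pos : 0 < splitRate (2 * beta) := by
  have := beta_pos
  rw [splitRate]; positivity

/-- On rectangles above `x` the weight is the power weight of exponent `β`. -/
lemma weight_eq_powWeight {R : Rect} (hR : R.Proper) {x : ℝ} (hx : R.IsAbove x) :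
    R.weight x = powWeight x beta R := by
  obtain ⟨h1, h2⟩ := hx
  have h3 : 0 < R.right - R.left := by linarith [hR.left_lt_right]
  have h4 : 0 < R.top - R.bottom := by linarith [hR.bottom_lt_top]
  have hb := beta_pos
  have hvol : (volume R.carrier).toReal = (R.right - R.left) * (R.top - R.bottom) := by
    rw [Rect.carrier, Measure.volume_eq_prod, Measure.prod_prod, Real.volume_Icc, Real.volume_Icc,
      ENNReal.toReal_mul, ENNReal.toReal_ofReal h3.le, ENNReal.toReal_ofReal h4.le]
  -- The squared width in this denominator, raised to the power β/2, cancels the power β of the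
  -- width that comes from the area.
  have hpos : R.position x * (1 - R.position x) =
      ((x - R.left) * (R.right - x)) / (R.right - R.left) ^ 2 := by
    rw [Rect.position]; field_simp; ring
  rw [Rect.weight, hvol, h, hpos, Real.div_rpow (mul_nonneg (by linarith) (by linarith))
    (by positivity), ← Real.rpow_natCast_mul h3.le, Real.mul_rpow h3.le h4.le]
  have e : ((2 : ℕ) : ℝ) * (beta / 2) = beta := by push_cast; ring
  rw [e, powWeight]
  have h5 : (R.right - R.left) ^ beta ≠ 0 := (Real.rpow_pos_of_pos h3 _).ne'
  split_ifs with h6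
  · field_simp
  -- Here `x` lies on a vertical side. The original weight vanishes there because β > 0, in
  -- agreement with the strict inequalities in `powWeight`.
  · have : (x - R.left) * (R.right - x) = 0 := by
      rcases h1.lt_or_eq with h | h
      · rcases h2.lt_or_eq with h' | h'
        · exact absurd ⟨h, h'⟩ h6
        · simp [h']
      · simp [h]
    rw [this, Real.zero_rpow (by positivity)]; simp

lemma powWeight_eq_zero_of_not_isAbove {R : Rect} {x : ℝ} (hx : ¬ R.IsAbove x) (γ : ℝ) :
    powWeight x γ R = 0 := by
  rw [powWeight, if_neg]
  exact fun h => hx ⟨h.1.le, h.2.le⟩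

end Quadtree

namespace Quadtree

/-! ### One uniform insertion -/

/-- The uniform distribution on the unit square. -/
noncomputable def unif : Measure (ℝ × ℝ) := volume.restrict (Set.Icc 0 1 ×ˢ Set.Icc 0 1)

instance : IsProbabilityMeasure unif := by
  constructor
  rw [unif, Measure.restrict_apply_univ, Measure.volume_eq_prod, Measure.prod_prod,
    Real.volume_Icc]
  simp

lemma Rect.measurableSet_inner (R : Rect) : MeasurableSet R.inner :=
  measurableSet_Ioo.prod measurableSet_Ioo

lemma Rect.volume_inner (R : Rect) :
    volume R.inner = ENNReal.ofReal (R.right - R.left) * ENNReal.ofReal (R.top - R.bottom) := by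
  rw [Rect.inner, Measure.volume_eq_prod, Measure.prod_prod, Real.volume_Ioo, Real.volume_Ioo]

lemma Rect.volume_inner_lt_top (R : Rect) : volume R.inner < ⊤ := by
  rw [Rect.volume_inner]
  exact ENNReal.mul_lt_top ENNReal.ofReal_lt_top ENNReal.ofReal_lt_top

lemma Rect.Proper.volume_real_inner {R : Rect} (hR : R.Proper) : volume.real R.inner = R.area := by
  rw [Measure.real, Rect.volume_inner, ENNReal.toReal_mul,
    ENNReal.toReal_ofReal (by linarith [hR.left_lt_right]),
    ENNReal.toReal_ofReal (by linarith [hR.bottom_lt_top]), Rect.area]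

lemma Rect.Proper.inner_subset {R : Rect} (hR : R.Proper) :
    R.inner ⊆ Set.Icc 0 1 ×ˢ Set.Icc 0 1 := by
  intro q hq
  obtain ⟨⟨a, b⟩, c, d⟩ := Rect.mem_inner.1 hq
  have := hR.left_nonneg; have := hR.right_le; have := hR.bottom_nonneg; have := hR.top_le
  exact ⟨⟨by linarith, by linarith⟩, ⟨by linarith, by linarith⟩⟩

/-- A quantity that changes only when a cell is split has a mean change that is the sum of the
contributions of the cells. -/
lemma integral_unif_eq_add_sum {s : Finset Cell} (hs : IsTiling s) {Θ : ℝ × ℝ → ℝ} {Θ₀ : ℝ}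
    (hint : Integrable Θ unif) (h0 : ∀ q, (∀ c ∈ s, q ∉ c.2.inner) → Θ q = Θ₀) :
    ∫ q, Θ q ∂unif = Θ₀ + ∑ c ∈ s, ∫ q in c.2.inner, (Θ q - Θ₀) := by
  have hint' : IntegrableOn (fun q => Θ q - Θ₀) (Set.Icc 0 1 ×ˢ Set.Icc 0 1) volume :=
    hint.sub (integrable_const _)
  have h1 : ∫ q, Θ q ∂unif = Θ₀ + ∫ q, (Θ q - Θ₀) ∂unif := by
    rw [integral_sub hint (integrable_const _)]; simp
  have hsub : (⋃ c ∈ s, c.2.inner) ⊆ Set.Icc 0 1 ×ˢ Set.Icc 0 1 :=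
    Set.iUnion₂_subset fun c hc => (hs.proper c hc).inner_subset
  rw [h1, unif, setIntegral_eq_of_subset_of_forall_sdiff_eq_zero
      (measurableSet_Icc.prod measurableSet_Icc) hsub,
    integral_biUnion_finset]
  · exact fun c _ => c.2.measurableSet_inner
  · exact fun c hc d hd hne => hs.disjoint c hc d hd hne
  · exact fun c hc => hint'.mono_set (hs.proper c hc).inner_subset
  · intro q hq
    rw [h0 q, sub_self]
    intro c hc hqc
    exact hq.2 (Set.mem_biUnion hc hqc)

lemma integrableOn_inner_of_bounded {R : Rect} {f : ℝ × ℝ → ℝ} {C : ℝ}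
    (hf : Measurable f) (hC : ∀ q ∈ R.inner, |f q| ≤ C) : IntegrableOn f R.inner := by
  refine Measure.integrableOn_of_bounded (M := C) R.volume_inner_lt_top.ne
    hf.aestronglyMeasurable ?_
  filter_upwards [ae_restrict_mem R.measurableSet_inner] with q hq using hC q hq

/-- The change of the total weight at a split. -/
noncomputable def splitChange (x γ : ℝ) (R : Rect) (q : ℝ × ℝ) : ℝ :=
  ∑ j, powWeight x γ (R.split q j) - powWeight x γ R

lemma measurable_splitChange (x γ : ℝ) (R : Rect) : Measurable (splitChange x γ R) :=
  (Finset.measurable_sum _ fun j _ => (measurable_powWeight x γ).comp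
    (measurable_split measurable_const measurable_id j)).sub measurable_const

/-- The children's total lies between zero and twice the weight of the parent. -/
lemma abs_splitChange_le {R : Rect} (hR : R.Proper) {q : ℝ × ℝ} (hq : q ∈ R.inner)
    (x : ℝ) {γ : ℝ} (hγ : 0 < γ) : |splitChange x γ R q| ≤ powWeight x γ R := by
  have h1 := sum_powWeight_split_nonneg hR hq x γ
  have h2 := sum_powWeight_split_le hq x hγ
  rw [splitChange, abs_le]; constructor <;> linarith

lemma integrableOn_splitChange {R : Rect} (hR : R.Proper) (x : ℝ) {γ : ℝ} (hγ : 0 < γ) :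
    IntegrableOn (splitChange x γ R) R.inner :=
  integrableOn_inner_of_bounded (measurable_splitChange x γ R)
    fun _ hq => abs_splitChange_le hR hq x hγ

lemma setIntegral_splitChange {R : Rect} (hR : R.Proper) (x : ℝ) {γ : ℝ} (hγ : 0 < γ) :
    ∫ q in R.inner, splitChange x γ R q = (splitRate γ - 1) * (R.area * powWeight x γ R) := by
  have hint : IntegrableOn (fun q => ∑ j, powWeight x γ (R.split q j)) R.inner := by
    refine (integrableOn_inner_of_bounded (C := 2 * powWeight x γ R) ?_ fun q hq => ?_)
    · exact Finset.measurable_sum _ fun j _ => (measurable_powWeight x γ).comp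
        (measurable_split measurable_const measurable_id j)
    · rw [abs_of_nonneg (sum_powWeight_split_nonneg hR hq x γ)]
      exact sum_powWeight_split_le hq x hγ
  simp only [splitChange]
  rw [integral_sub hint (integrableOn_const R.volume_inner_lt_top.ne),
    setIntegral_sum_powWeight_split hR x hγ, setIntegral_const, hR.volume_real_inner, smul_eq_mul]
  ring

/-! ### Total weights of the capped quadtree -/

/-- The total power weight of the quadtree capped at generation `n` after `k` insertions. -/
noncomputable def capWeight (x γ : ℝ) (n : ℕ∞) (k : ℕ) (p : ℕ → ℝ × ℝ) : ℝ :=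
  ∑ c ∈ capCells n p k, powWeight x γ c.2

lemma capWeight_congr (x γ : ℝ) (n : ℕ∞) {k : ℕ} {p p' : ℕ → ℝ × ℝ} (hp : ∀ i < k, p i = p' i) :
    capWeight x γ n k p = capWeight x γ n k p' := by
  rw [capWeight, capWeight, capCells_congr n hp]

lemma measurable_capWeight_comp {Z : Type*} [MeasurableSpace Z] (x γ : ℝ) (n : ℕ∞) (k : ℕ)
    {p : Z → ℕ → ℝ × ℝ} (hp : ∀ i, Measurable fun z => p z i) :
    Measurable fun z => capWeight x γ n k (p z) :=
  measurable_sum_capCells n hp k (fun _ _ R => powWeight x γ R)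
    fun _ => (measurable_powWeight x γ).comp measurable_snd

lemma measurable_capWeight (x γ : ℝ) (n : ℕ∞) (k : ℕ) : Measurable (capWeight x γ n k) :=
  measurable_capWeight_comp x γ n k measurable_pi_apply

lemma capWeight_nonneg (x γ : ℝ) (n : ℕ∞) (k : ℕ) (p : ℕ → ℝ × ℝ) : 0 ≤ capWeight x γ n k p :=
  Finset.sum_nonneg fun c hc => powWeight_nonneg ((isTiling_capCells n p k).proper c hc) x γ

/-- A crude bound, whose purpose is that every functional of finitely many insertions is bounded and
hence integrable. -/
lemma capWeight_le (x : ℝ) {γ : ℝ} (hγ : 0 < γ) (n : ℕ∞) (k : ℕ) (p : ℕ → ℝ × ℝ) :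
    capWeight x γ n k p ≤ 2 ^ k := by
  induction k with
  | zero => simpa [capWeight, capCells] using powWeight_le_one unitSquare_proper x hγ
  | succ k ih =>
    calc capWeight x γ n (k + 1) p
        = ∑ c ∈ capCells n p k, ∑ d ∈ stepCap n (p k) c, powWeight x γ d.2 :=
          sum_capCells_succ n p k _
      _ ≤ ∑ c ∈ capCells n p k, 2 * powWeight x γ c.2 := by
          refine Finset.sum_le_sum fun c hc => ?_
          by_cases hh : IsHit n (p k) c
          · rw [sum_stepCap_of_isHit hh]
            exact sum_powWeight_split_le hh.2 x hγ
          · rw [sum_stepCap_of_not_isHit hh]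
            linarith [powWeight_nonneg ((isTiling_capCells n p k).proper c hc) x γ]
      _ = 2 * capWeight x γ n k p := by rw [capWeight, Finset.mul_sum]
      _ ≤ 2 ^ (k + 1) := by rw [pow_succ]; linarith

lemma abs_capWeight_le (x : ℝ) {γ : ℝ} (hγ : 0 < γ) (n : ℕ∞) (k : ℕ) (p : ℕ → ℝ × ℝ) :
    |capWeight x γ n k p| ≤ 2 ^ k := by
  rw [abs_of_nonneg (capWeight_nonneg x γ n k p)]; exact capWeight_le x hγ n k p

/-- Drifts are computed with the earlier points fixed and the point of index `k` replaced by an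
integration variable `q`. This replacement leaves the tree before the insertion unchanged. -/
lemma capCells_update (n : ℕ∞) (k : ℕ) (p : ℕ → ℝ × ℝ) (q : ℝ × ℝ) :
    capCells n (Function.update p k q) k = capCells n p k :=
  capCells_congr n fun _ hi => Function.update_of_ne hi.ne _ _

lemma sum_capCells_update_of_isHit {n : ℕ∞} {p : ℕ → ℝ × ℝ} {k : ℕ} {q : ℝ × ℝ} {c : Cell}
    (hc : c ∈ capCells n p k) (hh : IsHit n q c) (g : Cell → ℝ) :
    ∑ d ∈ capCells n (Function.update p k q) (k + 1), g d =
      ∑ d ∈ capCells n p k, g d + (∑ j, g (child q c j) - g c) := by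
  have := sum_capCells_succ_of_isHit (p := Function.update p k q) (k := k) (c := c)
    (by rwa [capCells_update]) (by rwa [Function.update_self]) g
  rwa [capCells_update, Function.update_self] at this

lemma capWeight_update_of_isHit {n : ℕ∞} {p : ℕ → ℝ × ℝ} {k : ℕ} {q : ℝ × ℝ} {c : Cell}
    (hc : c ∈ capCells n p k) (hh : IsHit n q c) (x γ : ℝ) :
    capWeight x γ n (k + 1) (Function.update p k q) =
      capWeight x γ n k p + splitChange x γ c.2 q :=
  sum_capCells_update_of_isHit hc hh _

lemma capCells_update_of_forall_not_isHit {n : ℕ∞} {p : ℕ → ℝ × ℝ} {k : ℕ} {q : ℝ × ℝ}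
    (hh : ∀ c ∈ capCells n p k, ¬ IsHit n q c) :
    capCells n (Function.update p k q) (k + 1) = capCells n p k := by
  rw [capCells_succ_of_forall_not_isHit, capCells_update]
  rwa [capCells_update, Function.update_self]

lemma capWeight_update_of_forall_not_isHit {n : ℕ∞} {p : ℕ → ℝ × ℝ} {k : ℕ} {q : ℝ × ℝ}
    (hh : ∀ c ∈ capCells n p k, ¬ IsHit n q c) (x γ : ℝ) :
    capWeight x γ n (k + 1) (Function.update p k q) = capWeight x γ n k p := by
  rw [capWeight, capWeight, capCells_update_of_forall_not_isHit hh]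

lemma measurable_update_apply (p : ℕ → ℝ × ℝ) (k i : ℕ) :
    Measurable fun q : ℝ × ℝ => Function.update p k q i := by
  by_cases h : i = k
  · subst h; simp only [Function.update_self]; exact measurable_id
  · simp only [Function.update_of_ne h]; exact measurable_const

lemma measurable_capWeight_update (x γ : ℝ) (n : ℕ∞) (k : ℕ) (p : ℕ → ℝ × ℝ) :
    Measurable fun q => capWeight x γ n (k + 1) (Function.update p k q) :=
  measurable_capWeight_comp x γ n (k + 1) (measurable_update_apply p k)

lemma integrable_of_abs_le {α : Type*} [MeasurableSpace α] {μ : Measure α} [IsFiniteMeasure μ]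
    {f : α → ℝ} {C : ℝ} (hf : Measurable f) (hC : ∀ a, |f a| ≤ C) : Integrable f μ :=
  Integrable.of_bound hf.aestronglyMeasurable C (ae_of_all _ hC)

/-- The total weight of exponent `β` is preserved on average by a uniform insertion. -/
lemma integral_capWeight_update (x : ℝ) (n : ℕ∞) (k : ℕ) (p : ℕ → ℝ × ℝ) :
    ∫ q, capWeight x beta n (k + 1) (Function.update p k q) ∂unif = capWeight x beta n k p := by
  rw [integral_unif_eq_add_sum (isTiling_capCells n p k) (Θ₀ := capWeight x beta n k p)
    (integrable_of_abs_le (measurable_capWeight_update x beta n k p)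
      fun _ => abs_capWeight_le x beta_pos _ _ _)
    fun q hq => capWeight_update_of_forall_not_isHit (fun c hc hh => hq c hc hh.2) x beta]
  rw [Finset.sum_eq_zero, add_zero]
  intro c hc
  by_cases hl : (c.1.length : ℕ∞) < n
  · rw [setIntegral_congr_fun (g := splitChange x beta c.2) c.2.measurableSet_inner,
      setIntegral_splitChange ((isTiling_capCells n p k).proper c hc) x beta_pos, splitRate_beta]
    · ring
    · intro q hq
      simp only
      rw [capWeight_update_of_isHit hc ⟨hl, hq⟩]; ring
  -- A frozen cell contributes nothing, since a point in its interior splits no cell.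
  · rw [setIntegral_congr_fun (g := fun _ => (0 : ℝ)) c.2.measurableSet_inner]
    · simp
    · intro q hq
      simp only
      rw [capWeight_update_of_forall_not_isHit, sub_self]
      intro d hd hh
      rw [(isTiling_capCells n p k).eq_of_mem hd hc hh.2 hq] at hh
      exact hl hh.1

/-- The exponent in the exponential moment bound. -/
noncomputable def expRate : ℝ := (1 - splitRate (2 * beta)) / 4

lemma expRate_pos : 0 < expRate := by
  have := splitRate_two_mul_beta_lt_one
  rw [expRate]; linarith

lemma expRate_le : expRate ≤ 1 / 4 := by
  have := splitRate_two_mul_beta_pos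
  rw [expRate]; linarith

/-- An exponential functional of the quadtree that decreases on average. -/
noncomputable def expWeight (x : ℝ) (n : ℕ∞) (k : ℕ) (p : ℕ → ℝ × ℝ) : ℝ :=
  Real.exp (expRate * (capWeight x beta n k p + capWeight x (2 * beta) n k p))

lemma expWeight_pos (x : ℝ) (n : ℕ∞) (k : ℕ) (p : ℕ → ℝ × ℝ) : 0 < expWeight x n k p :=
  Real.exp_pos _

lemma expWeight_le (x : ℝ) (n : ℕ∞) (k : ℕ) (p : ℕ → ℝ × ℝ) :
    expWeight x n k p ≤ Real.exp (2 * 2 ^ k) := by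
  refine Real.exp_le_exp.2 ?_
  have hb := beta_pos
  have h1 := capWeight_le x hb n k p
  have h2 := capWeight_le x (γ := 2 * beta) (by linarith) n k p
  have h3 := capWeight_nonneg x beta n k p
  have h4 := capWeight_nonneg x (2 * beta) n k p
  have := expRate_pos
  have := expRate_le
  nlinarith

lemma abs_expWeight_le (x : ℝ) (n : ℕ∞) (k : ℕ) (p : ℕ → ℝ × ℝ) :
    |expWeight x n k p| ≤ Real.exp (2 * 2 ^ k) := by
  rw [abs_of_pos (expWeight_pos x n k p)]; exact expWeight_le x n k p

lemma exp_capWeight_le_expWeight (x : ℝ) (n : ℕ∞) (k : ℕ) (p : ℕ → ℝ × ℝ) :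
    Real.exp (expRate * capWeight x beta n k p) ≤ expWeight x n k p := by
  refine Real.exp_le_exp.2 (mul_le_mul_of_nonneg_left ?_ expRate_pos.le)
  linarith [capWeight_nonneg x (2 * beta) n k p]

lemma expWeight_zero_le (x : ℝ) (n : ℕ∞) (p : ℕ → ℝ × ℝ) : expWeight x n 0 p ≤ Real.exp 2 := by
  simpa using expWeight_le x n 0 p

lemma measurable_expWeight_comp {Z : Type*} [MeasurableSpace Z] (x : ℝ) (n : ℕ∞) (k : ℕ)
    {p : Z → ℕ → ℝ × ℝ} (hp : ∀ i, Measurable fun z => p z i) :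
    Measurable fun z => expWeight x n k (p z) :=
  Real.measurable_exp.comp (((measurable_capWeight_comp x _ n k hp).add
    (measurable_capWeight_comp x _ n k hp)).const_mul _)

lemma expWeight_congr (x : ℝ) (n : ℕ∞) {k : ℕ} {p p' : ℕ → ℝ × ℝ} (hp : ∀ i < k, p i = p' i) :
    expWeight x n k p = expWeight x n k p' := by
  rw [expWeight, expWeight, capWeight_congr _ _ _ hp, capWeight_congr _ _ _ hp]

/-- Use e^y ≤ 1 + y + y² for |y| ≤ 1, and let w be the weight of `R` and κ = `expRate`. The
first-order term of exponent β has mean zero. That of exponent 2β integrates to -κ(1-ρ) w² times the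
area, while the quadratic term is at most (2κw)². The choice κ = (1-ρ)/4 makes the two balance
exactly. -/
lemma setIntegral_exp_splitChange_le {R : Rect} (hR : R.Proper) (x : ℝ) :
    ∫ q in R.inner, (Real.exp (expRate * (splitChange x beta R q + splitChange x (2 * beta) R q))
      - 1) ≤ 0 := by
  have hb := beta_pos
  have hb2 : 0 < 2 * beta := by linarith
  have hk := expRate_pos
  have hk4 := expRate_le
  set w := powWeight x beta R with hw
  have hw2 : powWeight x (2 * beta) R = w ^ 2 := (powWeight_sq hR x beta).symm
  have hw0 : 0 ≤ w := powWeight_nonneg hR x beta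
  have hw1 : w ≤ 1 := powWeight_le_one hR x hb
  have i1 := integrableOn_splitChange hR x hb
  have i2 := integrableOn_splitChange hR x hb2
  have i12 : IntegrableOn (fun q => expRate * (splitChange x beta R q +
      splitChange x (2 * beta) R q)) R.inner := (i1.add i2).const_mul _
  have ic : IntegrableOn (fun _ : ℝ × ℝ => expRate ^ 2 * (4 * w ^ 2)) R.inner :=
    integrableOn_const R.volume_inner_lt_top.ne
  -- The changes at exponents β and 2β are at most w and w², and w ≤ 1.
  have hbound : ∀ q ∈ R.inner,
      |expRate * (splitChange x beta R q + splitChange x (2 * beta) R q)| ≤ expRate * (2 * w) := by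
    intro q hq
    have h1 := abs_splitChange_le hR hq x hb
    have h2 := abs_splitChange_le hR hq x hb2
    rw [hw2] at h2
    rw [abs_mul, abs_of_pos hk]
    refine mul_le_mul_of_nonneg_left ((abs_add_le _ _).trans ?_) hk.le
    nlinarith
  calc _ ≤ ∫ q in R.inner, (expRate * (splitChange x beta R q + splitChange x (2 * beta) R q) +
        expRate ^ 2 * (4 * w ^ 2)) := by
        refine setIntegral_mono_on ?_ (i12.add ic) R.measurableSet_inner ?_
        · refine integrableOn_inner_of_bounded (C := Real.exp 1 + 1) ?_ fun q hq => ?_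
          · exact (Real.measurable_exp.comp (((measurable_splitChange _ _ _).add
              (measurable_splitChange _ _ _)).const_mul _)).sub measurable_const
          · refine (abs_sub _ _).trans ?_
            rw [abs_one, abs_of_pos (Real.exp_pos _)]
            gcongr
            exact (le_abs_self _).trans ((hbound q hq).trans (by nlinarith))
        · intro q hq
          have h1 := hbound q hq
          have h2 : |expRate * (splitChange x beta R q + splitChange x (2 * beta) R q)| ≤ 1 :=
            h1.trans (by nlinarith)
          have h3 := (abs_le.1 (Real.abs_exp_sub_one_sub_id_le h2)).2
          have h4 := sq_le_sq' (abs_le.1 h1).1 (abs_le.1 h1).2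
          nlinarith
    _ = expRate * ((splitRate (2 * beta) - 1) * (R.area * w ^ 2)) +
        R.area * (expRate ^ 2 * (4 * w ^ 2)) := by
        rw [integral_add i12 ic, integral_const_mul, integral_add i1 i2,
          setIntegral_splitChange hR x hb, setIntegral_splitChange hR x hb2, splitRate_beta, hw2,
          setIntegral_const, hR.volume_real_inner, smul_eq_mul]
        ring
    _ ≤ 0 := by
        have : splitRate (2 * beta) - 1 = -(4 * expRate) := by rw [expRate]; ring
        rw [this]
        apply le_of_eq; ring

lemma integral_expWeight_update_le (x : ℝ) (n : ℕ∞) (k : ℕ) (p : ℕ → ℝ × ℝ) :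
    ∫ q, expWeight x n (k + 1) (Function.update p k q) ∂unif ≤ expWeight x n k p := by
  have hcongr : ∀ q, (∀ c ∈ capCells n p k, ¬ IsHit n q c) →
      expWeight x n (k + 1) (Function.update p k q) = expWeight x n k p := by
    intro q hq
    rw [expWeight, expWeight, capWeight_update_of_forall_not_isHit hq,
      capWeight_update_of_forall_not_isHit hq]
  rw [integral_unif_eq_add_sum (isTiling_capCells n p k) (Θ₀ := expWeight x n k p)
    (integrable_of_abs_le (measurable_expWeight_comp x n (k + 1) (measurable_update_apply p k))
      fun _ => abs_expWeight_le x _ _ _)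
    fun q hq => hcongr q fun c hc hh => hq c hc hh.2]
  refine add_le_of_nonpos_right (Finset.sum_nonpos fun c hc => ?_)
  by_cases hl : (c.1.length : ℕ∞) < n
  -- A hit multiplies the functional by a factor that depends only on the cell hit, so the present
  -- value can be taken out of the integral.
  · rw [setIntegral_congr_fun (g := fun q => expWeight x n k p *
      (Real.exp (expRate * (splitChange x beta c.2 q + splitChange x (2 * beta) c.2 q)) - 1))
      c.2.measurableSet_inner, integral_const_mul]
    · exact mul_nonpos_of_nonneg_of_nonpos (expWeight_pos _ _ _ _).le
        (setIntegral_exp_splitChange_le ((isTiling_capCells n p k).proper c hc) x)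
    · intro q hq
      simp only [expWeight]
      rw [capWeight_update_of_isHit hc ⟨hl, hq⟩, capWeight_update_of_isHit hc ⟨hl, hq⟩, mul_sub,
        mul_one, ← Real.exp_add]
      ring_nf
  · rw [setIntegral_congr_fun (g := fun _ => (0 : ℝ)) c.2.measurableSet_inner]
    · simp
    · intro q hq
      simp only
      rw [hcongr, sub_self]
      intro d hd hh
      rw [(isTiling_capCells n p k).eq_of_mem hd hc hh.2 hq] at hh
      exact hl hh.1

/-! ### The effect of the cap -/

/-- The conditional variance still to come from generations at least `n`. -/
noncomputable def varPotential (x : ℝ) (n k : ℕ) (p : ℕ → ℝ × ℝ) : ℝ :=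
  ∑ c ∈ capCells ⊤ p k, splitRate (2 * beta) ^ (n - c.1.length) * powWeight x (2 * beta) c.2

/-- A quadratic functional controlling the effect of the cap, which decreases on average. -/
noncomputable def capVariance (x : ℝ) (n k : ℕ) (p : ℕ → ℝ × ℝ) : ℝ :=
  (capWeight x beta ⊤ k p - capWeight x beta n k p) ^ 2 +
    (1 - splitRate (2 * beta))⁻¹ * varPotential x n k p

lemma varPotential_nonneg (x : ℝ) (n k : ℕ) (p : ℕ → ℝ × ℝ) : 0 ≤ varPotential x n k p :=
  Finset.sum_nonneg fun c hc => mul_nonneg (pow_nonneg splitRate_two_mul_beta_pos.le _)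
    (powWeight_nonneg ((isTiling_capCells ⊤ p k).proper c hc) x _)

lemma varPotential_le (x : ℝ) (n k : ℕ) (p : ℕ → ℝ × ℝ) : varPotential x n k p ≤ 2 ^ k := by
  refine le_trans (Finset.sum_le_sum fun c hc => ?_)
    (capWeight_le x (γ := 2 * beta) (by linarith [beta_pos]) ⊤ k p)
  refine mul_le_of_le_one_left (powWeight_nonneg ((isTiling_capCells ⊤ p k).proper c hc) x _) ?_
  exact pow_le_one₀ splitRate_two_mul_beta_pos.le splitRate_two_mul_beta_lt_one.le

lemma inv_one_sub_splitRate_pos : 0 < (1 - splitRate (2 * beta))⁻¹ :=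
  inv_pos.2 (by linarith [splitRate_two_mul_beta_lt_one])

lemma sq_sub_le_capVariance (x : ℝ) (n k : ℕ) (p : ℕ → ℝ × ℝ) :
    (capWeight x beta ⊤ k p - capWeight x beta n k p) ^ 2 ≤ capVariance x n k p :=
  le_add_of_nonneg_right (mul_nonneg inv_one_sub_splitRate_pos.le (varPotential_nonneg x n k p))

lemma capVariance_nonneg (x : ℝ) (n k : ℕ) (p : ℕ → ℝ × ℝ) : 0 ≤ capVariance x n k p :=
  (sq_nonneg _).trans (sq_sub_le_capVariance x n k p)

lemma abs_capVariance_le (x : ℝ) (n k : ℕ) (p : ℕ → ℝ × ℝ) :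
    |capVariance x n k p| ≤ (2 ^ k) ^ 2 + (1 - splitRate (2 * beta))⁻¹ * 2 ^ k := by
  rw [abs_of_nonneg (capVariance_nonneg x n k p)]
  refine add_le_add ?_ (mul_le_mul_of_nonneg_left (varPotential_le x n k p)
    inv_one_sub_splitRate_pos.le)
  have h1 := capWeight_le x beta_pos ⊤ k p
  have h2 := capWeight_nonneg x beta ⊤ k p
  have h3 := capWeight_le x beta_pos n k p
  have h4 := capWeight_nonneg x beta n k p
  exact sq_le_sq' (by linarith) (by linarith)

/-- Before any insertion both trees are the unit square, of generation 0 and thus discounted by ρ^n.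
This is the origin of the geometric rate. -/
lemma capVariance_zero_le (x : ℝ) (n : ℕ) (p : ℕ → ℝ × ℝ) :
    capVariance x n 0 p ≤ (1 - splitRate (2 * beta))⁻¹ * splitRate (2 * beta) ^ n := by
  have h1 := powWeight_le_one unitSquare_proper x (γ := 2 * beta) (by linarith [beta_pos])
  simp only [capVariance, capWeight, varPotential, capCells, Finset.sum_singleton, sub_self,
    List.length_nil, Nat.sub_zero]
  rw [zero_pow two_ne_zero, zero_add]
  refine mul_le_mul_of_nonneg_left ?_ inv_one_sub_splitRate_pos.le
  exact mul_le_of_le_one_right (pow_nonneg splitRate_two_mul_beta_pos.le _) h1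

lemma measurable_capVariance_comp {Z : Type*} [MeasurableSpace Z] (x : ℝ) (n k : ℕ)
    {p : Z → ℕ → ℝ × ℝ} (hp : ∀ i, Measurable fun z => p z i) :
    Measurable fun z => capVariance x n k (p z) :=
  (((measurable_capWeight_comp x _ _ k hp).sub (measurable_capWeight_comp x _ _ k hp)).pow_const
    2).add (Measurable.const_mul (measurable_sum_capCells ⊤ hp k
      (fun u _ R => splitRate (2 * beta) ^ (n - u.length) * powWeight x (2 * beta) R)
      fun _ => ((measurable_powWeight x _).comp measurable_snd).const_mul _) _)

lemma capVariance_congr (x : ℝ) (n : ℕ) {k : ℕ} {p p' : ℕ → ℝ × ℝ} (hp : ∀ i < k, p i = p' i) :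
    capVariance x n k p = capVariance x n k p' := by
  rw [capVariance, capVariance, capWeight_congr _ _ _ hp, capWeight_congr _ _ _ hp, varPotential,
    varPotential, capCells_congr _ hp]

lemma varPotential_update_of_mem {n k : ℕ} {p : ℕ → ℝ × ℝ} {q : ℝ × ℝ} {c : Cell}
    (hc : c ∈ capCells ⊤ p k) (hq : q ∈ c.2.inner) (x : ℝ) :
    varPotential x n (k + 1) (Function.update p k q) = varPotential x n k p +
      (splitRate (2 * beta) ^ (n - (c.1.length + 1)) * ∑ j, powWeight x (2 * beta) (c.2.split q j) -
        splitRate (2 * beta) ^ (n - c.1.length) * powWeight x (2 * beta) c.2) := by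
  rw [varPotential, sum_capCells_update_of_isHit hc ⟨ENat.natCast_lt_top _, hq⟩, varPotential,
    Finset.mul_sum]
  simp [child]

/-- A cell of generation below `n` belongs to both trees, so its split leaves their difference
unchanged. The discount exponent of its children is one less, which offsets the mean factor ρ, and
there is no drift. A split of a cell of generation at least `n` affects the free tree only. The
cross term then has mean zero and the square gains at most w² times the area, which is what the
potential loses after multiplication by 1/(1-ρ). -/
lemma integral_capVariance_update_le (x : ℝ) (n k : ℕ) (p : ℕ → ℝ × ℝ) :
    ∫ q, capVariance x n (k + 1) (Function.update p k q) ∂unif ≤ capVariance x n k p := by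
  have hb := beta_pos
  have hb2 : 0 < 2 * beta := by linarith
  have ht := isTiling_capCells ⊤ p k
  rw [integral_unif_eq_add_sum ht (Θ₀ := capVariance x n k p)
    (integrable_of_abs_le (measurable_capVariance_comp x n (k + 1) (measurable_update_apply p k))
      fun _ => abs_capVariance_le x _ _ _)]
  swap
  · intro q hq
    have h1 : ∀ c ∈ capCells ⊤ p k, ¬ IsHit ⊤ q c := fun c hc hh => hq c hc hh.2
    have h2 : ∀ c ∈ capCells n p k, ¬ IsHit n q c := fun c hc hh =>
      hq c ((mem_capCells_iff_of_length_lt hh.1).1 hc) hh.2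
    rw [capVariance, capVariance, capWeight_update_of_forall_not_isHit h1,
      capWeight_update_of_forall_not_isHit h2, varPotential, varPotential,
      capCells_update_of_forall_not_isHit h1]
  refine add_le_of_nonpos_right (Finset.sum_nonpos fun c hc => ?_)
  have hR := ht.proper c hc
  have htop : ∀ q ∈ c.2.inner, IsHit ⊤ q c := fun q hq => ⟨ENat.natCast_lt_top _, hq⟩
  by_cases hl : c.1.length < n
  · have hl' : (c.1.length : ℕ∞) < n := by exact_mod_cast hl
    rw [setIntegral_congr_fun (g := fun q => (1 - splitRate (2 * beta))⁻¹ *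
      (splitRate (2 * beta) ^ (n - (c.1.length + 1)) * (splitChange x (2 * beta) c.2 q +
        (1 - splitRate (2 * beta)) * powWeight x (2 * beta) c.2))) c.2.measurableSet_inner]
    · rw [integral_const_mul, integral_const_mul, integral_add (integrableOn_splitChange hR x hb2)
        (integrableOn_const c.2.volume_inner_lt_top.ne), setIntegral_splitChange hR x hb2,
        setIntegral_const, hR.volume_real_inner, smul_eq_mul]
      apply le_of_eq; ring
    · intro q hq
      simp only [capVariance]
      rw [capWeight_update_of_isHit hc (htop q hq), capWeight_update_of_isHit
        ((mem_capCells_iff_of_length_lt hl').2 hc) ⟨hl', hq⟩, varPotential_update_of_mem hc hq,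
        splitChange, splitChange]
      -- With truncated subtraction this requires the generation to be below `n`.
      have : n - c.1.length = n - (c.1.length + 1) + 1 := by omega
      rw [this, pow_succ]
      ring
  -- From generation `n` on the subtraction truncates to 0, and neither the cell nor its children
  -- are discounted.
  · have hl0 : n - c.1.length = 0 := by omega
    have hl1 : n - (c.1.length + 1) = 0 := by omega
    have hn : ∀ q ∈ c.2.inner, ∀ d ∈ capCells n p k, ¬ IsHit n q d := by
      intro q hq d hd hh
      rw [ht.eq_of_mem ((mem_capCells_iff_of_length_lt hh.1).1 hd) hc hh.2 hq] at hh
      exact hl (by exact_mod_cast hh.1)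
    set X := capWeight x beta ⊤ k p - capWeight x beta n k p with hX
    have i1 := (integrableOn_splitChange hR x hb).const_mul (2 * X)
    have i2 := (integrableOn_splitChange hR x hb2).const_mul (1 - splitRate (2 * beta))⁻¹
    have ic : IntegrableOn (fun _ : ℝ × ℝ => powWeight x (2 * beta) c.2) c.2.inner :=
      integrableOn_const c.2.volume_inner_lt_top.ne
    have heq : Set.EqOn (fun q => capVariance x n (k + 1) (Function.update p k q) -
        capVariance x n k p) (fun q => 2 * X * splitChange x beta c.2 q +
          splitChange x beta c.2 q ^ 2 +
          (1 - splitRate (2 * beta))⁻¹ * splitChange x (2 * beta) c.2 q) c.2.inner := by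
      intro q hq
      simp only [capVariance]
      rw [capWeight_update_of_isHit hc (htop q hq),
        capWeight_update_of_forall_not_isHit (hn q hq), varPotential_update_of_mem hc hq, hl0, hl1,
        splitChange, splitChange, hX]
      ring
    have hsq : ∀ q ∈ c.2.inner, splitChange x beta c.2 q ^ 2 ≤ powWeight x (2 * beta) c.2 := by
      intro q hq
      have h1 := abs_splitChange_le hR hq x hb
      rw [← powWeight_sq hR]
      exact sq_le_sq' (abs_le.1 h1).1 (abs_le.1 h1).2
    have i3 : IntegrableOn (fun q => splitChange x beta c.2 q ^ 2) c.2.inner := by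
      refine integrableOn_inner_of_bounded (C := powWeight x (2 * beta) c.2)
        ((measurable_splitChange _ _ _).pow_const 2) fun q hq => ?_
      rw [abs_of_nonneg (sq_nonneg _)]; exact hsq q hq
    rw [setIntegral_congr_fun c.2.measurableSet_inner heq]
    calc _ ≤ ∫ q in c.2.inner, (2 * X * splitChange x beta c.2 q + powWeight x (2 * beta) c.2 +
          (1 - splitRate (2 * beta))⁻¹ * splitChange x (2 * beta) c.2 q) := by
          refine setIntegral_mono_on ((i1.add i3).add i2) ((i1.add ic).add i2)
            c.2.measurableSet_inner fun q hq => ?_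
          linarith [hsq q hq]
      _ = 0 := by
          have h1 : 1 - splitRate (2 * beta) ≠ 0 := by linarith [splitRate_two_mul_beta_lt_one]
          have i4 : IntegrableOn (fun q => 2 * X * splitChange x beta c.2 q +
            powWeight x (2 * beta) c.2) c.2.inner := i1.add ic
          rw [integral_add i4 i2, integral_add i1 ic, integral_const_mul,
            integral_const_mul, setIntegral_splitChange hR x hb, setIntegral_splitChange hR x hb2,
            splitRate_beta, setIntegral_const, hR.volume_real_inner, smul_eq_mul]
          field_simp
          ring
      _ ≤ 0 := le_rfl

end Quadtree

/-! ### Counts of a Poisson point process -/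

section Poisson

variable {Ω E : Type*} [MeasurableSpace Ω] [MeasurableSpace E] {N : Ω → Measure E}
  {μ : Measure E} {P : Measure Ω}

lemma IsPoissonPointProcess.measurable_count (hN : IsPoissonPointProcess N μ P) {B : Set E}
    (hB : MeasurableSet B) : Measurable fun ω => N ω B :=
  (Measure.measurable_coe hB).comp hN.measurable

lemma IsPoissonPointProcess.measure_count_eq (hN : IsPoissonPointProcess N μ P) {B : Set E}
    (hB : MeasurableSet B) {r : ℝ≥0} (hr : μ B = r) (k : ℕ) :
    P {ω | N ω B = k} = ENNReal.ofReal (Real.exp (-r) * r ^ k / (k.factorial : ℝ)) := by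
  have h1 := congrArg (fun m : Measure ℝ≥0∞ => m {(k : ℝ≥0∞)}) (hN.law B hB r hr)
  rw [Measure.map_apply (hN.measurable_count hB) (measurableSet_singleton _),
    Measure.map_apply measurable_from_nat (measurableSet_singleton _)] at h1
  have h2 : (fun k : ℕ => (k : ℝ≥0∞)) ⁻¹' {(k : ℝ≥0∞)} = {k} := by
    ext j; simp
  rw [h2, poissonMeasure_singleton] at h1
  exact h1

lemma IsPoissonPointProcess.ae_count_lt_top [IsProbabilityMeasure P]
    (hN : IsPoissonPointProcess N μ P) {B : Set E} (hB : MeasurableSet B) (hr : μ B ≠ ⊤) :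
    ∀ᵐ ω ∂P, N ω B ≠ ⊤ := by
  have h1 := congrArg (fun m : Measure ℝ≥0∞ => m {(⊤ : ℝ≥0∞)})
    (hN.law B hB _ (ENNReal.coe_toNNReal hr).symm)
  rw [Measure.map_apply (hN.measurable_count hB) (measurableSet_singleton _),
    Measure.map_apply measurable_from_nat (measurableSet_singleton _)] at h1
  have h2 : (fun k : ℕ => (k : ℝ≥0∞)) ⁻¹' {(⊤ : ℝ≥0∞)} = ∅ := by
    ext j; simp
  rw [h2, measure_empty] at h1
  rw [ae_iff]
  simp only [not_not]
  exact h1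

lemma IsPoissonPointProcess.ae_count_eq_zero [IsProbabilityMeasure P]
    (hN : IsPoissonPointProcess N μ P) {B : Set E} (hB : MeasurableSet B) (hr : μ B = 0) :
    ∀ᵐ ω ∂P, N ω B = 0 := by
  have h1 := hN.measure_count_eq hB (r := 0) (by simpa using hr) 0
  have h2 : MeasurableSet {ω | N ω B = 0} := hN.measurable_count hB (measurableSet_singleton 0)
  have h3 : P {ω | N ω B = 0} = 1 := by simpa using h1
  exact (prob_compl_eq_zero_iff h2).2 h3

lemma IsPoissonPointProcess.iIndepFun_count (hN : IsPoissonPointProcess N μ P) {ι : Type*}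
    [Fintype ι] (B : ι → Set E) (hB : ∀ i, MeasurableSet (B i))
    (hd : Pairwise (Function.onFun Disjoint B)) : iIndepFun (fun i ω => N ω (B i)) P := by
  have h1 := hN.indep _ (fun i => B ((Fintype.equivFin ι).symm i)) (fun i => hB _)
    (fun i j hij => hd (by simpa using hij))
  have h2 := h1.precomp (Fintype.equivFin ι).injective
  simpa using h2

end Poisson

namespace Quadtree

/-! ### Times and positions of the atoms, observed on a mesh -/

/-- The `a`-th time slot of mesh `1 / (n + 1)`. -/
def slot (n a : ℕ) : Set ℝ := {t | 0 ≤ t ∧ ⌊t * (n + 1)⌋₊ = a}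

lemma slot_eq (n a : ℕ) : slot n a = Set.Ico ((a : ℝ) / (n + 1)) ((a + 1 : ℝ) / (n + 1)) := by
  ext t
  have hn : (0 : ℝ) < n + 1 := by positivity
  simp only [slot, Set.mem_ofPred_eq, Set.mem_Ico]
  rw [div_le_iff₀ hn, lt_div_iff₀ hn]
  constructor
  · rintro ⟨h0, h1⟩
    exact (Nat.floor_eq_iff (by positivity)).1 h1
  · intro h1
    have h2 : 0 ≤ t * (n + 1) := le_trans (Nat.cast_nonneg a) h1.1
    refine ⟨nonneg_of_mul_nonneg_left h2 hn, (Nat.floor_eq_iff h2).2 h1⟩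

lemma measurableSet_slot (n a : ℕ) : MeasurableSet (slot n a) := by
  rw [slot_eq]; exact measurableSet_Ico

lemma intensity_slot_prod (n a : ℕ) {V : Set (ℝ × ℝ)} (hV : MeasurableSet V) :
    intensity (slot n a ×ˢ V) = ENNReal.ofReal (1 / (n + 1)) * unif V := by
  rw [intensity, Measure.restrict_apply ((measurableSet_slot n a).prod hV), Set.prod_inter_prod,
    Measure.volume_eq_prod, Measure.prod_prod, unif, Measure.restrict_apply hV]
  congr 1
  rw [Set.inter_eq_left.2 fun t ht => ht.1, slot_eq, Real.volume_Ico]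
  congr 1
  ring

/-- The number of points of an enumerated configuration in a set. -/
noncomputable def count (t : ℕ → ℝ) (q : ℕ → ℝ × ℝ) (S : Set (ℝ × ℝ × ℝ)) : ℝ≥0∞ :=
  Measure.sum (fun i => Measure.dirac (t i, q i)) S

open Classical in
lemma count_eq_tsum (t : ℕ → ℝ) (q : ℕ → ℝ × ℝ) {S : Set (ℝ × ℝ × ℝ)} (hS : MeasurableSet S) :
    count t q S = ∑' i, if (t i, q i) ∈ S then 1 else 0 := by
  rw [count, Measure.sum_apply _ hS]
  refine tsum_congr fun i => ?_
  rw [Measure.dirac_apply' _ hS, Set.indicator_apply]; rfl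

lemma count_eq_zero_iff {t : ℕ → ℝ} {q : ℕ → ℝ × ℝ} {S : Set (ℝ × ℝ × ℝ)} (hS : MeasurableSet S) :
    count t q S = 0 ↔ ∀ i, (t i, q i) ∉ S := by
  classical
  rw [count_eq_tsum t q hS, ENNReal.tsum_eq_zero]
  simp

lemma count_eq_one_of_unique {t : ℕ → ℝ} {q : ℕ → ℝ × ℝ} {S : Set (ℝ × ℝ × ℝ)}
    (hS : MeasurableSet S) {i : ℕ} (hi : (t i, q i) ∈ S) (hu : ∀ j, (t j, q j) ∈ S → j = i) :
    count t q S = 1 := by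
  classical
  rw [count_eq_tsum t q hS, tsum_eq_single i fun j hj => if_neg fun h => hj (hu j h), if_pos hi]

lemma eq_of_count_eq_one {t : ℕ → ℝ} {q : ℕ → ℝ × ℝ} {S : Set (ℝ × ℝ × ℝ)}
    (hS : MeasurableSet S) (hc : count t q S = 1) {i j : ℕ} (hi : (t i, q i) ∈ S)
    (hj : (t j, q j) ∈ S) : i = j := by
  classical
  by_contra hne
  rw [count_eq_tsum t q hS] at hc
  have h1 := ENNReal.sum_le_tsum (f := fun i => if (t i, q i) ∈ S then (1 : ℝ≥0∞) else 0) {i, j}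
  rw [hc, Finset.sum_pair hne, if_pos hi, if_pos hj] at h1
  norm_num at h1

/-- The event that the first `m + 1` atoms fall into the prescribed slots and sets, each slot
up to that of the last one containing no other atom. -/
def SlotEvent (n m : ℕ) (a : Fin (m + 1) → ℕ) (W : ℕ → Set (ℝ × ℝ)) (t : ℕ → ℝ)
    (q : ℕ → ℝ × ℝ) : Prop :=
  (∀ i : Fin (m + 1), ⌊t i * (n + 1)⌋₊ = a i ∧ q i ∈ W (a i)) ∧
    a (Fin.last m) < ⌊t (m + 1) * (n + 1)⌋₊

open Classical in
-- Translates an event about ranked atoms into counts in disjoint boxes, to which the independence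
-- of a Poisson process applies. Conversely, the counts provide exactly one atom σ(i) in each
-- prescribed slot and none in the other slots up to the last. Then σ is increasing, and its range
-- has m+1 elements and contains 0, …, m, so σ(i) = i.
lemma slotEvent_iff_count {n m : ℕ} {a : Fin (m + 1) → ℕ} (ha : StrictMono a)
    {W : ℕ → Set (ℝ × ℝ)} (hW : ∀ b, MeasurableSet (W b)) {t : ℕ → ℝ}
    {q : ℕ → ℝ × ℝ} (ht : StrictMono t) (ht0 : ∀ i, 0 ≤ t i) :
    SlotEvent n m a W t q ↔ ∀ b < a (Fin.last m) + 1,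
      count t q (slot n b ×ˢ W b) = (if b ∈ Set.range a then 1 else 0) ∧
      count t q (slot n b ×ˢ (W b)ᶜ) = 0 := by
  have hA : Monotone fun i => ⌊t i * (n + 1)⌋₊ := fun i j hij =>
    Nat.floor_mono (mul_le_mul_of_nonneg_right (ht.monotone hij) (by positivity))
  have hmem : ∀ (b : ℕ) (V : Set (ℝ × ℝ)) (j : ℕ),
      (t j, q j) ∈ slot n b ×ˢ V ↔ ⌊t j * (n + 1)⌋₊ = b ∧ q j ∈ V := by
    intro b V j; simp [slot, ht0 j]
  have hS : ∀ b, MeasurableSet (slot n b ×ˢ W b) := fun b => (measurableSet_slot n b).prod (hW b)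
  have hS' : ∀ b, MeasurableSet (slot n b ×ˢ (W b)ᶜ) :=
    fun b => (measurableSet_slot n b).prod (hW b).compl
  have hlast : ∀ i, a i ≤ a (Fin.last m) := fun i => ha.monotone (Fin.le_last i)
  constructor
  · rintro ⟨h1, h2⟩ b hb
    -- As the times increase, all atoms from index m+1 on lie beyond the last prescribed slot.
    have hj : ∀ j, ⌊t j * (n + 1)⌋₊ = b → ∃ i : Fin (m + 1), (i : ℕ) = j ∧ a i = b := by
      intro j hj
      have hjm : j < m + 1 := by
        by_contra hcon
        have := hA (not_lt.1 hcon)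
        simp only at this
        omega
      exact ⟨⟨j, hjm⟩, rfl, by rw [← (h1 ⟨j, hjm⟩).1]; exact hj⟩
    by_cases hbr : b ∈ Set.range a
    · obtain ⟨i, rfl⟩ := hbr
      have huniq : ∀ j, ⌊t j * (n + 1)⌋₊ = a i → j = i := by
        intro j hj'
        obtain ⟨i', rfl, hi'⟩ := hj j hj'
        rw [ha.injective hi']
      rw [if_pos ⟨i, rfl⟩]
      refine ⟨count_eq_one_of_unique (hS _) (i := i) ((hmem _ _ _).2 (h1 i))
        fun j hj' => huniq j ((hmem _ _ _).1 hj').1, (count_eq_zero_iff (hS' _)).2 fun j hj' => ?_⟩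
      obtain ⟨h3, h4⟩ := (hmem _ _ _).1 hj'
      rw [huniq j h3] at h4
      exact h4 (h1 i).2
    · rw [if_neg hbr]
      refine ⟨(count_eq_zero_iff (hS _)).2 fun j hj' => ?_,
        (count_eq_zero_iff (hS' _)).2 fun j hj' => ?_⟩
      · obtain ⟨i, _, hi⟩ := hj j ((hmem _ _ _).1 hj').1
        exact hbr ⟨i, hi⟩
      · obtain ⟨i, _, hi⟩ := hj j ((hmem _ _ _).1 hj').1
        exact hbr ⟨i, hi⟩
  · intro h
    have hin : ∀ b < a (Fin.last m) + 1, ∀ j, ⌊t j * (n + 1)⌋₊ = b → q j ∈ W b := by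
      intro b hb j hj
      by_contra hq
      exact (count_eq_zero_iff (hS' b)).1 (h b hb).2 j ((hmem _ _ _).2 ⟨hj, hq⟩)
    have hex : ∀ i, ∃ j, ⌊t j * (n + 1)⌋₊ = a i := by
      intro i
      by_contra hcon
      push Not at hcon
      have h0 : count t q (slot n (a i) ×ˢ W (a i)) = 0 :=
        (count_eq_zero_iff (hS _)).2 fun j hj => hcon j ((hmem _ _ _).1 hj).1
      have := (h (a i) (Nat.lt_succ_of_le (hlast i))).1
      rw [h0, if_pos ⟨i, rfl⟩] at this
      exact zero_ne_one this
    choose σ hσ using hex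
    have huniq : ∀ i j, ⌊t j * (n + 1)⌋₊ = a i → j = σ i := by
      intro i j hj
      have hb := Nat.lt_succ_of_le (hlast i)
      have hc := (h (a i) hb).1
      rw [if_pos ⟨i, rfl⟩] at hc
      exact eq_of_count_eq_one (hS _) hc ((hmem _ _ _).2 ⟨hj, hin _ hb j hj⟩)
        ((hmem _ _ _).2 ⟨hσ i, hin _ hb _ (hσ i)⟩)
    have hrange : ∀ j, ⌊t j * (n + 1)⌋₊ < a (Fin.last m) + 1 → j ∈ Set.range σ := by
      intro j hj
      by_cases hbr : ⌊t j * (n + 1)⌋₊ ∈ Set.range a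
      · obtain ⟨i, hi⟩ := hbr
        exact ⟨i, (huniq i j hi.symm).symm⟩
      · have hc := (h _ hj).1
        rw [if_neg hbr] at hc
        exact absurd ((hmem _ _ _).2 ⟨rfl, hin _ hj j rfl⟩) ((count_eq_zero_iff (hS _)).1 hc j)
    have hσm : StrictMono σ := by
      intro i i' hii
      by_contra hcon
      have h1 := hA (not_lt.1 hcon)
      simp only [hσ] at h1
      exact absurd (ha hii) (not_lt.2 h1)
    have hle : ∀ i : Fin (m + 1), (i : ℕ) ≤ σ i := by
      intro ⟨i, hi⟩
      induction i with
      | zero => exact Nat.zero_le _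
      | succ i ih =>
        have h1 := ih (by omega)
        have h2 : σ ⟨i, by omega⟩ < σ ⟨i + 1, hi⟩ := hσm (by simp)
        simp only at h1 ⊢
        omega
    have hsub : Finset.range (m + 1) ⊆ Finset.univ.image σ := by
      intro j hj
      have hj' := Finset.mem_range.1 hj
      have h1 := hA (hle ⟨j, hj'⟩)
      simp only [hσ] at h1
      obtain ⟨i, hi⟩ := hrange j (Nat.lt_succ_of_le (h1.trans (hlast _)))
      exact Finset.mem_image.2 ⟨i, Finset.mem_univ _, hi⟩
    have heq : Finset.range (m + 1) = Finset.univ.image σ := by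
      refine Finset.eq_of_subset_of_card_le hsub ?_
      rw [Finset.card_image_of_injective _ hσm.injective]; simp
    have hσ_eq : σ = fun i : Fin (m + 1) => (i : ℕ) := by
      refine (StrictMono.range_inj hσm (fun i j hij => hij)).1 ?_
      ext j
      have h1 : j ∈ Finset.univ.image σ ↔ j ∈ Set.range σ := by simp
      rw [← h1, ← heq, Finset.mem_range]
      constructor
      · intro hj; exact ⟨⟨j, hj⟩, rfl⟩
      · rintro ⟨i, rfl⟩; exact i.2
    have hσi : ∀ i : Fin (m + 1), ⌊t i * (n + 1)⌋₊ = a i := by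
      intro i
      have := hσ i
      rwa [hσ_eq] at this
    refine ⟨fun i => ⟨hσi i, hin _ (Nat.lt_succ_of_le (hlast i)) i (hσi i)⟩, ?_⟩
    by_contra hcon
    obtain ⟨i, hi⟩ := hrange (m + 1) (by omega)
    rw [hσ_eq] at hi
    have := i.2
    simp only at hi
    omega

end Quadtree

/-! ### The joint law of the times and the positions -/

namespace Quadtree

lemma measurableSet_ofPred_forall {Ω ι : Type*} [MeasurableSpace Ω] [Countable ι]
    {q : ι → Ω → Prop} (h : ∀ i, MeasurableSet {ω | q i ω}) : MeasurableSet {ω | ∀ i, q i ω} := by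
  have : {ω | ∀ i, q i ω} = ⋂ i, {ω | q i ω} := by ext; simp
  rw [this]; exact MeasurableSet.iInter h

lemma measure_slot_count {Ω : Type*} [MeasurableSpace Ω] {P : Measure Ω}
    {N : Ω → Measure (ℝ × ℝ × ℝ)} (hN : IsPoissonPointProcess N intensity P) (n b k : ℕ) {V : Set (ℝ × ℝ)} (hV : MeasurableSet V) :
    P {ω | N ω (slot n b ×ˢ V) = k} = ENNReal.ofReal (Real.exp (-(1 / (n + 1) * unif.real V)) *
      (1 / (n + 1) * unif.real V) ^ k / (k.factorial : ℝ)) := by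
  have h0 : 0 ≤ 1 / ((n : ℝ) + 1) * unif.real V := by positivity
  have hr : intensity (slot n b ×ˢ V) =
      ((Real.toNNReal (1 / (n + 1) * unif.real V) : ℝ≥0) : ℝ≥0∞) := by
    rw [intensity_slot_prod n b hV, ENNReal.ofNNReal_toNNReal,
      ENNReal.ofReal_mul (by positivity), Measure.real, ENNReal.ofReal_toReal (measure_ne_top _ _)]
  rw [hN.measure_count_eq ((measurableSet_slot n b).prod hV) hr k, Real.coe_toNNReal _ h0]

section Atoms

variable {Ω : Type*} [MeasurableSpace Ω] {P : Measure Ω} [IsProbabilityMeasure P]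
  {N : Ω → Measure (ℝ × ℝ × ℝ)} {τ : ℕ → Ω → ℝ} {p : ℕ → Ω → ℝ × ℝ}

lemma ae_time_nonneg (hN : IsPoissonPointProcess N intensity P)
    (hatoms : ∀ᵐ ω ∂P, N ω = Measure.sum (fun i => Measure.dirac (τ i ω, p i ω))) :
    ∀ᵐ ω ∂P, ∀ i, 0 ≤ τ i ω := by
  have hS : MeasurableSet (Set.Iio (0 : ℝ) ×ˢ (Set.univ : Set (ℝ × ℝ))) :=
    measurableSet_Iio.prod MeasurableSet.univ
  have h0 : intensity (Set.Iio (0 : ℝ) ×ˢ (Set.univ : Set (ℝ × ℝ))) = 0 := by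
    rw [intensity, Measure.restrict_apply hS, Set.prod_inter_prod]
    have : Set.Iio (0 : ℝ) ∩ Set.Ici 0 = ∅ := by ext t; simp
    simp [this]
  filter_upwards [hN.ae_count_eq_zero hS h0, hatoms] with ω h1 h2 i
  rw [h2] at h1
  have := (count_eq_zero_iff (t := fun i => τ i ω) (q := fun i => p i ω) hS).1 h1 i
  simpa using this

open Classical in
/-- The probability that the slots up to the last prescribed one are occupied as prescribed. -/
noncomputable def slotProb (n m : ℕ) (a : Fin (m + 1) → ℕ) : ℝ≥0∞ :=
  ∏ b ∈ Finset.range (a (Fin.last m) + 1),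
    if b ∈ Set.range a then ENNReal.ofReal (Real.exp (-(1 / (n + 1))) * (1 / (n + 1)))
    else ENNReal.ofReal (Real.exp (-(1 / (n + 1))))

/-- With δ = 1/(n+1) and u the uniform measure of `W b`, slot `b` splits into two boxes with
independent Poisson counts of means δu and δ(1-u). The two exponentials combine to e^(-δ), so `W b`
enters only through the factor u of an occupied slot. The hypothesis `hWu` gives u = 1 on the slots
that must be empty. -/
lemma measure_slotEvent (hN : IsPoissonPointProcess N intensity P)
    (hatoms : ∀ᵐ ω ∂P, N ω = Measure.sum (fun i => Measure.dirac (τ i ω, p i ω)))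
    (hrank : ∀ᵐ ω ∂P, StrictMono (fun i => τ i ω)) (n m : ℕ) {a : Fin (m + 1) → ℕ}
    (ha : StrictMono a) {W : ℕ → Set (ℝ × ℝ)} (hW : ∀ b, MeasurableSet (W b))
    (hWu : ∀ b ∉ Set.range a, W b = Set.univ) :
    P {ω | SlotEvent n m a W (fun i => τ i ω) (fun i => p i ω)} =
      (∏ b ∈ Finset.range (a (Fin.last m) + 1), unif (W b)) * slotProb n m a := by
  classical
  set L := a (Fin.last m) + 1 with hL
  let S : Fin L × Bool → Set (ℝ × ℝ × ℝ) := fun y =>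
    slot n y.1 ×ˢ (if y.2 then W y.1 else (W y.1)ᶜ)
  let c : Fin L × Bool → ℕ := fun y => if y.2 ∧ (y.1 : ℕ) ∈ Set.range a then 1 else 0
  have hV : ∀ y : Fin L × Bool, MeasurableSet (if y.2 then W y.1 else (W y.1)ᶜ) := by
    intro y; split_ifs
    · exact hW _
    · exact (hW _).compl
  have hS : ∀ y, MeasurableSet (S y) := fun y => (measurableSet_slot n y.1).prod (hV y)
  have hd : Pairwise (Function.onFun Disjoint S) := by
    rintro ⟨b, e⟩ ⟨b', e'⟩ hne
    rw [Function.onFun, Set.disjoint_left]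
    rintro ⟨t, q⟩ ⟨⟨_, h1⟩, h2⟩ ⟨⟨_, h3⟩, h4⟩
    simp only at h1 h2 h3 h4
    have hbb : b = b' := Fin.ext (h1.symm.trans h3)
    subst hbb
    cases e <;> cases e' <;> simp_all
  have hae : {ω | SlotEvent n m a W (fun i => τ i ω) (fun i => p i ω)} =ᵐ[P]
      (⋂ y ∈ (Finset.univ : Finset (Fin L × Bool)), (fun ω => N ω (S y)) ⁻¹' {(c y : ℝ≥0∞)} :
        Set Ω) := by
    filter_upwards [ae_time_nonneg hN hatoms, hatoms, hrank] with ω h0 h1 h2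
    refine propext ?_
    change SlotEvent n m a W (fun i => τ i ω) (fun i => p i ω) ↔
      ω ∈ ⋂ y ∈ (Finset.univ : Finset (Fin L × Bool)), (fun ω => N ω (S y)) ⁻¹' {(c y : ℝ≥0∞)}
    rw [slotEvent_iff_count ha hW h2 h0]
    simp only [Finset.mem_univ, Set.iInter_true, Set.mem_iInter, Set.mem_preimage,
      Set.mem_singleton_iff, h1]
    constructor
    · rintro h ⟨b, e⟩
      have := h b b.2
      cases e
      · simpa [S, c, count] using this.2
      · simpa [S, c, count] using this.1
    · intro h b hb
      have e1 := h (⟨b, hb⟩, true)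
      have e2 := h (⟨b, hb⟩, false)
      constructor
      · simpa [S, c, count] using e1
      · simpa [S, c, count] using e2
  rw [measure_congr hae, (hN.iIndepFun_count S hS hd).measure_inter_preimage_eq_mul _
    fun y _ => measurableSet_singleton _, Fintype.prod_prod_type, slotProb,
    ← Finset.prod_mul_distrib, Finset.prod_range]
  refine Finset.prod_congr rfl fun b _ => ?_
  rw [Fintype.prod_bool]
  have e1 : P ((fun ω => N ω (S (b, true))) ⁻¹' {(c (b, true) : ℝ≥0∞)}) = _ :=
    measure_slot_count hN n b (c (b, true)) (hV (b, true))
  have e2 : P ((fun ω => N ω (S (b, false))) ⁻¹' {(c (b, false) : ℝ≥0∞)}) = _ :=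
    measure_slot_count hN n b (c (b, false)) (hV (b, false))
  rw [e1, e2]
  have hcompl : unif.real (W b)ᶜ = 1 - unif.real (W b) := probReal_compl_eq_one_sub (hW b)
  simp only [c, if_true, hcompl, true_and, Bool.false_eq_true, if_false, false_and, pow_zero,
    Nat.factorial_zero]
  by_cases hb : (b : ℕ) ∈ Set.range a
  · simp only [if_pos hb]
    rw [← ENNReal.ofReal_mul (by positivity), ← ENNReal.ofReal_toReal (measure_ne_top unif (W b)),
      ← ENNReal.ofReal_mul (by positivity)]
    congr 1
    have : Real.exp (-(1 / ((n : ℝ) + 1))) = Real.exp (-(1 / (n + 1) * unif.real (W b))) *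
        Real.exp (-(1 / (n + 1) * (1 - unif.real (W b)))) := by
      rw [← Real.exp_add]; ring_nf
    rw [this, ← Measure.real]
    simp
    ring
  · simp only [if_neg hb]
    rw [hWu b hb]
    simp

/-- The slots of the first atoms are increasing, up to the atom `m + 1`. -/
def SlotsSeparated (n m : ℕ) (t : ℕ → ℝ) : Prop :=
  ∀ i ≤ m, ⌊t i * (n + 1)⌋₊ < ⌊t (i + 1) * (n + 1)⌋₊

lemma measurable_slotIndex (hτ : ∀ i, Measurable (τ i)) (n i : ℕ) :
    Measurable fun ω => ⌊τ i ω * (n + 1)⌋₊ :=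
  Nat.measurable_floor.comp ((hτ i).mul_const _)

lemma measurableSet_slotsSeparated (hτ : ∀ i, Measurable (τ i)) (n m : ℕ) :
    MeasurableSet {ω | SlotsSeparated n m fun i => τ i ω} := by
  have : {ω | SlotsSeparated n m fun i => τ i ω} =
      ⋂ i, ⋂ (_ : i ≤ m), {ω | ⌊τ i ω * (n + 1)⌋₊ < ⌊τ (i + 1) ω * (n + 1)⌋₊} := by
    ext ω; simp [SlotsSeparated]
  rw [this]
  exact MeasurableSet.iInter fun i => MeasurableSet.iInter fun _ =>
    measurableSet_lt (measurable_slotIndex hτ n i) (measurable_slotIndex hτ n (i + 1))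

/-- The factor `slotProb` does not involve the sets `B`, so it is identified by taking all of them
equal to the whole plane. If `a` is not increasing, both events are empty. -/
lemma measure_slots_mul (hN : IsPoissonPointProcess N intensity P)
    (hatoms : ∀ᵐ ω ∂P, N ω = Measure.sum (fun i => Measure.dirac (τ i ω, p i ω)))
    (hrank : ∀ᵐ ω ∂P, StrictMono (fun i => τ i ω)) (n m : ℕ) (a : Fin (m + 1) → ℕ)
    {B : Fin (m + 1) → Set (ℝ × ℝ)} (hB : ∀ i, MeasurableSet (B i)) :
    P {ω | (∀ i : Fin (m + 1), ⌊τ i ω * (n + 1)⌋₊ = a i ∧ p i ω ∈ B i) ∧ SlotsSeparated n m fun i => τ i ω} =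
      (∏ i, unif (B i)) * P {ω | (∀ i : Fin (m + 1), ⌊τ i ω * (n + 1)⌋₊ = a i) ∧
        SlotsSeparated n m fun i => τ i ω} := by
  classical
  by_cases ha : StrictMono a
  · have key : ∀ B : Fin (m + 1) → Set (ℝ × ℝ), (∀ i, MeasurableSet (B i)) →
        P {ω | (∀ i : Fin (m + 1), ⌊τ i ω * (n + 1)⌋₊ = a i ∧ p i ω ∈ B i) ∧
          SlotsSeparated n m fun i => τ i ω} = (∏ i, unif (B i)) * slotProb n m a := by
      intro B hB
      -- A slot that is not prescribed must be empty. The whole plane expresses this and contributes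
      -- a factor 1.
      let W : ℕ → Set (ℝ × ℝ) := Function.extend a B fun _ => Set.univ
      have hWa : ∀ i, W (a i) = B i := fun i => ha.injective.extend_apply _ _ i
      have hWu : ∀ b ∉ Set.range a, W b = Set.univ := fun b hb =>
        Function.extend_apply' _ _ _ hb
      have hW : ∀ b, MeasurableSet (W b) := by
        intro b
        by_cases hb : b ∈ Set.range a
        · obtain ⟨i, rfl⟩ := hb
          rw [hWa]; exact hB i
        · rw [hWu b hb]; exact MeasurableSet.univ
      have hprod : ∏ b ∈ Finset.range (a (Fin.last m) + 1), unif (W b) = ∏ i, unif (B i) := by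
        rw [← Finset.prod_subset (s₁ := Finset.univ.image a),
          Finset.prod_image fun i _ j _ h => ha.injective h]
        · exact Finset.prod_congr rfl fun i _ => by rw [hWa]
        · intro b hb
          obtain ⟨i, _, rfl⟩ := Finset.mem_image.1 hb
          exact Finset.mem_range.2 (Nat.lt_succ_of_le (ha.monotone (Fin.le_last i)))
        · intro b _ hb
          rw [hWu b, measure_univ]
          rintro ⟨i, rfl⟩
          exact hb (Finset.mem_image_of_mem _ (Finset.mem_univ _))
      rw [← hprod, ← measure_slotEvent hN hatoms hrank n m ha hW hWu]
      congr 1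
      ext ω
      simp only [Set.mem_ofPred_eq, SlotEvent, hWa]
      refine and_congr_right fun h1 => ?_
      constructor
      · intro h2
        have := h2 m le_rfl
        rwa [← (h1 (Fin.last m)).1]
      · intro h2 i hi
        rcases hi.lt_or_eq with hi | rfl
        · have e1 := (h1 ⟨i, by omega⟩).1
          have e2 := (h1 ⟨i + 1, by omega⟩).1
          simp only at e1 e2
          rw [e1, e2]
          exact ha (by simp)
        · rwa [← (h1 (Fin.last i)).1] at h2
    have h2 := key (fun _ => Set.univ) fun _ => MeasurableSet.univ
    rw [key B hB]
    simp only [measure_univ, Finset.prod_const_one, one_mul, Set.mem_univ, and_true] at h2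
    rw [h2]
  · have hempty : ∀ ω, (∀ i : Fin (m + 1), ⌊τ i ω * (n + 1)⌋₊ = a i) →
        ¬ SlotsSeparated n m fun i => τ i ω := by
      intro ω h1 h2
      apply ha
      rw [Fin.strictMono_iff_lt_succ]
      intro i
      rw [← h1, ← h1]
      exact h2 i (i.2.le)
    have e1 : {ω | (∀ i : Fin (m + 1), ⌊τ i ω * (n + 1)⌋₊ = a i ∧ p i ω ∈ B i) ∧
        SlotsSeparated n m fun i => τ i ω} = ∅ := by
      ext ω
      simp only [Set.mem_ofPred_eq, Set.mem_empty_iff_false, iff_false]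
      exact fun h => hempty ω (fun i => (h.1 i).1) h.2
    have e2 : {ω | (∀ i : Fin (m + 1), ⌊τ i ω * (n + 1)⌋₊ = a i) ∧
        SlotsSeparated n m fun i => τ i ω} = ∅ := by
      ext ω
      simp only [Set.mem_ofPred_eq, Set.mem_empty_iff_false, iff_false]
      exact fun h => hempty ω h.1 h.2
    rw [e1, e2]; simp

/-- A set of times whose indicator is well approximated by time slots. -/
def SlotApprox (C : Set ℝ) : Prop :=
  MeasurableSet C ∧ ∀ t : ℝ, 0 ≤ t → ∀ᶠ n : ℕ in atTop, ((⌊t * (n + 1)⌋₊ : ℝ) / (n + 1) ∈ C ↔ t ∈ C)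

lemma slotApprox_univ : SlotApprox Set.univ :=
  ⟨MeasurableSet.univ, fun _ _ => by simp⟩

/-- Replacing `t` by the left end of its slot always preserves `t ≤ c`, and preserves `c < t` once
the mesh is finer than `t - c`. These half-lines suffice to generate the events about times. -/
lemma slotApprox_Iic (c : ℝ) : SlotApprox (Set.Iic c) := by
  refine ⟨measurableSet_Iic, fun t ht => ?_⟩
  by_cases hc : t ≤ c
  · refine Eventually.of_forall fun n => ?_
    have hn : (0 : ℝ) < n + 1 := by positivity
    simp only [Set.mem_Iic, hc, iff_true]
    rw [div_le_iff₀ hn]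
    exact (Nat.floor_le (by positivity)).trans (mul_le_mul_of_nonneg_right hc hn.le)
  · push Not at hc
    have h1 : Tendsto (fun n : ℕ => (1 : ℝ) / (n + 1)) atTop (𝓝 0) :=
      tendsto_one_div_add_atTop_nhds_zero_nat
    filter_upwards [h1.eventually (gt_mem_nhds (sub_pos.2 hc))] with n hn
    have hn1 : (0 : ℝ) < n + 1 := by positivity
    simp only [Set.mem_Iic, not_le.2 hc, iff_false, not_le]
    rw [lt_div_iff₀ hn1]
    rw [div_lt_iff₀ hn1] at hn
    have := Nat.lt_floor_add_one (t * ((n : ℝ) + 1))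
    nlinarith

lemma eventually_floor_lt_floor {s t : ℝ} (hst : s < t) (hs : 0 ≤ s) :
    ∀ᶠ n : ℕ in atTop, ⌊s * (n + 1)⌋₊ < ⌊t * (n + 1)⌋₊ := by
  have h1 : Tendsto (fun n : ℕ => (1 : ℝ) / (n + 1)) atTop (𝓝 0) :=
    tendsto_one_div_add_atTop_nhds_zero_nat
  filter_upwards [h1.eventually (gt_mem_nhds (sub_pos.2 hst))] with n hn
  have hn1 : (0 : ℝ) < n + 1 := by positivity
  rw [div_lt_iff₀ hn1] at hn
  rw [Nat.floor_lt (by positivity)]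
  have := Nat.lt_floor_add_one (t * ((n : ℝ) + 1))
  nlinarith

/-- The positions of the atoms are uniform, independent, and independent of the times. -/
lemma measure_times_positions (hN : IsPoissonPointProcess N intensity P)
    (hτ : ∀ i, Measurable (τ i)) (hp : ∀ i, Measurable (p i))
    (hatoms : ∀ᵐ ω ∂P, N ω = Measure.sum (fun i => Measure.dirac (τ i ω, p i ω)))
    (hrank : ∀ᵐ ω ∂P, StrictMono (fun i => τ i ω)) (m : ℕ)
    {C : Fin (m + 1) → Set ℝ} (hC : ∀ i, SlotApprox (C i))
    {B : Fin (m + 1) → Set (ℝ × ℝ)} (hB : ∀ i, MeasurableSet (B i)) :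
    P {ω | ∀ i : Fin (m + 1), τ i ω ∈ C i ∧ p i ω ∈ B i} =
      (∏ i, unif (B i)) * P {ω | ∀ i : Fin (m + 1), τ i ω ∈ C i} := by
  have hconst : (∏ i, unif (B i)) ≠ ⊤ := ENNReal.prod_ne_top fun i _ => measure_ne_top _ _
  have hidx : ∀ (n : ℕ) (i : Fin (m + 1)),
      MeasurableSet {ω | (⌊τ i ω * (n + 1)⌋₊ : ℝ) / (n + 1) ∈ C i} := fun n i =>
    ((measurable_from_nat.comp (measurable_slotIndex hτ n i)).div_const _) (hC i).1
  have hmB : ∀ n : ℕ, MeasurableSet {ω | (∀ i : Fin (m + 1),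
      (⌊τ i ω * (n + 1)⌋₊ : ℝ) / (n + 1) ∈ C i ∧ p i ω ∈ B i) ∧
        SlotsSeparated n m fun i => τ i ω} := fun n =>
    (measurableSet_ofPred_forall fun i => (hidx n i).inter (hp i (hB i))).inter
      (measurableSet_slotsSeparated hτ n m)
  have hm : ∀ n : ℕ, MeasurableSet {ω | (∀ i : Fin (m + 1),
      (⌊τ i ω * (n + 1)⌋₊ : ℝ) / (n + 1) ∈ C i) ∧ SlotsSeparated n m fun i => τ i ω} := fun n =>
    (measurableSet_ofPred_forall fun i => hidx n i).inter (measurableSet_slotsSeparated hτ n m)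
  -- At a fixed mesh, both events are decomposed according to the countably many possible vectors of
  -- slot indices.
  have hmesh : ∀ n : ℕ,
      P {ω | (∀ i : Fin (m + 1), (⌊τ i ω * (n + 1)⌋₊ : ℝ) / (n + 1) ∈ C i ∧ p i ω ∈ B i) ∧
        SlotsSeparated n m fun i => τ i ω} = (∏ i, unif (B i)) *
      P {ω | (∀ i : Fin (m + 1), (⌊τ i ω * (n + 1)⌋₊ : ℝ) / (n + 1) ∈ C i) ∧
        SlotsSeparated n m fun i => τ i ω} := by
    intro n
    let A : Ω → Fin (m + 1) → ℕ := fun ω i => ⌊τ i ω * (n + 1)⌋₊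
    have hA : Measurable A := measurable_pi_lambda _ fun i => measurable_slotIndex hτ n i
    have hdecomp : ∀ H : Set Ω, MeasurableSet H → P H = ∑' a : Fin (m + 1) → ℕ, P (H ∩ A ⁻¹' {a}) := by
      intro H hH
      rw [← measure_iUnion]
      · rw [← Set.inter_iUnion]; congr 1
        ext ω; simp
      · intro a b hab
        rw [Function.onFun, Set.disjoint_left]
        rintro ω ⟨_, h1⟩ ⟨_, h2⟩
        exact hab (h1.symm.trans h2)
      · exact fun a => hH.inter (hA (measurableSet_singleton a))
    rw [hdecomp _ (hmB n), hdecomp _ (hm n), ← ENNReal.tsum_mul_left]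
    refine tsum_congr fun a => ?_
    by_cases ha : ∀ i, (a i : ℝ) / (n + 1) ∈ C i
    · have := measure_slots_mul hN hatoms hrank n m a hB
      convert this using 2
      · ext ω
        simp only [Set.mem_inter_iff, Set.mem_ofPred_eq, Set.mem_preimage, Set.mem_singleton_iff,
          A, funext_iff]
        constructor
        · rintro ⟨⟨h1, h2⟩, h3⟩
          exact ⟨fun i => ⟨h3 i, (h1 i).2⟩, h2⟩
        · rintro ⟨h1, h2⟩
          exact ⟨⟨fun i => ⟨by rw [(h1 i).1]; exact ha i, (h1 i).2⟩, h2⟩, fun i => (h1 i).1⟩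
      · congr 1
        ext ω
        simp only [Set.mem_inter_iff, Set.mem_ofPred_eq, Set.mem_preimage, Set.mem_singleton_iff,
          A, funext_iff]
        constructor
        · rintro ⟨⟨h1, h2⟩, h3⟩
          exact ⟨h3, h2⟩
        · rintro ⟨h1, h2⟩
          exact ⟨⟨fun i => by rw [h1 i]; exact ha i, h2⟩, h1⟩
    · have e1 : ∀ H : Set Ω, (∀ ω ∈ H, ∀ i, (⌊τ i ω * (n + 1)⌋₊ : ℝ) / (n + 1) ∈ C i) →
          P (H ∩ A ⁻¹' {a}) = 0 := by
        intro H hH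
        have : H ∩ A ⁻¹' {a} = ∅ := by
          ext ω
          simp only [Set.mem_inter_iff, Set.mem_preimage, Set.mem_singleton_iff,
            Set.mem_empty_iff_false, iff_false]
          rintro ⟨h1, rfl⟩
          exact ha fun i => hH ω h1 i
        rw [this, measure_empty]
      rw [e1 _ fun ω h i => (h.1 i).1, e1 _ fun ω h i => h.1 i, mul_zero]
  -- As the mesh shrinks, the atoms concerned end up in different slots and the conditions on slots
  -- become the conditions on times.
  have hlim : ∀ᵐ ω ∂P, ∀ᶠ n : ℕ in atTop, (SlotsSeparated n m fun i => τ i ω) ∧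
      ∀ i : Fin (m + 1), ((⌊τ i ω * (n + 1)⌋₊ : ℝ) / (n + 1) ∈ C i ↔ τ i ω ∈ C i) := by
    filter_upwards [ae_time_nonneg hN hatoms, hrank] with ω h0 h1
    refine Eventually.and ?_ (eventually_all.2 fun i => (hC i).2 _ (h0 i))
    have := (Finset.range (m + 1)).eventually_all (l := atTop)
      (p := fun i n => ⌊τ i ω * ((n : ℕ) + 1)⌋₊ < ⌊τ (i + 1) ω * (n + 1)⌋₊)
    filter_upwards [this.2 fun i _ => eventually_floor_lt_floor (h1 i.lt_succ_self) (h0 i)]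
      with n hn i hi
    exact hn i (Finset.mem_range.2 (Nat.lt_succ_of_le hi))
  have t1 := tendsto_measure_of_ae_tendsto_indicator_of_isFiniteMeasure atTop (μ := P)
    (A := {ω | ∀ i : Fin (m + 1), τ i ω ∈ C i ∧ p i ω ∈ B i})
    (measurableSet_ofPred_forall fun i => (hτ i (hC i).1).inter (hp i (hB i))) hmB (by
      filter_upwards [hlim] with ω h
      filter_upwards [h] with n hn
      simp only [hn.1, hn.2, and_true])
  have t2 := tendsto_measure_of_ae_tendsto_indicator_of_isFiniteMeasure atTop (μ := P)
    (A := {ω | ∀ i : Fin (m + 1), τ i ω ∈ C i})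
    (measurableSet_ofPred_forall fun i => hτ i (hC i).1) hm (by
      filter_upwards [hlim] with ω h
      filter_upwards [h] with n hn
      simp only [hn.1, hn.2, and_true])
  simp only [hmesh] at t1
  exact tendsto_nhds_unique t1 (ENNReal.Tendsto.const_mul t2 (Or.inr hconst))

end Atoms
end Quadtree

namespace Quadtree

/-! ### Independence of the next position from the past -/

/-- The first `k` terms of a sequence of points. -/
noncomputable def pre (k : ℕ) (p : ℕ → ℝ × ℝ) : ℕ → ℝ × ℝ := fun i => if i < k then p i else 0

lemma pre_apply {k i : ℕ} (hi : i < k) (p : ℕ → ℝ × ℝ) : pre k p i = p i := if_pos hi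

lemma measurable_pre (k : ℕ) : Measurable (pre k) := by
  refine measurable_pi_lambda _ fun i => ?_
  by_cases hi : i < k
  · simpa only [pre, hi, if_true] using measurable_pi_apply i
  · simpa only [pre, hi, if_false] using measurable_const

lemma pre_pre {k l : ℕ} (hkl : k ≤ l) (p : ℕ → ℝ × ℝ) : pre k (pre l p) = pre k p := by
  funext i
  by_cases hi : i < k
  · simp [pre, hi, hi.trans_le hkl]
  · simp [pre, hi]

/-- All times, and the first `k` positions. -/
noncomputable def past {Ω : Type*} (τ : ℕ → Ω → ℝ) (p : ℕ → Ω → ℝ × ℝ) (k : ℕ) (ω : Ω) :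
    (ℕ → ℝ) × (ℕ → ℝ × ℝ) :=
  (fun i => τ i ω, pre k fun i => p i ω)

/-- Elementary events for the `i`-th atom in the past of the `k`-th position. -/
def pastEvents {Ω : Type*} (τ : ℕ → Ω → ℝ) (p : ℕ → Ω → ℝ × ℝ) (k i : ℕ) : Set (Set Ω) :=
  {s | ∃ C B, (C ∈ Set.range Set.Iic ∨ C = Set.univ) ∧ MeasurableSet B ∧
    (k ≤ i → B = Set.univ) ∧ s = τ i ⁻¹' C ∩ p i ⁻¹' B}

lemma isPiSystem_pastEvents {Ω : Type*} (τ : ℕ → Ω → ℝ) (p : ℕ → Ω → ℝ × ℝ) (k i : ℕ) :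
    IsPiSystem (pastEvents τ p k i) := by
  rintro s ⟨C, B, hC, hB, hk, rfl⟩ s' ⟨C', B', hC', hB', hk', rfl⟩ _
  refine ⟨C ∩ C', B ∩ B', ?_, hB.inter hB', fun h => by rw [hk h, hk' h, Set.univ_inter], ?_⟩
  · rcases hC with ⟨c, rfl⟩ | rfl
    · rcases hC' with ⟨c', rfl⟩ | rfl
      · exact Or.inl ⟨min c c', by rw [Set.Iic_inter_Iic]⟩
      · exact Or.inl ⟨c, by simp⟩
    · rcases hC' with ⟨c', rfl⟩ | rfl
      · exact Or.inl ⟨c', by simp⟩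
      · exact Or.inr (by simp)
  · rw [Set.preimage_inter, Set.preimage_inter, Set.inter_inter_inter_comm]

lemma comap_past_le {Ω : Type*} (τ : ℕ → Ω → ℝ) (p : ℕ → Ω → ℝ × ℝ) (k : ℕ) :
    MeasurableSpace.comap (past τ p k) inferInstance ≤
      MeasurableSpace.generateFrom (piiUnionInter (pastEvents τ p k) Set.univ) := by
  let m : MeasurableSpace Ω :=
    MeasurableSpace.generateFrom (piiUnionInter (pastEvents τ p k) Set.univ)
  have hmem : ∀ i, ∀ s ∈ pastEvents τ p k i, MeasurableSet s := fun i s hs =>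
    MeasurableSpace.measurableSet_generateFrom (subset_piiUnionInter (Set.mem_univ i) hs)
  suffices h : Measurable (past τ p k) from h.comap_le
  refine Measurable.prodMk (measurable_pi_lambda _ fun i => measurable_of_Iic fun c => ?_)
    (measurable_pi_lambda _ fun i => ?_)
  · exact hmem i _ ⟨Set.Iic c, Set.univ, Or.inl ⟨c, rfl⟩, MeasurableSet.univ, fun _ => rfl,
      by simp⟩
  · by_cases hi : i < k
    · simp only [pre, hi, if_true]
      intro B hB
      exact hmem i _ ⟨Set.univ, B, Or.inr rfl, hB, fun h => absurd hi (not_lt.2 h), by simp⟩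
    · simp only [pre, hi, if_false]
      exact measurable_const

section Independence

variable {Ω : Type*} [mΩ : MeasurableSpace Ω] {P : Measure Ω} [IsProbabilityMeasure P]
  {N : Ω → Measure (ℝ × ℝ × ℝ)} {τ : ℕ → Ω → ℝ} {p : ℕ → Ω → ℝ × ℝ}

lemma measure_forall_le (hN : IsPoissonPointProcess N intensity P)
    (hτ : ∀ i, Measurable (τ i)) (hp : ∀ i, Measurable (p i))
    (hatoms : ∀ᵐ ω ∂P, N ω = Measure.sum (fun i => Measure.dirac (τ i ω, p i ω)))
    (hrank : ∀ᵐ ω ∂P, StrictMono (fun i => τ i ω)) (m : ℕ)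
    {C : ℕ → Set ℝ} (hC : ∀ i, SlotApprox (C i))
    {B : ℕ → Set (ℝ × ℝ)} (hB : ∀ i, MeasurableSet (B i)) :
    P {ω | ∀ i < m + 1, τ i ω ∈ C i ∧ p i ω ∈ B i} =
      (∏ i ∈ Finset.range (m + 1), unif (B i)) * P {ω | ∀ i < m + 1, τ i ω ∈ C i} := by
  have := measure_times_positions hN hτ hp hatoms hrank m (C := fun i => C i) (fun i => hC i)
    (B := fun i => B i) (fun i => hB i)
  simp only [Fin.forall_iff] at this
  rw [this, Finset.prod_range]

lemma measure_position (hN : IsPoissonPointProcess N intensity P)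
    (hτ : ∀ i, Measurable (τ i)) (hp : ∀ i, Measurable (p i))
    (hatoms : ∀ᵐ ω ∂P, N ω = Measure.sum (fun i => Measure.dirac (τ i ω, p i ω)))
    (hrank : ∀ᵐ ω ∂P, StrictMono (fun i => τ i ω)) (k : ℕ) {V : Set (ℝ × ℝ)}
    (hV : MeasurableSet V) : P (p k ⁻¹' V) = unif V := by
  classical
  have h1 := measure_forall_le hN hτ hp hatoms hrank k (C := fun _ => Set.univ)
    (fun _ => slotApprox_univ) (B := Function.update (fun _ => Set.univ) k V) (by
      intro i
      by_cases hi : i = k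
      · subst hi; simpa using hV
      · simp [Function.update_of_ne hi])
  rw [Finset.prod_eq_single k] at h1
  · simp only [Function.update_self, Set.mem_univ, implies_true, true_and] at h1
    have h2 : {ω | ∀ i < k + 1, p i ω ∈ Function.update (fun _ => Set.univ) k V i} =
        p k ⁻¹' V := by
      ext ω
      simp only [Set.mem_ofPred_eq, Set.mem_preimage]
      constructor
      · intro h; simpa using h k k.lt_succ_self
      · intro h i _
        by_cases hi : i = k
        · subst hi; simpa using h
        · simp [Function.update_of_ne hi]
    rw [h2] at h1
    rw [h1]
    have : {ω : Ω | True} = Set.univ := by ext; simp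
    rw [this, measure_univ, mul_one]
  · intro i _ hi
    simp [Function.update_of_ne hi]
  · intro h; simp at h

lemma map_position (hN : IsPoissonPointProcess N intensity P)
    (hτ : ∀ i, Measurable (τ i)) (hp : ∀ i, Measurable (p i))
    (hatoms : ∀ᵐ ω ∂P, N ω = Measure.sum (fun i => Measure.dirac (τ i ω, p i ω)))
    (hrank : ∀ᵐ ω ∂P, StrictMono (fun i => τ i ω)) (k : ℕ) : P.map (p k) = unif := by
  ext V hV
  rw [Measure.map_apply (hp k) hV, measure_position hN hτ hp hatoms hrank k hV]

/-- By a π-system argument it suffices to consider finitely many elementary conditions on the past,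
none of which restricts the position of index `k`. Requiring that position to lie in `V` replaces a
factor 1 of the product formula by `unif V` and leaves the event about the times as it was. -/
lemma indepFun_past_position (hN : IsPoissonPointProcess N intensity P)
    (hτ : ∀ i, Measurable (τ i)) (hp : ∀ i, Measurable (p i))
    (hatoms : ∀ᵐ ω ∂P, N ω = Measure.sum (fun i => Measure.dirac (τ i ω, p i ω)))
    (hrank : ∀ᵐ ω ∂P, StrictMono (fun i => τ i ω)) (k : ℕ) :
    IndepFun (past τ p k) (p k) P := by
  classical
  rw [IndepFun_iff_Indep]
  refine indep_of_indep_of_le_left ?_ (comap_past_le τ p k)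
  have hCm : ∀ C : Set ℝ, (C ∈ Set.range Set.Iic ∨ C = Set.univ) → SlotApprox C := by
    rintro C (⟨c, rfl⟩ | rfl)
    · exact slotApprox_Iic c
    · exact slotApprox_univ
  have hgen : ∀ i, MeasurableSpace.generateFrom (pastEvents τ p k i) ≤ mΩ := by
    intro i
    refine MeasurableSpace.generateFrom_le ?_
    rintro s ⟨C, B, hC, hB, _, rfl⟩
    exact (hτ i (hCm C hC).1).inter (hp i hB)
  refine IndepSets.indep (p1 := piiUnionInter (pastEvents τ p k) Set.univ)
    (p2 := {s | MeasurableSet[MeasurableSpace.comap (p k) inferInstance] s})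
    (generateFrom_piiUnionInter_le _ hgen _) (hp k).comap_le
    (isPiSystem_piiUnionInter _ (isPiSystem_pastEvents τ p k) _)
    (@MeasurableSpace.isPiSystem_measurableSet _ (_)) rfl
    (@MeasurableSpace.generateFrom_measurableSet _ (_)).symm ?_
  rw [IndepSets_iff]
  rintro _ _ ⟨t, _, f, hf, rfl⟩ ⟨V, hV, rfl⟩
  choose! C B hC hB hk hfe using hf
  let C' : ℕ → Set ℝ := fun i => if i ∈ t then C i else Set.univ
  let B' : ℕ → Set (ℝ × ℝ) := fun i => if i ∈ t then B i else Set.univ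
  have hC' : ∀ i, SlotApprox (C' i) := by
    intro i
    by_cases hi : i ∈ t
    · simpa only [C', hi, if_true] using hCm _ (hC i hi)
    · simpa only [C', hi, if_false] using slotApprox_univ
  have hB' : ∀ i, MeasurableSet (B' i) := by
    intro i
    by_cases hi : i ∈ t
    · simpa only [B', hi, if_true] using hB i hi
    · simpa only [B', hi, if_false] using MeasurableSet.univ
  have hBk : B' k = Set.univ := by
    by_cases hi : k ∈ t
    · simpa only [B', hi, if_true] using hk k hi le_rfl
    · simp only [B', hi, if_false]
  have hB'' : ∀ i, MeasurableSet (Function.update B' k V i) := by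
    intro i
    by_cases hi : i = k
    · subst hi; simpa using hV
    · rw [Function.update_of_ne hi]; exact hB' i
  -- The product formula concerns initial segments of atoms. This one contains `t` and `k`, and the
  -- remaining indices carry trivial conditions.
  set m := max (t.sup id) k with hm
  have htm : ∀ i ∈ t, i < m + 1 := fun i hi =>
    Nat.lt_succ_of_le ((Finset.le_sup (f := id) hi).trans (le_max_left _ _))
  have hkm : k < m + 1 := Nat.lt_succ_of_le (le_max_right _ _)
  have e1 : (⋂ i ∈ t, f i) = {ω | ∀ i < m + 1, τ i ω ∈ C' i ∧ p i ω ∈ B' i} := by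
    ext ω
    simp only [Set.mem_iInter, Set.mem_ofPred_eq]
    constructor
    · intro h i _
      by_cases hi : i ∈ t
      · have := h i hi
        rw [hfe i hi] at this
        simp only [C', B', hi, if_true]
        exact this
      · simp [C', B', hi]
    · intro h i hi
      have := h i (htm i hi)
      rw [hfe i hi]
      simp only [C', B', hi, if_true] at this
      exact this
  have e2 : {ω | ∀ i < m + 1, τ i ω ∈ C' i ∧ p i ω ∈ B' i} ∩ p k ⁻¹' V =
      {ω | ∀ i < m + 1, τ i ω ∈ C' i ∧ p i ω ∈ Function.update B' k V i} := by
    ext ω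
    simp only [Set.mem_inter_iff, Set.mem_ofPred_eq, Set.mem_preimage]
    constructor
    · rintro ⟨h1, h2⟩ i hi
      refine ⟨(h1 i hi).1, ?_⟩
      by_cases hik : i = k
      · subst hik; simpa using h2
      · rw [Function.update_of_ne hik]; exact (h1 i hi).2
    · intro h
      refine ⟨fun i hi => ⟨(h i hi).1, ?_⟩, by simpa using (h k hkm).2⟩
      by_cases hik : i = k
      · subst hik; rw [hBk]; trivial
      · have := (h i hi).2
        rwa [Function.update_of_ne hik] at this
  rw [e1, e2, measure_forall_le hN hτ hp hatoms hrank m hC' hB',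
    measure_forall_le hN hτ hp hatoms hrank m hC' hB'', measure_position hN hτ hp hatoms hrank k hV]
  have hprod : ∏ i ∈ Finset.range (m + 1), unif (Function.update B' k V i) =
      unif V * ∏ i ∈ Finset.range (m + 1), unif (B' i) := by
    have hk' : k ∈ Finset.range (m + 1) := Finset.mem_range.2 hkm
    rw [← Finset.mul_prod_erase _ _ hk', ← Finset.mul_prod_erase _ (fun i => unif (B' i)) hk',
      Function.update_self, hBk, measure_univ, one_mul]
    congr 1
    refine Finset.prod_congr rfl fun i hi => ?_
    rw [Function.update_of_ne (Finset.mem_erase.1 hi).1]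
  rw [hprod]
  ring

end Independence

end Quadtree

namespace Quadtree

/-! ### The discrete-time filtration and its martingales -/

lemma measurable_past {Ω : Type*} [MeasurableSpace Ω] {τ : ℕ → Ω → ℝ} {p : ℕ → Ω → ℝ × ℝ}
    (hτ : ∀ i, Measurable (τ i)) (hp : ∀ i, Measurable (p i)) (k : ℕ) :
    Measurable (past τ p k) :=
  (measurable_pi_lambda _ hτ).prodMk ((measurable_pre k).comp (measurable_pi_lambda _ hp))

/-- The filtration of all times and the first positions. -/
noncomputable def pastFiltration {Ω : Type*} [mΩ : MeasurableSpace Ω] {τ : ℕ → Ω → ℝ}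
    {p : ℕ → Ω → ℝ × ℝ} (hτ : ∀ i, Measurable (τ i)) (hp : ∀ i, Measurable (p i)) :
    Filtration ℕ mΩ where
  seq k := MeasurableSpace.comap (past τ p k) inferInstance
  mono' k l hkl := by
    have : past τ p k = (fun y => (y.1, pre k y.2)) ∘ past τ p l := by
      funext ω
      simp [past, pre_pre hkl]
    beta_reduce
    rw [this, ← MeasurableSpace.comap_comp]
    exact MeasurableSpace.comap_mono
      (measurable_fst.prodMk ((measurable_pre k).comp measurable_snd)).comap_le
  le' k := (measurable_past hτ hp k).comap_le

/-- The distributional input: the positions are uniform and independent of the past. -/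
structure IsUniformInput {Ω : Type*} [MeasurableSpace Ω] (P : Measure Ω) (τ : ℕ → Ω → ℝ)
    (p : ℕ → Ω → ℝ × ℝ) : Prop where
  measurable_time : ∀ i, Measurable (τ i)
  measurable_position : ∀ i, Measurable (p i)
  map_position : ∀ k, P.map (p k) = unif
  indepFun : ∀ k, IndepFun (past τ p k) (p k) P

section UniformInput

variable {Ω : Type*} [mΩ : MeasurableSpace Ω] {P : Measure Ω} [IsProbabilityMeasure P]
  {τ : ℕ → Ω → ℝ} {p : ℕ → Ω → ℝ × ℝ}

lemma measurable_update_snd (k : ℕ) :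
    Measurable fun y : ((ℕ → ℝ) × (ℕ → ℝ × ℝ)) × (ℝ × ℝ) => Function.update y.1.2 k y.2 := by
  refine measurable_pi_lambda _ fun i => ?_
  by_cases hi : i = k
  · subst hi
    simp only [Function.update_self]
    exact measurable_snd
  · simp only [Function.update_of_ne hi]
    exact (measurable_pi_apply i).comp (measurable_snd.comp measurable_fst)

/-- The next position may be integrated out, given the past. -/
lemma IsUniformInput.setIntegral_eq (hI : IsUniformInput P τ p) {k : ℕ}
    {Φ : (ℕ → ℝ × ℝ) → ℝ} (hΦ : Measurable Φ) {C : ℝ} (hC : ∀ z, |Φ z| ≤ C)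
    (hcongr : ∀ z z', (∀ i < k + 1, z i = z' i) → Φ z = Φ z') {A : Set Ω}
    (hA : MeasurableSet[MeasurableSpace.comap (past τ p k) inferInstance] A) :
    ∫ ω in A, Φ (fun i => p i ω) ∂P =
      ∫ ω in A, ∫ q, Φ (Function.update (fun i => p i ω) k q) ∂unif ∂P := by
  obtain ⟨S, hS, rfl⟩ := hA
  have hpast := measurable_past hI.measurable_time hI.measurable_position k
  have hpk := hI.measurable_position k
  let G : ((ℕ → ℝ) × (ℕ → ℝ × ℝ)) × (ℝ × ℝ) → ℝ := fun y => Φ (Function.update y.1.2 k y.2)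
  have hG : Measurable G := hΦ.comp (measurable_update_snd k)
  -- Independence makes the joint law a product, and Fubini's theorem then integrates out the next
  -- position.
  have hlaw : P.map (fun ω => (past τ p k ω, p k ω)) = (P.map (past τ p k)).prod unif := by
    rw [(hI.indepFun k).map_prod_eq_prod_map_map hpast.aemeasurable hpk.aemeasurable,
      hI.map_position k]
  have : IsProbabilityMeasure (P.map (past τ p k)) :=
    Measure.isProbabilityMeasure_map hpast.aemeasurable
  -- `past` erases the positions from index `k` on; `Φ` reads only those up to `k`, and the last of
  -- these is restored by the update.
  have h1 : ∀ ω, Φ (fun i => p i ω) = G (past τ p k ω, p k ω) := by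
    intro ω
    refine hcongr _ _ fun i hi => ?_
    by_cases hik : i = k
    · subst hik; simp
    · rw [Function.update_of_ne hik]
      exact (pre_apply (lt_of_le_of_ne (Nat.lt_succ_iff.1 hi) hik) fun i => p i ω).symm
  have h2 : ∀ ω q, Φ (Function.update (fun i => p i ω) k q) = G (past τ p k ω, q) := by
    intro ω q
    refine hcongr _ _ fun i hi => ?_
    by_cases hik : i = k
    · subst hik; simp
    · rw [Function.update_of_ne hik, Function.update_of_ne hik]
      exact (pre_apply (lt_of_le_of_ne (Nat.lt_succ_iff.1 hi) hik) fun i => p i ω).symm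
  simp only [h1, h2]
  have e1 : ∫ ω in past τ p k ⁻¹' S, G (past τ p k ω, p k ω) ∂P =
      ∫ y in S ×ˢ Set.univ, G y ∂(P.map (fun ω => (past τ p k ω, p k ω))) := by
    rw [setIntegral_map (hS.prod MeasurableSet.univ) hG.aestronglyMeasurable
      (hpast.prodMk hpk).aemeasurable]
    congr 2
    ext ω; simp
  have e2 : ∫ ω in past τ p k ⁻¹' S, (∫ q, G (past τ p k ω, q) ∂unif) ∂P =
      ∫ y in S, (∫ q, G (y, q) ∂unif) ∂(P.map (past τ p k)) := by
    rw [setIntegral_map hS _ hpast.aemeasurable]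
    exact (hG.stronglyMeasurable.integral_prod_right).aestronglyMeasurable
  rw [e1, e2, hlaw, ← Measure.prod_restrict, Measure.restrict_univ, integral_prod]
  exact integrable_of_abs_le hG fun y => hC _

lemma measurable_positions (hp : ∀ i, Measurable (p i)) :
    Measurable fun ω => fun i => p i ω := measurable_pi_lambda _ hp

/-- The total weight of exponent `β` of the capped quadtree is a martingale. -/
lemma IsUniformInput.martingale_capWeight (hI : IsUniformInput P τ p) (x : ℝ) (n : ℕ∞) :
    Martingale (fun k ω => capWeight x beta n k fun i => p i ω)
      (pastFiltration hI.measurable_time hI.measurable_position) P := by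
  refine martingale_of_setIntegral_eq_succ (fun k => ?_) (fun k => ?_) fun k A hA => ?_
  · have : (fun ω => capWeight x beta n k fun i => p i ω) =
        (fun y : (ℕ → ℝ) × (ℕ → ℝ × ℝ) => capWeight x beta n k y.2) ∘ past τ p k := by
      funext ω
      exact capWeight_congr _ _ _ fun i hi => (pre_apply hi fun i => p i ω).symm
    rw [this]
    exact (((measurable_capWeight x beta n k).comp measurable_snd).comp
      (comap_measurable (past τ p k))).stronglyMeasurable
  · exact integrable_of_abs_le ((measurable_capWeight x beta n k).comp
      (measurable_positions hI.measurable_position)) fun _ => abs_capWeight_le x beta_pos n k _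
  · rw [hI.setIntegral_eq (measurable_capWeight x beta n (k + 1))
      (abs_capWeight_le x beta_pos n (k + 1)) (fun z z' h => capWeight_congr _ _ _ h) hA]
    simp only [integral_capWeight_update]

/-- Functionals that decrease on average have decreasing integrals over events about times. -/
lemma IsUniformInput.setIntegral_le (hI : IsUniformInput P τ p)
    {Φ : ℕ → (ℕ → ℝ × ℝ) → ℝ} (hΦ : ∀ k, Measurable (Φ k)) {C : ℕ → ℝ} (hC : ∀ k z, |Φ k z| ≤ C k)
    (hcongr : ∀ k z z', (∀ i < k, z i = z' i) → Φ k z = Φ k z')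
    (hdrift : ∀ k z, ∫ q, Φ (k + 1) (Function.update z k q) ∂unif ≤ Φ k z) {A : Set Ω}
    (hA : MeasurableSet[MeasurableSpace.comap (past τ p 0) inferInstance] A) (k : ℕ) :
    ∫ ω in A, Φ k (fun i => p i ω) ∂P ≤ ∫ ω in A, Φ 0 (fun i => p i ω) ∂P := by
  induction k with
  | zero => exact le_rfl
  | succ k ih =>
    refine le_trans ?_ ih
    -- An event about the times belongs to every stage of the filtration, so one and the same `A`
    -- can be kept throughout the induction.
    rw [hI.setIntegral_eq (hΦ (k + 1)) (hC (k + 1)) (hcongr (k + 1))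
      ((pastFiltration hI.measurable_time hI.measurable_position).mono (Nat.zero_le k) A hA)]
    have hint : ∀ j, Integrable (fun ω => Φ j fun i => p i ω) P := fun j =>
      integrable_of_abs_le ((hΦ j).comp (measurable_positions hI.measurable_position))
        fun _ => hC j _
    refine setIntegral_mono ?_ (hint k).integrableOn fun ω => hdrift k _
    refine (integrable_of_abs_le (C := C (k + 1)) ?_ fun ω => ?_).integrableOn
    · have hm : Measurable fun y : Ω × (ℝ × ℝ) =>
          Φ (k + 1) (Function.update (fun i => p i y.1) k y.2) := by
        refine (hΦ (k + 1)).comp (measurable_pi_lambda _ fun i => ?_)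
        by_cases hi : i = k
        · subst hi
          simp only [Function.update_self]
          exact measurable_snd
        · simp only [Function.update_of_ne hi]
          exact (hI.measurable_position i).comp measurable_fst
      exact hm.stronglyMeasurable.integral_prod_right.measurable
    · refine (norm_integral_le_of_norm_le_const (C := C (k + 1)) (μ := unif)
        (f := fun q => Φ (k + 1) (Function.update (fun i => p i ω) k q))
        (ae_of_all _ fun q => hC (k + 1) _)).trans ?_
      simp

/-- The restriction to events about times is what later allows `k` to be replaced by the random
number of atoms up to a given time. -/
lemma IsUniformInput.setIntegral_exp_le (hI : IsUniformInput P τ p) (x : ℝ) (n : ℕ∞) (k : ℕ)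
    {A : Set Ω} (hA : MeasurableSet[MeasurableSpace.comap (past τ p 0) inferInstance] A) :
    ∫ ω in A, Real.exp (expRate * capWeight x beta n k fun i => p i ω) ∂P ≤
      Real.exp 2 * P.real A := by
  have hpos := measurable_positions hI.measurable_position
  have hm : ∀ k, Measurable (expWeight x n k) := fun k =>
    measurable_expWeight_comp x n k measurable_pi_apply
  have hint : ∀ j, Integrable (fun ω => expWeight x n j fun i => p i ω) P := fun j =>
    integrable_of_abs_le ((hm j).comp hpos) fun _ => abs_expWeight_le x n j _
  calc _ ≤ ∫ ω in A, expWeight x n k (fun i => p i ω) ∂P := by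
        refine setIntegral_mono ?_ (hint k).integrableOn
          fun ω => exp_capWeight_le_expWeight x n k _
        refine ((hint k).mono' ?_ (ae_of_all _ fun ω => ?_)).integrableOn
        · exact (Real.measurable_exp.comp (((measurable_capWeight x beta n k).comp
            hpos).const_mul _)).aestronglyMeasurable
        · rw [Real.norm_of_nonneg (Real.exp_pos _).le]
          exact exp_capWeight_le_expWeight x n k _
    _ ≤ ∫ ω in A, expWeight x n 0 (fun i => p i ω) ∂P :=
        hI.setIntegral_le hm (abs_expWeight_le x n) (fun k z z' h => expWeight_congr x n h)
          (integral_expWeight_update_le x n) hA k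
    _ ≤ ∫ ω in A, Real.exp 2 ∂P :=
        setIntegral_mono (hint 0).integrableOn (integrable_const _).integrableOn
          fun ω => expWeight_zero_le x n _
    _ = Real.exp 2 * P.real A := by rw [setIntegral_const, smul_eq_mul, mul_comm]

/-- The exponential moments of the total weights are bounded, on every event about times. -/
lemma IsUniformInput.setLIntegral_exp_le (hI : IsUniformInput P τ p) (x : ℝ) (n : ℕ∞) (k : ℕ)
    {A : Set Ω} (hA : MeasurableSet[MeasurableSpace.comap (past τ p 0) inferInstance] A) :
    ∫⁻ ω in A, ENNReal.ofReal (Real.exp (expRate * capWeight x beta n k fun i => p i ω)) ∂P ≤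
      ENNReal.ofReal (Real.exp 2) * P A := by
  have hpos := measurable_positions hI.measurable_position
  rw [← ofReal_integral_eq_lintegral_ofReal]
  · refine (ENNReal.ofReal_le_ofReal (hI.setIntegral_exp_le x n k hA)).trans (le_of_eq ?_)
    rw [ENNReal.ofReal_mul (Real.exp_pos _).le, ofReal_measureReal]
  · refine (integrable_of_abs_le (C := Real.exp (expRate * 2 ^ k)) ?_ fun ω => ?_).integrableOn
    · exact Real.measurable_exp.comp (((measurable_capWeight x beta n k).comp hpos).const_mul _)
    · rw [abs_of_pos (Real.exp_pos _), Real.exp_le_exp]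
      exact mul_le_mul_of_nonneg_left (capWeight_le x beta_pos n k _) expRate_pos.le
  · exact ae_of_all _ fun ω => (Real.exp_pos _).le

/-- The effect in quadratic mean of the cap at generation `n` decays geometrically. -/
lemma IsUniformInput.lintegral_sq_sub_le (hI : IsUniformInput P τ p) (x : ℝ) (n k : ℕ) :
    ∫⁻ ω, ENNReal.ofReal ((capWeight x beta ⊤ k (fun i => p i ω) -
        capWeight x beta n k fun i => p i ω) ^ 2) ∂P ≤
      ENNReal.ofReal ((1 - splitRate (2 * beta))⁻¹ * splitRate (2 * beta) ^ n) := by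
  have hpos := measurable_positions hI.measurable_position
  have hm : ∀ k, Measurable (capVariance x n k) := fun k =>
    measurable_capVariance_comp x n k measurable_pi_apply
  have hint : ∀ j, Integrable (fun ω => capVariance x n j fun i => p i ω) P := fun j =>
    integrable_of_abs_le ((hm j).comp hpos) fun _ => abs_capVariance_le x n j _
  calc _ ≤ ∫⁻ ω, ENNReal.ofReal (capVariance x n k fun i => p i ω) ∂P :=
        lintegral_mono fun ω => ENNReal.ofReal_le_ofReal (sq_sub_le_capVariance x n k _)
    _ = ENNReal.ofReal (∫ ω, capVariance x n k (fun i => p i ω) ∂P) :=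
        (ofReal_integral_eq_lintegral_ofReal (hint k)
          (ae_of_all _ fun ω => capVariance_nonneg x n k _)).symm
    _ ≤ _ := by
        refine ENNReal.ofReal_le_ofReal ?_
        have h1 := hI.setIntegral_le hm (abs_capVariance_le x n)
          (fun k z z' h => capVariance_congr x n h) (integral_capVariance_update_le x n)
          (A := Set.univ) MeasurableSet.univ k
        rw [setIntegral_univ, setIntegral_univ] at h1
        refine h1.trans ((integral_mono (hint 0) (integrable_const _)
          fun ω => capVariance_zero_le x n _).trans (le_of_eq ?_))
        simp

end UniformInput

end Quadtree

/-! ### Convergence in `L^q` from exponential moments -/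

section ExpMoments

variable {Ω : Type*} [MeasurableSpace Ω] {P : Measure Ω}

/-- A non-negative random variable with exponential moment of order `θ` at most `K`. -/
structure ExpBounded (P : Measure Ω) (θ K : ℝ) (f : Ω → ℝ) : Prop where
  aestronglyMeasurable : AEStronglyMeasurable f P
  nonneg : ∀ᵐ ω ∂P, 0 ≤ f ω
  lintegral_exp_le : ∫⁻ ω, ENNReal.ofReal (Real.exp (θ * f ω)) ∂P ≤ ENNReal.ofReal K

/-- Raise y ≤ e^y, for y = θx/r, to the power r. -/
lemma rpow_le_mul_exp {θ r x : ℝ} (hθ : 0 < θ) (hr : 0 < r) (hx : 0 ≤ x) :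
    x ^ r ≤ (r / θ) ^ r * Real.exp (θ * x) := by
  have h1 : θ * x / r ≤ Real.exp (θ * x / r) := by linarith [Real.add_one_le_exp (θ * x / r)]
  have h2 : x = (r / θ) * (θ * x / r) := by field_simp
  calc x ^ r = (r / θ) ^ r * (θ * x / r) ^ r := by
        rw [← Real.mul_rpow (by positivity) (by positivity), ← h2]
    _ ≤ (r / θ) ^ r * (Real.exp (θ * x / r)) ^ r := by gcongr
    _ = _ := by
        rw [← Real.exp_mul]
        congr 2
        field_simp

lemma ExpBounded.memLp {θ K : ℝ} (hθ : 0 < θ) {f : Ω → ℝ} (hf : ExpBounded P θ K f)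
    {q : ℝ≥0∞} (hq : 1 ≤ q) (hq' : q ≠ ⊤) : MemLp f q P := by
  refine ⟨hf.aestronglyMeasurable, ?_⟩
  have hq0 : q ≠ 0 := (zero_lt_one.trans_le hq).ne'
  have hr : 0 < q.toReal := ENNReal.toReal_pos hq0 hq'
  rw [eLpNorm_lt_top_iff_lintegral_rpow_enorm_lt_top hq0 hq']
  calc ∫⁻ ω, ‖f ω‖ₑ ^ q.toReal ∂P
      ≤ ∫⁻ ω, ENNReal.ofReal ((q.toReal / θ) ^ q.toReal) *
          ENNReal.ofReal (Real.exp (θ * f ω)) ∂P := by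
        refine lintegral_mono_ae ?_
        filter_upwards [hf.nonneg] with ω hω
        rw [Real.enorm_of_nonneg hω, ENNReal.ofReal_rpow_of_nonneg hω hr.le,
          ← ENNReal.ofReal_mul (by positivity)]
        exact ENNReal.ofReal_le_ofReal (rpow_le_mul_exp hθ hr hω)
    _ = ENNReal.ofReal ((q.toReal / θ) ^ q.toReal) *
          ∫⁻ ω, ENNReal.ofReal (Real.exp (θ * f ω)) ∂P :=
        lintegral_const_mul' _ _ ENNReal.ofReal_ne_top
    _ < ⊤ := ENNReal.mul_lt_top ENNReal.ofReal_lt_top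
        (hf.lintegral_exp_le.trans_lt ENNReal.ofReal_lt_top)

/-- Where f ≥ C one has f^r ≤ f^(r+1)/C, and the power r+1 is at most A times the exponential. The
tail integral is therefore at most AK/C, uniformly in the family. The level C is taken just above
AK/ε^r. -/
lemma unifIntegrable_of_expBounded {ι : Type*} {θ K : ℝ} (hθ : 0 < θ) (hK : 0 ≤ K)
    {f : ι → Ω → ℝ} (hf : ∀ i, ExpBounded P θ K (f i)) {q : ℝ≥0∞} (hq : 1 ≤ q) (hq' : q ≠ ⊤) :
    UnifIntegrable f q P := by
  have hq0 : q ≠ 0 := (zero_lt_one.trans_le hq).ne'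
  have hr : 0 < q.toReal := ENNReal.toReal_pos hq0 hq'
  set r := q.toReal with hrdef
  refine unifIntegrable_of hq hq' (fun i => (hf i).aestronglyMeasurable) fun ε hε => ?_
  set A := ((r + 1) / θ) ^ (r + 1) with hA
  have hA0 : 0 < A := by positivity
  have hε' : 0 < ε ^ r := Real.rpow_pos_of_pos hε r
  set C : ℝ := A * K / ε ^ r + 1 with hC
  have hC0 : 0 < C := by positivity
  refine ⟨C.toNNReal, fun i => ?_⟩
  rw [eLpNorm_eq_lintegral_rpow_enorm_toReal hq0 hq']
  have hbound : ∫⁻ ω, ‖{ω | C.toNNReal ≤ ‖f i ω‖₊}.indicator (f i) ω‖ₑ ^ r ∂P ≤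
      ENNReal.ofReal (ε ^ r) := by
    calc _ ≤ ∫⁻ ω, ENNReal.ofReal (A / C) * ENNReal.ofReal (Real.exp (θ * f i ω)) ∂P := by
          refine lintegral_mono_ae ?_
          filter_upwards [(hf i).nonneg] with ω hω
          by_cases hω' : ω ∈ {ω | C.toNNReal ≤ ‖f i ω‖₊}
          · rw [Set.indicator_of_mem hω', Real.enorm_of_nonneg hω,
              ENNReal.ofReal_rpow_of_nonneg hω hr.le, ← ENNReal.ofReal_mul (by positivity)]
            refine ENNReal.ofReal_le_ofReal ?_
            have h1 : C ≤ f i ω := by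
              have h2 : C.toNNReal ≤ ‖f i ω‖₊ := hω'
              have h3 : ((C.toNNReal : ℝ≥0) : ℝ) ≤ ‖f i ω‖ := by exact_mod_cast h2
              rwa [Real.coe_toNNReal _ hC0.le, Real.norm_of_nonneg hω] at h3
            have h2 := rpow_le_mul_exp hθ (by linarith : 0 < r + 1) hω
            have hfpos : 0 < f i ω := hC0.trans_le h1
            rw [Real.rpow_add hfpos, Real.rpow_one] at h2
            rw [div_mul_eq_mul_div, le_div_iff₀ hC0]
            exact (mul_le_mul_of_nonneg_left h1 (Real.rpow_nonneg hω r)).trans h2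
          · rw [Set.indicator_of_notMem hω', enorm_zero, ENNReal.zero_rpow_of_pos hr]
            exact zero_le
      _ = ENNReal.ofReal (A / C) * ∫⁻ ω, ENNReal.ofReal (Real.exp (θ * f i ω)) ∂P :=
          lintegral_const_mul' _ _ ENNReal.ofReal_ne_top
      _ ≤ ENNReal.ofReal (A / C) * ENNReal.ofReal K := by gcongr; exact (hf i).lintegral_exp_le
      _ ≤ ENNReal.ofReal (ε ^ r) := by
          rw [← ENNReal.ofReal_mul (by positivity)]
          refine ENNReal.ofReal_le_ofReal ?_
          rw [div_mul_eq_mul_div, div_le_iff₀ hC0, hC]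
          have : ε ^ r * (A * K / ε ^ r + 1) = A * K + ε ^ r := by field_simp
          linarith
  calc _ ≤ (ENNReal.ofReal (ε ^ r)) ^ (1 / r) := by gcongr
    _ = ENNReal.ofReal ε := by
        rw [ENNReal.ofReal_rpow_of_nonneg hε'.le (by positivity), ← Real.rpow_mul hε.le,
          mul_one_div_cancel hr.ne', Real.rpow_one]

/-- Fatou's lemma. Measurability of `g` up to null sets is part of the conclusion, so limits need no
separate measurability argument. -/
lemma ExpBounded.of_tendsto_ae {θ K : ℝ} {f : ℕ → Ω → ℝ} {g : Ω → ℝ}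
    (hf : ∀ n, ExpBounded P θ K (f n))
    (hfg : ∀ᵐ ω ∂P, Tendsto (fun n => f n ω) atTop (𝓝 (g ω))) : ExpBounded P θ K g := by
  refine ⟨aestronglyMeasurable_of_tendsto_ae atTop (fun n => (hf n).aestronglyMeasurable) hfg,
    ?_, ?_⟩
  · filter_upwards [hfg, ae_all_iff.2 fun n => (hf n).nonneg] with ω h1 h2
    exact ge_of_tendsto' h1 h2
  · calc ∫⁻ ω, ENNReal.ofReal (Real.exp (θ * g ω)) ∂P
        = ∫⁻ ω, liminf (fun n => ENNReal.ofReal (Real.exp (θ * f n ω))) atTop ∂P := by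
          refine lintegral_congr_ae ?_
          filter_upwards [hfg] with ω hω
          refine (Tendsto.liminf_eq ?_).symm
          exact (ENNReal.continuous_ofReal.tendsto _).comp
            ((Real.continuous_exp.tendsto _).comp (hω.const_mul θ))
      _ ≤ liminf (fun n => ∫⁻ ω, ENNReal.ofReal (Real.exp (θ * f n ω)) ∂P) atTop :=
          lintegral_liminf_le' fun n => (Real.measurable_exp.comp_aemeasurable
            ((hf n).aestronglyMeasurable.aemeasurable.const_mul θ)).ennreal_ofReal
      _ ≤ ENNReal.ofReal K := by
          refine liminf_le_of_le (by isBoundedDefault) fun b hb => ?_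
          obtain ⟨n, hn⟩ := hb.exists
          exact hn.trans (hf n).lintegral_exp_le

/-- Vitali's convergence theorem. -/
lemma tendsto_eLpNorm_of_expBounded [IsFiniteMeasure P] {θ K : ℝ} (hθ : 0 < θ) (hK : 0 ≤ K)
    {f : ℕ → Ω → ℝ} {g : Ω → ℝ} (hf : ∀ n, ExpBounded P θ K (f n))
    (hfg : ∀ᵐ ω ∂P, Tendsto (fun n => f n ω) atTop (𝓝 (g ω))) {q : ℝ≥0∞} (hq : 1 ≤ q)
    (hq' : q ≠ ⊤) : Tendsto (fun n => eLpNorm (f n - g) q P) atTop (𝓝 0) :=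
  tendsto_Lp_finite_of_tendsto_ae hq hq' (fun n => (hf n).aestronglyMeasurable)
    ((ExpBounded.of_tendsto_ae hf hfg).memLp hθ hq hq')
    (unifIntegrable_of_expBounded hθ hK hf hq hq') hfg

end ExpMoments

namespace Quadtree

/-! ### All cells are eventually split -/

/-- Every proper rectangle is visited infinitely often. -/
def Recurrent (p : ℕ → ℝ × ℝ) : Prop := ∀ R : Rect, R.Proper → ∀ k, ∃ j, k ≤ j ∧ p j ∈ R.inner

lemma unif_inner_pos {R : Rect} (hR : R.Proper) : 0 < unif R.inner := by
  rw [unif, Measure.restrict_apply R.measurableSet_inner, Set.inter_eq_left.2 hR.inner_subset,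
    Rect.volume_inner]
  exact ENNReal.mul_pos (by simpa using hR.left_lt_right) (by simpa using hR.bottom_lt_top)

/-- Reduces recurrence to countably many rectangles, so that one null set serves for all of them. -/
lemma exists_rat_rect {R : Rect} (hR : R.Proper) : ∃ a b c d : ℚ,
    (⟨a, b, c, d⟩ : Rect).Proper ∧ (⟨a, b, c, d⟩ : Rect).inner ⊆ R.inner := by
  obtain ⟨h1, h2, h3, h4, h5, h6⟩ := hR
  obtain ⟨a, ha1, ha2⟩ := exists_rat_btwn h2
  obtain ⟨b, hb1, hb2⟩ := exists_rat_btwn ha2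
  obtain ⟨c, hc1, hc2⟩ := exists_rat_btwn h5
  obtain ⟨d, hd1, hd2⟩ := exists_rat_btwn hc2
  refine ⟨a, b, c, d, ⟨?_, ?_, ?_, ?_, ?_, ?_⟩, fun z hz => ?_⟩ <;> (try dsimp only) <;> try linarith
  rw [Rect.mem_inner] at hz ⊢
  simp only at hz
  refine ⟨⟨?_, ?_⟩, ?_, ?_⟩ <;> linarith

section

variable {Ω : Type*} [mΩ : MeasurableSpace Ω] {P : Measure Ω} [IsProbabilityMeasure P]
  {τ : ℕ → Ω → ℝ} {p : ℕ → Ω → ℝ × ℝ}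

lemma IsUniformInput.measure_avoid (hI : IsUniformInput P τ p) {B : Set (ℝ × ℝ)}
    (hB : MeasurableSet B) (k m : ℕ) :
    P {ω | ∀ j, k ≤ j → j < k + m → p j ω ∉ B} = (unif Bᶜ) ^ m := by
  induction m with
  | zero =>
    have : {ω | ∀ j, k ≤ j → j < k + 0 → p j ω ∉ B} = Set.univ := by
      ext ω
      simp only [Set.mem_ofPred_eq, Set.mem_univ, iff_true]
      intro j h1 h2; omega
    rw [this, measure_univ, pow_zero]
  | succ m ih =>
    let S : Set ((ℕ → ℝ) × (ℕ → ℝ × ℝ)) := {y | ∀ j, k ≤ j → j < k + m → y.2 j ∉ B}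
    have hS : MeasurableSet S := by
      refine measurableSet_ofPred_forall fun j => ?_
      by_cases h : k ≤ j ∧ j < k + m
      · simp only [h.1, h.2, forall_const]
        have hm : Measurable fun y : (ℕ → ℝ) × (ℕ → ℝ × ℝ) => y.2 j :=
          (measurable_pi_apply j).comp measurable_snd
        exact hm hB.compl
      · have : {y : (ℕ → ℝ) × (ℕ → ℝ × ℝ) | k ≤ j → j < k + m → y.2 j ∉ B} = Set.univ := by
          ext y
          simp only [Set.mem_ofPred_eq, Set.mem_univ, iff_true]
          exact fun h1 h2 => absurd ⟨h1, h2⟩ h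
        rw [this]; exact MeasurableSet.univ
    have e1 : past τ p (k + m) ⁻¹' S = {ω | ∀ j, k ≤ j → j < k + m → p j ω ∉ B} := by
      ext ω
      refine forall_congr' fun j => forall_congr' fun _ => forall_congr' fun hj => ?_
      change pre (k + m) (fun i => p i ω) j ∉ B ↔ _
      rw [pre_apply hj]
    have e2 : {ω | ∀ j, k ≤ j → j < k + (m + 1) → p j ω ∉ B} =
        past τ p (k + m) ⁻¹' S ∩ p (k + m) ⁻¹' Bᶜ := by
      rw [e1]
      ext ω
      simp only [Set.mem_ofPred_eq, Set.mem_inter_iff, Set.mem_preimage, Set.mem_compl_iff]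
      constructor
      · intro h
        exact ⟨fun j h1 h2 => h j h1 (by omega), h (k + m) (by omega) (by omega)⟩
      · rintro ⟨h1, h2⟩ j h3 h4
        rcases (Nat.lt_succ_iff.1 (show j < (k + m) + 1 by omega)).lt_or_eq with h5 | rfl
        · exact h1 j h3 h5
        · exact h2
    rw [e2, (hI.indepFun (k + m)).measure_inter_preimage_eq_mul _ _ hS hB.compl, e1, ih,
      ← Measure.map_apply (hI.measurable_position _) hB.compl, hI.map_position, pow_succ]

lemma IsUniformInput.ae_exists_mem (hI : IsUniformInput P τ p) {R : Rect} (hR : R.Proper)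
    (k : ℕ) : ∀ᵐ ω ∂P, ∃ j, k ≤ j ∧ p j ω ∈ R.inner := by
  have hB := R.measurableSet_inner
  have hlt : unif R.innerᶜ < 1 := by
    rw [prob_compl_eq_one_sub hB]
    exact ENNReal.sub_lt_self ENNReal.one_ne_top one_ne_zero (unif_inner_pos hR).ne'
  rw [ae_iff]
  refine le_antisymm (ge_of_tendsto' (ENNReal.tendsto_pow_atTop_nhds_zero_of_lt_one hlt)
    fun m => ?_) zero_le
  rw [← hI.measure_avoid hB k m]
  refine measure_mono fun ω hω j h1 _ h2 => hω ⟨j, h1, h2⟩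

lemma IsUniformInput.ae_recurrent (hI : IsUniformInput P τ p) :
    ∀ᵐ ω ∂P, Recurrent fun i => p i ω := by
  have h1 : ∀ᵐ ω ∂P, ∀ (a b c d : ℚ) (k : ℕ), (⟨a, b, c, d⟩ : Rect).Proper →
      ∃ j, k ≤ j ∧ p j ω ∈ (⟨a, b, c, d⟩ : Rect).inner := by
    simp only [ae_all_iff]
    intro a b c d k hR
    exact hI.ae_exists_mem hR k
  filter_upwards [h1] with ω hω R hR k
  obtain ⟨a, b, c, d, hR', hsub⟩ := exists_rat_rect hR
  obtain ⟨j, hj, hmem⟩ := hω a b c d k hR'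
  exact ⟨j, hj, hsub hmem⟩

end

/-- A cell of generation at most `n` in the quadtree capped at `n + 1` is an old unvisited one,
once all cells have generation at least `n`. -/
lemma mem_of_length_le {p : ℕ → ℝ × ℝ} {n K : ℕ}
    (hK : ∀ c ∈ capCells (n + 1 : ℕ) p K, n ≤ c.1.length) (k : ℕ) (hk : K ≤ k) {c : Cell}
    (hc : c ∈ capCells (n + 1 : ℕ) p k) (hl : c.1.length ≤ n) :
    c ∈ capCells (n + 1 : ℕ) p K ∧ ∀ j, K ≤ j → j < k → p j ∉ c.2.inner := by
  classical
  induction k, hk using Nat.le_induction generalizing c with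
  | base => exact ⟨hc, fun j h1 h2 => by omega⟩
  | succ k hk ih =>
    rw [capCells, Finset.mem_biUnion] at hc
    obtain ⟨d, hd, hc⟩ := hc
    rcases mem_stepCap.1 hc with ⟨hh, j, rfl⟩ | ⟨hh, rfl⟩
    · have hlen : d.1.length + 1 ≤ n := by simpa [child] using hl
      have := hK d (ih hd (by omega)).1
      omega
    · obtain ⟨h1, h2⟩ := ih hd hl
      refine ⟨h1, fun j hj hjk => ?_⟩
      rcases (Nat.lt_succ_iff.1 hjk).lt_or_eq with h3 | rfl
      · exact h2 j hj h3
      · intro hmem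
        exact hh ⟨by exact_mod_cast Nat.lt_succ_of_le hl, hmem⟩

/-- Induction on `n`. Once all cells of the tree capped at n+1 have generation at least `n`, those
of generation `n` are finitely many and no new one can appear. By recurrence each of them is hit,
and then only generation n+1 is left. -/
lemma Recurrent.exists_forall_length_eq {p : ℕ → ℝ × ℝ} (hp : Recurrent p) (n : ℕ) :
    ∃ K, ∀ c ∈ capCells n p K, c.1.length = n := by
  induction n with
  | zero =>
    refine ⟨0, fun c hc => ?_⟩
    have := length_le_of_mem_capCells hc
    simpa using this
  | succ n ih =>
    obtain ⟨K, hK⟩ := ih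
    -- A cell of generation below `n` would also be present in the tree capped at `n`, which by
    -- induction has none at this stage.
    have hK' : ∀ c ∈ capCells (n + 1 : ℕ) p K, n ≤ c.1.length := by
      intro c hc
      by_contra hlt
      push Not at hlt
      have h1 : (c.1.length : ℕ∞) < n := by exact_mod_cast hlt
      have h2 : (c.1.length : ℕ∞) < (n + 1 : ℕ) := by exact_mod_cast hlt.trans n.lt_succ_self
      have h3 := hK c ((mem_capCells_iff_of_length_lt h1).2
        ((mem_capCells_iff_of_length_lt h2).1 hc))
      omega
    have hvisit : ∀ c ∈ capCells (n + 1 : ℕ) p K, ∃ j, K ≤ j ∧ p j ∈ c.2.inner := fun c hc =>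
      hp c.2 ((isTiling_capCells _ p K).proper c hc) K
    choose! v hv using hvisit
    refine ⟨max K ((capCells (n + 1 : ℕ) p K).sup v + 1), fun c hc => ?_⟩
    have hle : c.1.length ≤ n + 1 := by exact_mod_cast length_le_of_mem_capCells hc
    by_contra hne
    obtain ⟨h1, h2⟩ := mem_of_length_le hK' _ (le_max_left _ _) hc (by omega)
    refine h2 (v c) (hv c h1).1 ?_ (hv c h1).2
    exact lt_of_lt_of_le (Nat.lt_succ_of_le (Finset.le_sup h1)) (le_max_right _ _)

lemma capCells_eq_of_forall_length_eq {p : ℕ → ℝ × ℝ} {n K : ℕ}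
    (hK : ∀ c ∈ capCells n p K, c.1.length = n) {k : ℕ} (hk : K ≤ k) :
    capCells n p k = capCells n p K := by
  induction k, hk using Nat.le_induction with
  | base => rfl
  | succ k hk ih =>
    rw [capCells_succ_of_forall_not_isHit, ih]
    rw [ih]
    intro c hc hh
    have := hh.1
    rw [hK c hc] at this
    exact lt_irrefl _ this

lemma sum_filter_weight_eq {s : Finset Rect} (hs : ∀ R ∈ s, R.Proper) (x : ℝ)
    [DecidablePred fun R : Rect => R.IsAbove x] :
    ∑ R ∈ s.filter (fun R => R.IsAbove x), R.weight x = ∑ R ∈ s, powWeight x beta R := by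
  rw [Finset.sum_filter]
  refine Finset.sum_congr rfl fun R hR => ?_
  split_ifs with h
  · exact weight_eq_powWeight (hs R hR) h
  · exact (powWeight_eq_zero_of_not_isAbove h _).symm

/-- The weight of generation `n` is the limit of the weights of the capped quadtrees. -/
lemma Recurrent.eventually_capWeight_eq {p : ℕ → ℝ × ℝ} (hp : Recurrent p) (x : ℝ) (n : ℕ) :
    ∀ᶠ k in atTop, capWeight x beta n k p = Mgen p x n := by
  classical
  obtain ⟨K, hK⟩ := hp.exists_forall_length_eq n
  have hset : generationAbove p x n =
      (((capCells n p K).filter fun c => c.2.IsAbove x : Finset Cell) : Set Cell) := by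
    ext c
    simp only [generationAbove, Set.mem_ofPred_eq, Finset.coe_filter]
    constructor
    · rintro ⟨⟨k, hk⟩, hl, ha⟩
      refine ⟨?_, ha⟩
      rw [← capCells_eq_of_forall_length_eq hK (le_max_right k K),
        mem_capCells_iff_of_length_eq hl]
      exact ⟨k, le_max_left _ _, by rwa [capCells_top]⟩
    · rintro ⟨hc, ha⟩
      obtain ⟨j, _, hj⟩ := (mem_capCells_iff_of_length_eq (hK c hc)).1 hc
      exact ⟨⟨j, by rwa [capCells_top] at hj⟩, hK c hc, ha⟩
  filter_upwards [eventually_ge_atTop K] with k hk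
  rw [Mgen, hset, finsum_mem_coe_finset, Finset.sum_filter, capWeight,
    capCells_eq_of_forall_length_eq hK hk]
  refine Finset.sum_congr rfl fun c hc => ?_
  split_ifs with h
  · exact (weight_eq_powWeight ((isTiling_capCells _ p K).proper c hc) h).symm
  · exact powWeight_eq_zero_of_not_isAbove h _

end Quadtree

namespace Quadtree

/-! ### The covering as a measurable function -/

/-- Exactly `k` of the times are at most `t`. -/
def HasAtoms (t : ℝ≥0) (k : ℕ) (τ : ℕ → ℝ) : Prop :=
  ∃ s : Finset ℕ, s.card = k ∧ ∀ i, τ i ≤ t ↔ i ∈ s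

lemma HasAtoms.numAtoms_eq {t : ℝ≥0} {k : ℕ} {τ : ℕ → ℝ} (hk : HasAtoms t k τ) :
    numAtoms τ t = k := by
  obtain ⟨s, hs, h⟩ := hk
  have : {i | τ i ≤ t} = (s : Set ℕ) := by ext i; simp [h]
  rw [numAtoms, this, Set.ncard_coe_finset, hs]

lemma HasAtoms.numAtoms_le {t u : ℝ≥0} (hut : u ≤ t) {k : ℕ} {τ : ℕ → ℝ} (hk : HasAtoms t k τ) :
    numAtoms τ u ≤ k := by
  obtain ⟨s, hs, h⟩ := hk
  rw [numAtoms, ← hs, ← Set.ncard_coe_finset]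
  refine Set.ncard_le_ncard (fun i hi => ?_) s.finite_toSet
  exact (h i).1 (le_trans hi (by exact_mod_cast hut))

lemma hasAtoms_numAtoms {t : ℝ≥0} {τ : ℕ → ℝ} (hf : {i | τ i ≤ t}.Finite) :
    HasAtoms t (numAtoms τ t) τ :=
  ⟨hf.toFinset, (Set.ncard_eq_toFinset_card _ hf).symm, fun i => by simp⟩

/-- The value 0 is excluded because `ncard` is also 0 on infinite sets, whereas `HasAtoms` requires
finiteness. -/
lemma numAtoms_eq_iff {t : ℝ≥0} {k : ℕ} (hk : k ≠ 0) {τ : ℕ → ℝ} :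
    numAtoms τ t = k ↔ HasAtoms t k τ := by
  constructor
  · intro h
    have hf : {i | τ i ≤ t}.Finite := Set.finite_of_ncard_ne_zero (by rw [← numAtoms, h]; exact hk)
    have := hasAtoms_numAtoms hf
    rwa [h] at this
  · exact HasAtoms.numAtoms_eq

lemma measurableSet_hasAtoms (t : ℝ≥0) (k : ℕ) : MeasurableSet {τ : ℕ → ℝ | HasAtoms t k τ} := by
  have : {τ : ℕ → ℝ | HasAtoms t k τ} =
      ⋃ s : Finset ℕ, {τ : ℕ → ℝ | s.card = k ∧ ∀ i, τ i ≤ t ↔ i ∈ s} := by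
    ext τ; simp [HasAtoms]
  rw [this]
  refine MeasurableSet.iUnion fun s => (MeasurableSet.const _).inter
    (measurableSet_ofPred_forall fun i => ?_)
  have h1 : MeasurableSet {τ : ℕ → ℝ | τ i ≤ t} :=
    measurableSet_le (measurable_pi_apply i) measurable_const
  by_cases hi : i ∈ s
  · simpa only [hi, iff_true] using h1
  · simp only [hi, iff_false]
    exact h1.compl

lemma measurable_numAtoms (t : ℝ≥0) : Measurable fun τ : ℕ → ℝ => numAtoms τ t := by
  have hpos : ∀ k ≠ 0, MeasurableSet ((fun τ : ℕ → ℝ => numAtoms τ t) ⁻¹' {k}) := by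
    intro k hk
    have : (fun τ : ℕ → ℝ => numAtoms τ t) ⁻¹' {k} = {τ | HasAtoms t k τ} := by
      ext τ; exact numAtoms_eq_iff hk
    rw [this]; exact measurableSet_hasAtoms t k
  refine measurable_to_countable' fun k => ?_
  by_cases hk : k = 0
  · subst hk
    -- The value 0 covers both the empty and the infinite case, so it is handled as the complement
    -- of the positive values.
    have : (fun τ : ℕ → ℝ => numAtoms τ t) ⁻¹' {0} =
        (⋃ k : ℕ, (fun τ : ℕ → ℝ => numAtoms τ t) ⁻¹' {k + 1})ᶜ := by
      ext τ
      simp only [Set.mem_preimage, Set.mem_singleton_iff, Set.mem_compl_iff, Set.mem_iUnion,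
        not_exists]
      constructor
      · intro h k; omega
      · intro h
        by_contra hne
        exact h (numAtoms τ t - 1) (by omega)
    rw [this]
    exact (MeasurableSet.iUnion fun k => hpos (k + 1) k.succ_ne_zero).compl
  · exact hpos k hk

open Classical in
lemma card_filter_quad (τ : ℕ → ℝ) (p : ℕ → ℝ × ℝ) (t : ℝ≥0) (B : Set Rect) :
    (((quad τ p t).filter (· ∈ B)).card : ℝ) =
      ∑ c ∈ capCells ⊤ p (numAtoms τ t), if c.2 ∈ B then 1 else 0 := by
  rw [quad, ← capCells_top, Finset.card_filter, Nat.cast_sum,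
    Finset.sum_image (isTiling_capCells ⊤ p _).injOn_snd]
  simp

lemma measurable_quad {Z : Type*} [MeasurableSpace Z] {τ : Z → ℕ → ℝ} {p : Z → ℕ → ℝ × ℝ}
    (hτ : Measurable τ) (hp : ∀ i, Measurable fun z => p z i) (t : ℝ≥0) :
    @Measurable Z (Finset Rect) _ rectFinsetSigma fun z => quad (τ z) (p z) t := by
  classical
  rw [measurable_iff_comap_le, rectFinsetSigma, MeasurableSpace.comap_iSup]
  refine iSup_le fun B => ?_
  rw [MeasurableSpace.comap_comp, ← measurable_iff_comap_le]
  have hsum : ∀ k, Measurable fun z =>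
      ∑ c ∈ capCells ⊤ (p z) k, if c.2 ∈ B.1 then (1 : ℝ) else 0 := fun k =>
    measurable_sum_capCells ⊤ hp k (fun _ _ R => if R ∈ B.1 then (1 : ℝ) else 0) fun _ =>
      Measurable.ite (measurable_snd B.2) measurable_const measurable_const
  refine measurable_to_countable' fun j => ?_
  have : (fun s : Finset Rect => (s.filter (· ∈ B.1)).card) ∘ (fun z => quad (τ z) (p z) t) ⁻¹' {j}
      = ⋃ k : ℕ, {z | numAtoms (τ z) t = k} ∩
        {z | ∑ c ∈ capCells ⊤ (p z) k, (if c.2 ∈ B.1 then (1 : ℝ) else 0) = j} := by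
    ext z
    simp only [Set.mem_preimage, Function.comp_apply, Set.mem_singleton_iff, Set.mem_iUnion,
      Set.mem_inter_iff, Set.mem_ofPred_eq, exists_eq_left']
    rw [← card_filter_quad, Nat.cast_inj]
  rw [this]
  exact MeasurableSet.iUnion fun k =>
    (((measurable_numAtoms t).comp hτ) (measurableSet_singleton k)).inter
      ((hsum k) (measurableSet_singleton (j : ℝ)))

/-- Sums of a measurable function over a finite set of rectangles are measurable. -/
lemma measurable_sum_rect {g : Rect → ℝ≥0∞} (hg : Measurable g) :
    @Measurable (Finset Rect) ℝ≥0∞ rectFinsetSigma _ fun s => ∑ R ∈ s, g R := by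
  classical
  let _ : MeasurableSpace (Finset Rect) := rectFinsetSigma
  -- A finite set is encoded by its counting measure, whose values on Borel sets are the counts that
  -- generate `rectFinsetSigma`. Sums become integrals, which depend measurably on the measure.
  let ν : Finset Rect → Measure Rect := fun s => ∑ R ∈ s, Measure.dirac R
  have hν : Measurable ν := by
    refine Measure.measurable_of_measurable_coe _ fun B hB => ?_
    have h1 : Measurable fun s : Finset Rect => (s.filter (· ∈ B)).card := by
      refine Measurable.mono (comap_measurable (m := ⊤)
        (fun s : Finset Rect => (s.filter (· ∈ B)).card)) ?_ le_top
      exact le_iSup (fun B : {B : Set Rect // MeasurableSet B} =>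
        MeasurableSpace.comap (fun s : Finset Rect => (s.filter (· ∈ B.1)).card) ⊤) ⟨B, hB⟩
    have h2 : (fun s => ν s B) =
        (fun n : ℕ => (n : ℝ≥0∞)) ∘ fun s : Finset Rect => (s.filter (· ∈ B)).card := by
      funext s
      simp only [ν, Measure.coe_finsetSum, Finset.sum_apply, Function.comp_apply,
        Measure.dirac_apply' _ hB, Finset.card_filter, Nat.cast_sum, Set.indicator_apply]
      simp
    rw [h2]
    exact measurable_from_nat.comp h1
  have h3 : (fun s : Finset Rect => ∑ R ∈ s, g R) = fun s => ∫⁻ R, g R ∂(ν s) := by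
    funext s
    simp only [ν, lintegral_finsetSum_measure, lintegral_dirac' _ hg]
  rw [h3]
  exact (Measure.measurable_lintegral hg).comp hν

lemma M_eq_capWeight (τ : ℕ → ℝ) (p : ℕ → ℝ × ℝ) (x : ℝ) (t : ℝ≥0) :
    M τ p x t = capWeight x beta ⊤ (numAtoms τ t) p := by
  classical
  have ht := isTiling_capCells ⊤ p (numAtoms τ t)
  rw [M, quad, ← capCells_top, sum_filter_weight_eq, capWeight, Finset.sum_image ht.injOn_snd]
  intro R hR
  obtain ⟨c, hc, rfl⟩ := Finset.mem_image.1 hR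
  exact ht.proper c hc

/-- Adaptedness to `history` requires M_t(x) as a function of the covering alone, whereas
`M_eq_capWeight` involves the number of atoms and their positions. -/
lemma M_eq_toReal (τ : ℕ → ℝ) (p : ℕ → ℝ × ℝ) (x : ℝ) (t : ℝ≥0) :
    M τ p x t = (∑ R ∈ quad τ p t, ENNReal.ofReal (powWeight x beta R)).toReal := by
  classical
  have ht := isTiling_capCells ⊤ p (numAtoms τ t)
  have hR : ∀ R ∈ quad τ p t, R.Proper := by
    intro R hR
    rw [quad, ← capCells_top] at hR
    obtain ⟨c, hc, rfl⟩ := Finset.mem_image.1 hR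
    exact ht.proper c hc
  rw [M, sum_filter_weight_eq hR, ENNReal.toReal_sum fun _ _ => ENNReal.ofReal_ne_top]
  exact Finset.sum_congr rfl fun R h =>
    (ENNReal.toReal_ofReal (powWeight_nonneg (hR R h) x beta)).symm

/-! ### The filtration of the quadtree process -/

section

variable {Ω : Type*} {τ : ℕ → Ω → ℝ} {p : ℕ → Ω → ℝ × ℝ}

/-- The filtration generated by the coverings. -/
noncomputable def quadFiltration [mΩ : MeasurableSpace Ω] (hτ : ∀ i, Measurable (τ i))
    (hp : ∀ i, Measurable (p i)) : Filtration ℝ≥0 mΩ where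
  seq t := history τ p t
  mono' s t hst := by
    refine iSup_le fun u => ?_
    exact le_iSup (fun u : {u : ℝ≥0 // u ≤ t} => MeasurableSpace.comap
      (fun ω => quad (fun i => τ i ω) (fun i => p i ω) u.1) rectFinsetSigma) ⟨u.1, u.2.trans hst⟩
  le' t := iSup_le fun u =>
    (measurable_quad (measurable_pi_lambda (fun ω i => τ i ω) hτ) hp u.1).comap_le

lemma measurable_M (x : ℝ) (t : ℝ≥0) :
    @Measurable Ω ℝ (history τ p t) _
      fun ω => M (fun i => τ i ω) (fun i => p i ω) x t := by
  simp only [M_eq_toReal]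
  refine ENNReal.measurable_toReal.comp ?_
  refine (measurable_sum_rect (measurable_powWeight x beta).ennreal_ofReal).comp ?_
  rw [measurable_iff_comap_le]
  exact le_iSup (fun u : {u : ℝ≥0 // u ≤ t} => MeasurableSpace.comap
    (fun ω => quad (fun i => τ i ω) (fun i => p i ω) u.1) rectFinsetSigma) ⟨t, le_rfl⟩

lemma measurableSet_hasAtoms_past (t : ℝ≥0) (k j : ℕ) :
    MeasurableSet[MeasurableSpace.comap (past τ p j) inferInstance]
      {ω | HasAtoms t k fun i => τ i ω} :=
  ⟨{y | HasAtoms t k y.1}, measurable_fst (measurableSet_hasAtoms t k), rfl⟩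

/-- On the event that there are `k` atoms up to time `t`, the history up to `t` depends only on
the times and the first `k` positions. -/
lemma measurableSet_history_inter {t : ℝ≥0} {A : Set Ω} (hA : MeasurableSet[history τ p t] A)
    (k : ℕ) : MeasurableSet[MeasurableSpace.comap (past τ p k) inferInstance]
      (A ∩ {ω | HasAtoms t k fun i => τ i ω}) := by
  set E := {ω | HasAtoms t k fun i => τ i ω} with hE
  have hEm : MeasurableSet[MeasurableSpace.comap (past τ p k) inferInstance] E :=
    measurableSet_hasAtoms_past t k k
  -- The sets with the claimed property form a σ-algebra because `E` itself belongs to the past, so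
  -- only the generators of the history have to be checked.
  let m : MeasurableSpace Ω :=
    { MeasurableSet' := fun A =>
        MeasurableSet[MeasurableSpace.comap (past τ p k) inferInstance] (A ∩ E)
      measurableSet_empty := by
        rw [Set.empty_inter]; exact @MeasurableSet.empty _ (_)
      measurableSet_compl := fun A hA => by
        have : Aᶜ ∩ E = E \ (A ∩ E) := by ext ω; simp; tauto
        rw [this]
        exact @MeasurableSet.diff _ (_) _ _ hEm hA
      measurableSet_iUnion := fun f hf => by
        rw [Set.iUnion_inter]
        exact @MeasurableSet.iUnion _ _ (_) _ _ hf }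
  have hle : history τ p t ≤ m := by
    refine iSup_le fun u => ?_
    rintro _ ⟨S, hS, rfl⟩
    have hq : @Measurable ((ℕ → ℝ) × (ℕ → ℝ × ℝ)) (Finset Rect) _ rectFinsetSigma
        fun y => quad y.1 y.2 u.1 :=
      measurable_quad measurable_fst (fun i => (measurable_pi_apply i).comp measurable_snd) u.1
    have heq : (fun ω => quad (fun i => τ i ω) (fun i => p i ω) u.1) ⁻¹' S ∩ E =
        past τ p k ⁻¹' ((fun y => quad y.1 y.2 u.1) ⁻¹' S) ∩ E := by
      ext ω
      refine and_congr_left fun hω => ?_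
      -- At an earlier time `u` there are at most `k` atoms, so the covering at time `u` reads no
      -- position beyond the first `k`.
      have hle := HasAtoms.numAtoms_le u.2 hω
      have : quad (fun i => τ i ω) (fun i => p i ω) u.1 =
          quad (past τ p k ω).1 (past τ p k ω).2 u.1 := by
        rw [quad, quad, ← capCells_top, ← capCells_top]
        congr 1
        exact capCells_congr ⊤ fun i hi =>
          (pre_apply (lt_of_lt_of_le hi hle) fun i => p i ω).symm
      simp only [Set.mem_preimage, this]
    change MeasurableSet[MeasurableSpace.comap (past τ p k) inferInstance] (_ ∩ E)
    rw [heq]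
    exact @MeasurableSet.inter _ (_) _ _ ⟨_, hq hS, rfl⟩ hEm
  exact hle A hA

end

end Quadtree

/-! ### Uniform integrability in `L¹` from exponential moments -/

lemma ExpBounded.eLpNorm_one_le {Ω : Type*} [MeasurableSpace Ω] {P : Measure Ω} {θ K : ℝ}
    (hθ : 0 < θ) {f : Ω → ℝ} (hf : ExpBounded P θ K f) :
    eLpNorm f 1 P ≤ ENNReal.ofReal (1 / θ) * ENNReal.ofReal K := by
  rw [eLpNorm_one_eq_lintegral_enorm]
  calc ∫⁻ ω, ‖f ω‖ₑ ∂P ≤ ∫⁻ ω, ENNReal.ofReal (1 / θ) * ENNReal.ofReal (Real.exp (θ * f ω)) ∂P := by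
        refine lintegral_mono_ae ?_
        filter_upwards [hf.nonneg] with ω hω
        rw [Real.enorm_of_nonneg hω, ← ENNReal.ofReal_mul (by positivity)]
        refine ENNReal.ofReal_le_ofReal ?_
        simpa using rpow_le_mul_exp hθ one_pos hω
    _ = ENNReal.ofReal (1 / θ) * ∫⁻ ω, ENNReal.ofReal (Real.exp (θ * f ω)) ∂P :=
        lintegral_const_mul' _ _ ENNReal.ofReal_ne_top
    _ ≤ _ := by gcongr; exact hf.lintegral_exp_le

lemma uniformIntegrable_of_expBounded {Ω ι : Type*} [MeasurableSpace Ω] {P : Measure Ω} {θ K : ℝ}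
    (hθ : 0 < θ) (hK : 0 ≤ K) {f : ι → Ω → ℝ} (hf : ∀ i, ExpBounded P θ K (f i)) :
    UniformIntegrable f 1 P := by
  refine ⟨fun i => (hf i).aestronglyMeasurable,
    unifIntegrable_of_expBounded hθ hK hf le_rfl ENNReal.one_ne_top,
    (1 / θ).toNNReal * K.toNNReal, fun i => ?_⟩
  exact (hf i).eLpNorm_one_le hθ

namespace Quadtree

/-! ### Limits of the weights -/

section

variable {Ω : Type*} [mΩ : MeasurableSpace Ω] {P : Measure Ω} [IsProbabilityMeasure P]
  {τ : ℕ → Ω → ℝ} {p : ℕ → Ω → ℝ × ℝ}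

lemma IsUniformInput.expBounded_capWeight (hI : IsUniformInput P τ p) (x : ℝ) (n : ℕ∞) (k : ℕ) :
    ExpBounded P expRate (Real.exp 2) fun ω => capWeight x beta n k fun i => p i ω := by
  refine ⟨((measurable_capWeight x beta n k).comp
    (measurable_positions hI.measurable_position)).aestronglyMeasurable,
    ae_of_all _ fun ω => capWeight_nonneg x beta n k _, ?_⟩
  have := hI.setLIntegral_exp_le x n k (A := Set.univ) MeasurableSet.univ
  rwa [setLIntegral_univ, measure_univ, mul_one] at this

lemma IsUniformInput.ae_tendsto_capWeight_Mgen (hI : IsUniformInput P τ p) (x : ℝ) (n : ℕ) :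
    ∀ᵐ ω ∂P, Tendsto (fun k => capWeight x beta n k fun i => p i ω) atTop
      (𝓝 (Mgen (fun i => p i ω) x n)) := by
  filter_upwards [hI.ae_recurrent] with ω hω
  exact tendsto_const_nhds.congr' ((hω.eventually_capWeight_eq x n).mono fun k hk => hk.symm)

lemma IsUniformInput.expBounded_Mgen (hI : IsUniformInput P τ p) (x : ℝ) (n : ℕ) :
    ExpBounded P expRate (Real.exp 2) fun ω => Mgen (fun i => p i ω) x n :=
  ExpBounded.of_tendsto_ae (fun k => hI.expBounded_capWeight x n k)
    (hI.ae_tendsto_capWeight_Mgen x n)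

/-- The limit of the discrete-time martingale. -/
noncomputable def limitWeight {Ω : Type*} (p : ℕ → Ω → ℝ × ℝ) (x : ℝ) (ω : Ω) : ℝ :=
  limUnder atTop fun k => capWeight x beta ⊤ k fun i => p i ω

lemma IsUniformInput.uniformIntegrable (hI : IsUniformInput P τ p) (x : ℝ) :
    UniformIntegrable (fun k ω => capWeight x beta ⊤ k fun i => p i ω) 1 P :=
  uniformIntegrable_of_expBounded expRate_pos (Real.exp_pos 2).le
    fun k => hI.expBounded_capWeight x ⊤ k

lemma IsUniformInput.ae_tendsto_limitWeight (hI : IsUniformInput P τ p) (x : ℝ) :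
    ∀ᵐ ω ∂P, Tendsto (fun k => capWeight x beta ⊤ k fun i => p i ω) atTop
      (𝓝 (limitWeight p x ω)) := by
  filter_upwards [(hI.martingale_capWeight x ⊤).submartingale.exists_ae_tendsto_of_bdd
    (hI.uniformIntegrable x).2.2.choose_spec] with ω hω
  exact tendsto_nhds_limUnder hω

lemma IsUniformInput.expBounded_limitWeight (hI : IsUniformInput P τ p) (x : ℝ) :
    ExpBounded P expRate (Real.exp 2) (limitWeight p x) :=
  ExpBounded.of_tendsto_ae (fun k => hI.expBounded_capWeight x ⊤ k) (hI.ae_tendsto_limitWeight x)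

lemma IsUniformInput.integrable_limitWeight (hI : IsUniformInput P τ p) (x : ℝ) :
    Integrable (limitWeight p x) P :=
  memLp_one_iff_integrable.1
    ((hI.expBounded_limitWeight x).memLp expRate_pos le_rfl ENNReal.one_ne_top)

lemma IsUniformInput.capWeight_ae_eq_condExp (hI : IsUniformInput P τ p) (x : ℝ) (k : ℕ) :
    (fun ω => capWeight x beta ⊤ k fun i => p i ω) =ᵐ[P]
      P[limitWeight p x | pastFiltration hI.measurable_time hI.measurable_position k] :=
  (hI.martingale_capWeight x ⊤).eq_condExp_of_tendsto_eLpNorm (hI.integrable_limitWeight x)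
    (tendsto_eLpNorm_of_expBounded expRate_pos (Real.exp_pos 2).le
      (fun k => hI.expBounded_capWeight x ⊤ k) (hI.ae_tendsto_limitWeight x) le_rfl
      ENNReal.one_ne_top) k

/-- Fatou's lemma in the number of insertions, in which the bound on the effect of the cap is
uniform. -/
lemma IsUniformInput.lintegral_sq_limitWeight_sub_le (hI : IsUniformInput P τ p) (x : ℝ) (n : ℕ) :
    ∫⁻ ω, ENNReal.ofReal ((limitWeight p x ω - Mgen (fun i => p i ω) x n) ^ 2) ∂P ≤
      ENNReal.ofReal ((1 - splitRate (2 * beta))⁻¹ * splitRate (2 * beta) ^ n) := by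
  have hpos := measurable_positions hI.measurable_position
  calc _ = ∫⁻ ω, liminf (fun k => ENNReal.ofReal ((capWeight x beta ⊤ k (fun i => p i ω) -
          capWeight x beta n k fun i => p i ω) ^ 2)) atTop ∂P := by
        refine lintegral_congr_ae ?_
        filter_upwards [hI.ae_tendsto_limitWeight x, hI.ae_tendsto_capWeight_Mgen x n] with ω h1 h2
        exact ((ENNReal.continuous_ofReal.tendsto _).comp ((h1.sub h2).pow 2)).liminf_eq.symm
    _ ≤ liminf (fun k => ∫⁻ ω, ENNReal.ofReal ((capWeight x beta ⊤ k (fun i => p i ω) -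
          capWeight x beta n k fun i => p i ω) ^ 2) ∂P) atTop :=
        lintegral_liminf_le fun k => ((((measurable_capWeight x beta ⊤ k).comp hpos).sub
          ((measurable_capWeight x beta n k).comp hpos)).pow_const 2).ennreal_ofReal
    _ ≤ _ := by
        refine liminf_le_of_le (by isBoundedDefault) fun b hb => ?_
        obtain ⟨k, hk⟩ := hb.exists
        exact hk.trans (hI.lintegral_sq_sub_le x n k)

/-- The mean squared distances to the limit are summable in `n`. The series of squared distances is
then almost surely finite, and its terms tend to zero. -/
lemma IsUniformInput.ae_tendsto_Mgen (hI : IsUniformInput P τ p) (x : ℝ) :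
    ∀ᵐ ω ∂P, Tendsto (fun n => Mgen (fun i => p i ω) x n) atTop (𝓝 (limitWeight p x ω)) := by
  have hm : ∀ n : ℕ, AEMeasurable (fun ω =>
      ENNReal.ofReal ((limitWeight p x ω - Mgen (fun i => p i ω) x n) ^ 2)) P := fun n =>
    (((hI.expBounded_limitWeight x).aestronglyMeasurable.aemeasurable.sub
      (hI.expBounded_Mgen x n).aestronglyMeasurable.aemeasurable).pow_const 2).ennreal_ofReal
  have hρ0 := splitRate_two_mul_beta_pos
  have hρ1 := splitRate_two_mul_beta_lt_one
  have hsum : ∑' n : ℕ, ∫⁻ ω, ENNReal.ofReal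
      ((limitWeight p x ω - Mgen (fun i => p i ω) x n) ^ 2) ∂P ≠ ⊤ := by
    refine ne_top_of_le_ne_top ?_ (ENNReal.tsum_le_tsum
      fun n => hI.lintegral_sq_limitWeight_sub_le x n)
    rw [← ENNReal.ofReal_tsum_of_nonneg]
    · exact ENNReal.ofReal_ne_top
    · exact fun n => mul_nonneg inv_one_sub_splitRate_pos.le (pow_nonneg hρ0.le n)
    · exact (summable_geometric_of_lt_one hρ0.le hρ1).mul_left _
  rw [← lintegral_tsum hm] at hsum
  filter_upwards [ae_lt_top' (AEMeasurable.tsum hm) hsum] with ω hω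
  have h1 := ENNReal.tendsto_atTop_zero_of_tsum_ne_top hω.ne
  have h2 := (ENNReal.tendsto_toReal ENNReal.zero_ne_top).comp h1
  simp only [Function.comp_def, ENNReal.toReal_ofReal (sq_nonneg _), ENNReal.toReal_zero] at h2
  have h3 : Tendsto (fun n => |limitWeight p x ω - Mgen (fun i => p i ω) x n|) atTop (𝓝 0) := by
    have := (Real.continuous_sqrt.tendsto 0).comp h2
    simpa only [Function.comp_def, Real.sqrt_sq_eq_abs, Real.sqrt_zero] using this
  have h4 := (tendsto_zero_iff_abs_tendsto_zero _).2 h3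
  have h5 := (tendsto_const_nhds (x := limitWeight p x ω)).sub h4
  simpa using h5

/-! ### The continuous-time process -/

lemma ae_partition {P : Measure Ω} (hfin : ∀ᵐ ω ∂P, ∀ t : ℝ≥0, {i | τ i ω ≤ t}.Finite) (t : ℝ≥0) :
    ∀ᵐ ω ∂P, ω ∈ ⋃ k, {ω | HasAtoms t k fun i => τ i ω} := by
  filter_upwards [hfin] with ω hω
  exact Set.mem_iUnion.2 ⟨_, hasAtoms_numAtoms (hω t)⟩

lemma pairwise_disjoint_hasAtoms {Ω : Type*} (τ : ℕ → Ω → ℝ) (t : ℝ≥0) :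
    Pairwise (Function.onFun Disjoint fun k => {ω | HasAtoms t k fun i => τ i ω}) := by
  intro k l hkl
  rw [Function.onFun, Set.disjoint_left]
  intro ω hk hl
  exact hkl ((HasAtoms.numAtoms_eq hk).symm.trans (HasAtoms.numAtoms_eq hl))

lemma IsUniformInput.measurableSet_hasAtoms {P : Measure Ω} (hI : IsUniformInput P τ p) (t : ℝ≥0) (k : ℕ) :
    MeasurableSet {ω | HasAtoms t k fun i => τ i ω} :=
  (measurable_past hI.measurable_time hI.measurable_position 0).comap_le _
    (measurableSet_hasAtoms_past t k 0)

/-- On the event that there are `k` atoms up to `t`, which concerns times only, the exponential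
moment is at most exp 2 times the probability of the event. The constant does not depend on `k`, so
these bounds can be summed. -/
lemma IsUniformInput.expBounded_M (hI : IsUniformInput P τ p)
    (hfin : ∀ᵐ ω ∂P, ∀ t : ℝ≥0, {i | τ i ω ≤ t}.Finite) (x : ℝ) (t : ℝ≥0) :
    ExpBounded P expRate (Real.exp 2) fun ω => M (fun i => τ i ω) (fun i => p i ω) x t := by
  refine ⟨?_, ae_of_all _ fun ω => ?_, ?_⟩
  · exact ((measurable_M x t).mono ((quadFiltration hI.measurable_time
      hI.measurable_position).le t) le_rfl).aestronglyMeasurable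
  · rw [M_eq_capWeight]; exact capWeight_nonneg _ _ _ _ _
  · rw [← Measure.restrict_eq_self_of_ae_mem (ae_partition hfin t),
      lintegral_iUnion (hI.measurableSet_hasAtoms t) (pairwise_disjoint_hasAtoms τ t)]
    calc _ ≤ ∑' k, ENNReal.ofReal (Real.exp 2) * P {ω | HasAtoms t k fun i => τ i ω} := by
          refine ENNReal.tsum_le_tsum fun k => ?_
          refine le_trans (le_of_eq ?_)
            (hI.setLIntegral_exp_le x ⊤ k (measurableSet_hasAtoms_past t k 0))
          refine setLIntegral_congr_fun (hI.measurableSet_hasAtoms t k) fun ω hω => ?_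
          simp only [M_eq_capWeight, HasAtoms.numAtoms_eq hω]
      _ = ENNReal.ofReal (Real.exp 2) * P (⋃ k, {ω | HasAtoms t k fun i => τ i ω}) := by
          rw [ENNReal.tsum_mul_left, measure_iUnion (pairwise_disjoint_hasAtoms τ t)
            (hI.measurableSet_hasAtoms t)]
      _ ≤ ENNReal.ofReal (Real.exp 2) * 1 := by gcongr; exact prob_le_one
      _ = _ := mul_one _

/-- A set `A` of the history is cut according to the number `k` of atoms up to `t`. Each piece
belongs to stage `k` of the discrete filtration, and on it M_t(x) is the k-th term of the discrete
martingale, which is the conditional expectation of the limit. -/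
lemma IsUniformInput.M_ae_eq_condExp (hI : IsUniformInput P τ p)
    (hfin : ∀ᵐ ω ∂P, ∀ t : ℝ≥0, {i | τ i ω ≤ t}.Finite) (x : ℝ) (t : ℝ≥0) :
    (fun ω => M (fun i => τ i ω) (fun i => p i ω) x t) =ᵐ[P]
      P[limitWeight p x | quadFiltration hI.measurable_time hI.measurable_position t] := by
  have hle := (quadFiltration hI.measurable_time hI.measurable_position).le t
  have hint : Integrable (fun ω => M (fun i => τ i ω) (fun i => p i ω) x t) P :=
    memLp_one_iff_integrable.1
      ((hI.expBounded_M hfin x t).memLp expRate_pos le_rfl ENNReal.one_ne_top)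
  have hlim := hI.integrable_limitWeight x
  refine ae_eq_condExp_of_forall_setIntegral_eq hle hlim (fun s _ _ => hint.integrableOn)
    (fun A hA _ => ?_) (measurable_M x t).stronglyMeasurable.aestronglyMeasurable
  have hA' : MeasurableSet A := hle A hA
  set E := fun k => {ω | HasAtoms t k fun i => τ i ω} with hE
  have hae : A =ᵐ[P] ⋃ k, A ∩ E k := by
    filter_upwards [ae_partition hfin t] with ω hω
    refine propext ?_
    change ω ∈ A ↔ ω ∈ ⋃ k, A ∩ E k
    rw [← Set.inter_iUnion]
    exact ⟨fun h => ⟨h, hω⟩, fun h => h.1⟩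
  have hm : ∀ k, MeasurableSet (A ∩ E k) := fun k => hA'.inter (hI.measurableSet_hasAtoms t k)
  have hd : Pairwise (Function.onFun Disjoint fun k => A ∩ E k) := fun k l hkl =>
    (pairwise_disjoint_hasAtoms τ t hkl).mono Set.inter_subset_right Set.inter_subset_right
  rw [setIntegral_congr_set hae, setIntegral_congr_set hae,
    integral_iUnion hm hd hint.integrableOn, integral_iUnion hm hd hlim.integrableOn]
  refine tsum_congr fun k => ?_
  calc ∫ ω in A ∩ E k, M (fun i => τ i ω) (fun i => p i ω) x t ∂P
      = ∫ ω in A ∩ E k, capWeight x beta ⊤ k (fun i => p i ω) ∂P := by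
        refine setIntegral_congr_fun (hm k) fun ω hω => ?_
        simp only [M_eq_capWeight, HasAtoms.numAtoms_eq hω.2]
    _ = ∫ ω in A ∩ E k, (P[limitWeight p x | pastFiltration hI.measurable_time
          hI.measurable_position k]) ω ∂P :=
        integral_congr_ae (ae_restrict_of_ae (hI.capWeight_ae_eq_condExp x k))
    _ = ∫ ω in A ∩ E k, limitWeight p x ω ∂P :=
        setIntegral_condExp ((pastFiltration hI.measurable_time hI.measurable_position).le k) hlim
          (measurableSet_history_inter hA k)

lemma tendsto_numAtoms {τ : ℕ → ℝ} (hτ : StrictMono τ)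
    (hfin : ∀ t : ℝ≥0, {i | τ i ≤ t}.Finite) : Tendsto (numAtoms τ) atTop atTop := by
  refine tendsto_atTop.2 fun b => ?_
  filter_upwards [eventually_ge_atTop (τ b).toNNReal] with t ht
  have hb : τ b ≤ t := Real.toNNReal_le_iff_le_coe.1 ht
  have hsub : ((Finset.range b : Finset ℕ) : Set ℕ) ⊆ {i | τ i ≤ t} := by
    intro i hi
    have : i < b := by simpa using hi
    exact (hτ this).le.trans hb
  have := Set.ncard_le_ncard hsub (hfin t)
  rwa [Set.ncard_coe_finset, Finset.card_range] at this

lemma IsUniformInput.ae_tendsto_M (hI : IsUniformInput P τ p)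
    (hfin : ∀ᵐ ω ∂P, ∀ t : ℝ≥0, {i | τ i ω ≤ t}.Finite)
    (hrank : ∀ᵐ ω ∂P, StrictMono (fun i => τ i ω)) (x : ℝ) :
    ∀ᵐ ω ∂P, Tendsto (fun t => M (fun i => τ i ω) (fun i => p i ω) x t) atTop
      (𝓝 (limitWeight p x ω)) := by
  filter_upwards [hfin, hrank, hI.ae_tendsto_limitWeight x] with ω h1 h2 h3
  simp only [M_eq_capWeight]
  exact h3.comp (tendsto_numAtoms h2 h1)

lemma IsUniformInput.martingale_M (hI : IsUniformInput P τ p)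
    (hfin : ∀ᵐ ω ∂P, ∀ t : ℝ≥0, {i | τ i ω ≤ t}.Finite) (x : ℝ) :
    Martingale (fun t ω => M (fun i => τ i ω) (fun i => p i ω) x t)
      (quadFiltration hI.measurable_time hI.measurable_position) P := by
  refine ⟨fun t => (measurable_M x t).stronglyMeasurable, fun s t hst => ?_⟩
  refine (condExp_congr_ae (hI.M_ae_eq_condExp hfin x t)).trans ?_
  refine (condExp_condExp_of_le ((quadFiltration hI.measurable_time
    hI.measurable_position).mono hst) ((quadFiltration hI.measurable_time
    hI.measurable_position).le t)).trans ?_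
  exact (hI.M_ae_eq_condExp hfin x s).symm

/-! ### The Poisson input -/

lemma ae_finite_atoms {N : Ω → Measure (ℝ × ℝ × ℝ)} (hN : IsPoissonPointProcess N intensity P)
    (hatoms : ∀ᵐ ω ∂P, N ω = Measure.sum (fun i => Measure.dirac (τ i ω, p i ω))) :
    ∀ᵐ ω ∂P, ∀ t : ℝ≥0, {i | τ i ω ≤ t}.Finite := by
  classical
  have hS : ∀ n : ℕ, MeasurableSet (Set.Iic (n : ℝ) ×ˢ (Set.univ : Set (ℝ × ℝ))) := fun n =>
    measurableSet_Iic.prod MeasurableSet.univ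
  have hlt : ∀ n : ℕ, intensity (Set.Iic (n : ℝ) ×ˢ (Set.univ : Set (ℝ × ℝ))) ≠ ⊤ := by
    intro n
    rw [intensity, Measure.restrict_apply (hS n), Set.prod_inter_prod, Set.univ_inter,
      Set.inter_comm, Set.Ici_inter_Iic, Measure.volume_eq_prod, Measure.prod_prod,
      Measure.volume_eq_prod, Measure.prod_prod, Real.volume_Icc, Real.volume_Icc]
    exact ENNReal.mul_ne_top ENNReal.ofReal_ne_top
      (ENNReal.mul_ne_top ENNReal.ofReal_ne_top ENNReal.ofReal_ne_top)
  filter_upwards [ae_all_iff.2 fun n => hN.ae_count_lt_top (hS n) (hlt n), hatoms] with ω h1 h2 t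
  obtain ⟨n, hn⟩ := exists_nat_ge (t : ℝ)
  have h3 := h1 n
  rw [h2, ← count, count_eq_tsum _ _ (hS n)] at h3
  refine (ENNReal.finite_const_le_of_tsum_ne_top h3 one_ne_zero).subset fun i hi => ?_
  have : τ i ω ≤ n := le_trans hi hn
  simp [this]

lemma isUniformInput_of_isPoissonPointProcess {N : Ω → Measure (ℝ × ℝ × ℝ)}
    (hN : IsPoissonPointProcess N intensity P)
    (hτ : ∀ i, Measurable (τ i)) (hp : ∀ i, Measurable (p i))
    (hatoms : ∀ᵐ ω ∂P, N ω = Measure.sum (fun i => Measure.dirac (τ i ω, p i ω)))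
    (hrank : ∀ᵐ ω ∂P, StrictMono (fun i => τ i ω)) : IsUniformInput P τ p :=
  ⟨hτ, hp, map_position hN hτ hp hatoms hrank, indepFun_past_position hN hτ hp hatoms hrank⟩

end

end Quadtree
-- The theorem on the martingale M_t(x) and its limit
theorem proposition3 {Ω : Type*} [mΩ : MeasurableSpace Ω] (P : Measure Ω)
    [IsProbabilityMeasure P]
    (N : Ω → Measure (ℝ × ℝ × ℝ))
    (hN : IsPoissonPointProcess N Quadtree.intensity P)
    (τ : ℕ → Ω → ℝ) (p : ℕ → Ω → ℝ × ℝ)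
    (hτ : ∀ i, Measurable (τ i)) (hp : ∀ i, Measurable (p i))
    (hatoms : ∀ᵐ ω ∂P, N ω = Measure.sum (fun i => Measure.dirac (τ i ω, p i ω)))
    (hrank : ∀ᵐ ω ∂P, StrictMono (fun i => τ i ω)) :
    ∃ ℱ : Filtration ℝ≥0 mΩ, (∀ t, ℱ t = Quadtree.history τ p t) ∧
      ∀ x ∈ Set.Icc (0 : ℝ) 1,
        let M : ℝ≥0 → Ω → ℝ := fun t ω => Quadtree.M (fun i => τ i ω) (fun i => p i ω) x t
        let Mgen : ℕ → Ω → ℝ := fun n ω => Quadtree.Mgen (fun i => p i ω) x n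
        (∀ t ω, 0 ≤ M t ω) ∧
        Martingale M ℱ P ∧
        ∃ Minf : Ω → ℝ,
          (∀ᵐ ω ∂P, Tendsto (fun n => Mgen n ω) atTop (𝓝 (Minf ω))) ∧
          (∀ᵐ ω ∂P, Tendsto (fun t => M t ω) atTop (𝓝 (Minf ω))) ∧
          (∀ t, M t =ᵐ[P] P[Minf | ℱ t]) ∧
          ∀ q : ℝ≥0∞, 1 < q → q ≠ ⊤ →
            MemLp Minf q P ∧ (∀ n, MemLp (Mgen n) q P) ∧ (∀ t, MemLp (M t) q P) ∧
            Tendsto (fun n => eLpNorm (Mgen n - Minf) q P) atTop (𝓝 0) ∧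
            Tendsto (fun t => eLpNorm (M t - Minf) q P) atTop (𝓝 0) := by
  have hI := Quadtree.isUniformInput_of_isPoissonPointProcess hN hτ hp hatoms hrank
  have hfin := Quadtree.ae_finite_atoms hN hatoms
  refine ⟨Quadtree.quadFiltration hτ hp, fun t => rfl, fun x _ => ?_⟩
  intro M Mgen
  have hK : 0 ≤ Real.exp 2 := (Real.exp_pos 2).le
  have hθ := Quadtree.expRate_pos
  refine ⟨fun t ω => ?_, hI.martingale_M hfin x, Quadtree.limitWeight p x, hI.ae_tendsto_Mgen x,
    hI.ae_tendsto_M hfin hrank x, hI.M_ae_eq_condExp hfin x, fun q hq hq' => ?_⟩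
  · simp only [M, Quadtree.M_eq_capWeight]
    exact Quadtree.capWeight_nonneg _ _ _ _ _
  · refine ⟨(hI.expBounded_limitWeight x).memLp hθ hq.le hq',
      fun n => (hI.expBounded_Mgen x n).memLp hθ hq.le hq',
      fun t => (hI.expBounded_M hfin x t).memLp hθ hq.le hq',
      tendsto_eLpNorm_of_expBounded hθ hK (hI.expBounded_Mgen x) (hI.ae_tendsto_Mgen x) hq.le hq',
      ?_⟩
    -- The filter at infinity on the half-line is countably generated, so sequences of times
    -- suffice. The almost sure limit along all `t` restricts to each of them.
    refine tendsto_of_seq_tendsto fun u hu => ?_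
    refine tendsto_eLpNorm_of_expBounded hθ hK (fun n => hI.expBounded_M hfin x (u n)) ?_ hq.le hq'
    filter_upwards [hI.ae_tendsto_M hfin hrank x] with ω hω
    exact hω.comp hu
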